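/- Let $p$ be a prime, $|\cdot|$ the absolute value of $\mathbb{C}_p$ with $|p|=1/p$, and $\varrho:=p^{-1/(p-1)}$. Let $\mathbf r=(R_j)_{j\ge1}$ be a strictly increasing sequence of real numbers with $R_1>p$ and $R_j\to\infty$; let $\mathcal C(\mathbf r)$ be the set of sequences $\mathbf c=(c_j)_{j\ge1}$ in $\mathbb{C}_p$ with $|c_j|=R_j$ for all $j$. For $\mathbf c\in\mathcal C(\mathbf r)$ put $$f_{\mathbf c}(z)=\frac{z^p}{p}\prod_{j\ge1}\Bigl(1-\frac z{c_j}\Bigr),\qquad \varphi(r)=\sup\{|f_{\mathbf c}(z)|:|z|\le r\}\quad(r>0);$$ $\varphi:\,]0,\infty[\,\to\,]0,\infty[$ is a bijection that depends only on $\mathbf r$. Assume that $\mathbf r$ is generic: $\varphi^{\circ n}(R_i)\ne R_j$ for all $j>i\ge1$ and $n\ge1$. Put $S_j=\varphi^{-1}(R_j)$. Given $\mathbf c$, let $B_0=\{|z|<1\}$, $B_j=\{|z-c_j|<R_j\}$ for $j\ge1$, and $A=\mathbb{C}_p\setminus\bigcup_{j\ge0}B_j$. A point $x\in\mathbb{C}_p$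 (that is, a type I point of the Berkovich affine line) has itinerary $\alpha_0\alpha_1\alpha_2\cdots$ under $f_{\mathbf c}$ if $f_{\mathbf c}^{\circ n}(x)\in\alpha_n$ for all $n\ge0$. For $j\ge1$ let $n_j=\min\{n\ge1: f_{\mathbf c}^{-(n+1)}(B_j)\cap B_0\ne\emptyset\}$ and let $\lambda_j$ be the multiplier of the unique fixed point of $f_{\mathbf c}$ in $B_j$; $n_j$ and $|\lambda_j|$ depend only on $\mathbf r$. Let $\mathbf m=(m_j)_{j\ge1}$ and $\boldsymbol\ell=(\ell_j)_{j\ge2}$ be sequences of positive integers and $\boldsymbol\varepsilon=(\varepsilon_j)_{j\ge1}$ a sequence of real numbers with $0<\varepsilon_j<R_j$. For $k\ge1$ let $$\alpha^{(k)}=B_0^{m_1}A^{n_1}B_1^{\ell_2}B_0^{m_2}A^{n_2}B_2^{\ell_3}\cdots B_{k-1}^{\ell_k}B_0^{m_k}A^{n_k}B_k .$$ **Connecting Lemma.** Let $k\ge1$ and assume that * (stability for $k$) $\displaystyle \varepsilon_k<\varrho^{\,k-j}\,\frac{R_k^2}{R_{j-1}S_{j-1}}\,|\lambda_{j-1}|^{-\ell_j}$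 for all $2\le j<k$; * (transversality for $k$) $\displaystyle \varrho^{-2}R_{j-1}S_{j-1}\,|\lambda_{j-1}|^{\ell_j}\,p^{-m_j}<1$ for all $2\le j\le k$; * (connecting inequality) $\displaystyle p\,\varrho^{-1}\,\frac{R_{k+1}^2}{S_k}\,|\lambda_k|^{-\ell_{k+1}}<\varepsilon_{k+1}$. If $\mathbf c\in\mathcal C(\mathbf r)$ and $x\in\mathbb{C}_p$ has itinerary $\alpha^{(k)}B_k^\infty$ under $f_{\mathbf c}$, then there is $\mathbf c'=(c'_j)\in\mathcal C(\mathbf r)$ with $c'_j=c_j$ for all $j\ne k+1$ and $|c'_{k+1}-c_{k+1}|<\varepsilon_{k+1}$ such that $x$ has itinerary $\alpha^{(k+1)}B_{k+1}^\infty$ under $f_{\mathbf c'}$. -/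

import Mathlib

/-- Letters of the alphabet `{A, B_0, B_1, B_2, …}`. -/
inductive Letter : Type
  | A : Letter
  | B : ℕ → Letter

noncomputable section

/-- The parameter space `𝒞(r)`: sequences `(c_j)_{j ≥ 1}` in `ℂ_p` with `|c_j| = R_j`.
All sequences are indexed from `1`; the entry with index `0` is never used. -/
def paramSpace (p : ℕ) [Fact p.Prime] (R : ℕ → ℝ) : Set (ℕ → ℂ_[p]) :=
  {c | ∀ j, 1 ≤ j → ‖c j‖ = R j}

/-- The entire map `f_c(z) = (z ^ p / p) ∏_{j ≥ 1} (1 - z / c_j)`. -/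
def entireMap (p : ℕ) [Fact p.Prime] (c : ℕ → ℂ_[p]) (z : ℂ_[p]) : ℂ_[p] :=
  z ^ p / (p : ℂ_[p]) * ∏' j : ℕ, (1 - z / c (j + 1))

/-- `φ(r) = sup {|f_c(z)| : |z| ≤ r}`. -/
def growth (p : ℕ) [Fact p.Prime] (c : ℕ → ℂ_[p]) (r : ℝ) : ℝ :=
  sSup {y : ℝ | ∃ z : ℂ_[p], ‖z‖ ≤ r ∧ y = ‖entireMap p c z‖}

/-- Generic sequences of radii `(R_j)_{j ≥ 1}`: strictly increasing, tending to infinity, `R_1 > p`,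
and `φ^n(R_i) ≠ R_j` for all `j > i ≥ 1` and `n ≥ 1`.  (The function `φ` is the same for all
parameters in `𝒞(r)`.) -/
structure IsGenericRadii (p : ℕ) [Fact p.Prime] (R : ℕ → ℝ) : Prop where
  increasing : ∀ i j, 1 ≤ i → i < j → R i < R j
  tendsto : Filter.Tendsto R Filter.atTop Filter.atTop
  lower : (p : ℝ) < R 1
  independent : ∀ c ∈ paramSpace p R, ∀ i j n : ℕ, 1 ≤ i → i < j → 1 ≤ n →
    (growth p c)^[n] (R i) ≠ R j

/-- The disks `B_0 = D(0, 1)` and `B_j = D(c_j, R_j)`, `j ≥ 1` (their classical points). -/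
def diskB (p : ℕ) [Fact p.Prime] (R : ℕ → ℝ) (c : ℕ → ℂ_[p]) (j : ℕ) : Set ℂ_[p] :=
  if j = 0 then {z | ‖z‖ < 1} else {z | ‖z - c j‖ < R j}

/-- The dynamical partition: `B_j`, `j ≥ 0`, and the complement `A` of their union. -/
def piece (p : ℕ) [Fact p.Prime] (R : ℕ → ℝ) (c : ℕ → ℂ_[p]) : Letter → Set ℂ_[p]
  | Letter.A => (⋃ j : ℕ, diskB p R c j)ᶜ
  | Letter.B j => diskB p R c j

/-- `itin_c(x) = α`: `f_c^n(x)` lies in the piece `α_n`, for all `n ≥ 0`. -/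
def HasItinerary (p : ℕ) [Fact p.Prime] (R : ℕ → ℝ) (c : ℕ → ℂ_[p]) (x : ℂ_[p])
    (α : ℕ → Letter) : Prop :=
  ∀ n : ℕ, (entireMap p c)^[n] x ∈ piece p R c (α n)

/-- The transition time `n_j = min {n ≥ 1 : f_c^{-(n+1)}(B_j) ∩ B_0 ≠ ∅}`, for `j ≥ 1`. -/
def transitTime (p : ℕ) [Fact p.Prime] (R : ℕ → ℝ) (c : ℕ → ℂ_[p]) (j : ℕ) : ℕ :=
  sInf {n : ℕ | 1 ≤ n ∧
    (((entireMap p c)^[n + 1]) ⁻¹' diskB p R c j ∩ diskB p R c 0).Nonempty}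

/-- The fixed point `w_j(c)` of `f_c` in `B_j` (it is unique), for `j ≥ 1`. -/
def fixedPt (p : ℕ) [Fact p.Prime] (R : ℕ → ℝ) (c : ℕ → ℂ_[p]) (j : ℕ) : ℂ_[p] :=
  Classical.epsilon fun w => w ∈ diskB p R c j ∧ entireMap p c w = w

/-- The multiplier `λ_j` of the fixed point `w_j(c)`. -/
def multiplier (p : ℕ) [Fact p.Prime] (R : ℕ → ℝ) (c : ℕ → ℂ_[p]) (j : ℕ) : ℂ_[p] :=
  deriv (entireMap p c) (fixedPt p R c j)

/-- `S_j = φ⁻¹(R_j)`, where `φ` is regarded as a bijection of `]0, ∞[`. -/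
def radiusS (p : ℕ) [Fact p.Prime] (R : ℕ → ℝ) (c : ℕ → ℂ_[p]) (j : ℕ) : ℝ :=
  Function.invFunOn (growth p c) (Set.Ioi 0) (R j)

/-- `ϱ = p ^ (-1 / (p - 1))`. -/
def rho (p : ℕ) : ℝ := (p : ℝ) ^ (-1 / ((p : ℝ) - 1))

/-- The word `B_0^{m_j} A^{n_j}`. -/
def wildWord (m n : ℕ → ℕ) (j : ℕ) : List Letter :=
  List.replicate (m j) (Letter.B 0) ++ List.replicate (n j) Letter.A

/-- The truncation `α^{(k)} = B_0^{m_1} A^{n_1} B_1^{ℓ_2} ⋯ B_{k-1}^{ℓ_k} B_0^{m_k} A^{n_k} B_k`. -/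
def truncWord (m l n : ℕ → ℕ) (k : ℕ) : List Letter :=
  (List.Ico 1 k).flatMap
      (fun j => wildWord m n j ++ List.replicate (l (j + 1)) (Letter.B j)) ++
    wildWord m n k ++ [Letter.B k]

/-- The infinite word `w s^∞`. -/
def padWord (w : List Letter) (s : Letter) : ℕ → Letter :=
  fun i => w.getD i s

/-- The stability inequality for `k`. -/
def StabilityAt (p : ℕ) [Fact p.Prime] (R : ℕ → ℝ) (c : ℕ → ℂ_[p]) (ε : ℕ → ℝ) (l : ℕ → ℕ)
    (k : ℕ) : Prop :=
  ∀ j : ℕ, 2 ≤ j → j < k →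
    ε k < rho p ^ (k - j) * (R k ^ 2 / (R (j - 1) * radiusS p R c (j - 1))) *
      ‖multiplier p R c (j - 1)‖ ^ (-(l j : ℤ))

/-- The transversality inequality for `k`, that is, for all `2 ≤ j ≤ k`. -/
def TransversalityAt (p : ℕ) [Fact p.Prime] (R : ℕ → ℝ) (c : ℕ → ℂ_[p]) (m l : ℕ → ℕ)
    (k : ℕ) : Prop :=
  ∀ j : ℕ, 2 ≤ j → j ≤ k →
    rho p ^ (-2 : ℤ) * R (j - 1) * radiusS p R c (j - 1) *
      ‖multiplier p R c (j - 1)‖ ^ (l j) * (p : ℝ) ^ (-(m j : ℤ)) < 1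

/-- The connecting inequality for `k`. -/
def ConnectingAt (p : ℕ) [Fact p.Prime] (R : ℕ → ℝ) (c : ℕ → ℂ_[p]) (ε : ℕ → ℝ) (l : ℕ → ℕ)
    (k : ℕ) : Prop :=
  (p : ℝ) * (rho p)⁻¹ * (R (k + 1) ^ 2 / radiusS p R c k) *
    ‖multiplier p R c k‖ ^ (-(l (k + 1) : ℤ)) < ε (k + 1)

/-- The set `U_k(c, ε_k)` of parameters that differ from `c` only in the `k`-th entry, by less
than `ε_k`. -/
def oneEntryNhd (p : ℕ) [Fact p.Prime] (R : ℕ → ℝ) (c : ℕ → ℂ_[p]) (k : ℕ) (e : ℝ) :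
    Set (ℕ → ℂ_[p]) :=
  {c' | c' ∈ paramSpace p R ∧ ‖c' k - c k‖ < e ∧ ∀ j, 1 ≤ j → j ≠ k → c' j = c j}

end

/-!
The parameters that differ from `c` only in the entry `c_{k+1}` are parametrized by the fixed point
`y` of the map in `B_{k+1}` (`fixingParam`); this parametrization is an isometry
(`norm_fixingParam_sub`).  For fixed `j` the orbit point `x_j(y) = f_{c(y)}^j(x)` is then an
analytic function of `y` on a disc around the fixed point `w` of `f_c`, and the task is to find `y`
with `|y - w| < ε_{k+1}` such that `x_j(y) = y` at the right time `j` and such that the earlier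
orbit points lie in the right pieces.  Analytic functions on discs of `ℂ_p` are handled as uniform
limits of polynomials, and three facts about them are used: the maximum principle and the
Schwarz lemma `|h(s) - h(a)| ≤ C |s - a| / r`; a function without zeros has constant norm
(`IsAnalyticOnDisc.norm_eq_of_ne_zero`); and if the norm is not constant on a disc around `a`, then
there is a zero closest to `a`, up to which the norm is constant
(`IsAnalyticOnDisc.exists_closest_zero`).

On the dynamical side, `|f_c(z)| = Φ(|z|)` for all `z` outside the discs `B_j`, `j ≥ 1`, with an
increasing function `Φ` (`radialGrowth`), and `f_c` multiplies all distances in `B_j` by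
`Φ(R_j) / R_j`, which is therefore the norm of the multiplier.  The piece containing `z` can be read
off from `|z|` and `|f_c(z)|` (`mem_piece_of_norm_eq`), so that it is enough to control norms along
orbits.  The letters of `B_0^{m} A^{n} B_{k+1}` correspond to the norms `Φ^{-i}(R_{k+1})`, which are
less than `1` exactly for `i > n`.

Let `L` be the time at which the orbit of `x` reaches the fixed point in `B_k`.

* If `y` is very close to `w`, then the deviation `|x_L(y) - x_L(w)|` can be computed
  (`HasBlocks.deviation_block`): by transversality, the contraction in `B_0` makes the deviation
  coming from the previous blocks negligible against the one created by moving `c_{k+1}` at the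
  entry into `B_k`, which then grows by the factor `|λ_k|` in each of the `ℓ_{k+1}` steps in `B_k`.
  With the connecting inequality, the Schwarz lemma shows that `x_L` cannot be bounded by `R_k` on
  all discs of radius less than `ε_{k+1}` (`HasBlocks.exists_norm_gt`).
* Hence `x_L` has a zero; let `s` be the one closest to `w`.  For `|y - w| ≤ |s - w|` none of the
  functions `x_j`, `j < L`, has a zero, so that their norms are constant, and the orbit of `x` stays
  in the pieces prescribed by the original itinerary (`HasBlocks.exists_orbit_eq_zero`).
* Since `x_L(s) = 0` and `|x_L(w)| = R_k ≥ 1`, the function `x_{L+M}(y) - y` does not have constant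
  norm on the disc around `s` that contains `w`, where `M = m_{k+1} + n_{k+1}`.  At its zero closest
  to `s`, the norms of `x_L, …, x_{L+M}` are the numbers `Φ^{-i}(R_{k+1})`, which give the word
  `B_0^{m_{k+1}} A^{n_{k+1}}` (`exists_orbit_eq_fixed`).
-/

open Filter Topology


/-! ### Ultrametric preliminaries -/

section Ultrametric

variable {K : Type*} [NontriviallyNormedField K] [IsUltrametricDist K]

theorem ultra_sub_le (x y : K) : ‖x - y‖ ≤ max ‖x‖ ‖y‖ := by
  simpa [sub_eq_add_neg] using IsUltrametricDist.norm_add_le_max x (-y)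

theorem ultra_sub_lt {x y : K} {C : ℝ} (hx : ‖x‖ < C) (hy : ‖y‖ < C) : ‖x - y‖ < C :=
  (ultra_sub_le x y).trans_lt (max_lt hx hy)

theorem ultra_add_lt {x y : K} {C : ℝ} (hx : ‖x‖ < C) (hy : ‖y‖ < C) : ‖x + y‖ < C :=
  (IsUltrametricDist.norm_add_le_max x y).trans_lt (max_lt hx hy)

theorem ultra_add_le {x y : K} {C : ℝ} (hx : ‖x‖ ≤ C) (hy : ‖y‖ ≤ C) : ‖x + y‖ ≤ C :=
  (IsUltrametricDist.norm_add_le_max x y).trans (max_le hx hy)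

theorem ultra_sub_trans_le {x y z : K} {C : ℝ} (h : ‖x - y‖ ≤ C) (h' : ‖y - z‖ ≤ C) :
    ‖x - z‖ ≤ C := by
  simpa using ultra_add_le h h'

theorem ultra_sub_trans_lt {x y z : K} {C : ℝ} (h : ‖x - y‖ < C) (h' : ‖y - z‖ < C) :
    ‖x - z‖ < C := by
  simpa using ultra_add_lt h h'

theorem ultra_sub_eq_left {x y : K} (h : ‖y‖ < ‖x‖) : ‖x - y‖ = ‖x‖ := by
  have := IsUltrametricDist.norm_add_eq_max_of_norm_ne_norm (x := x) (y := -y)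
    (by rw [norm_neg]; exact h.ne')
  rw [sub_eq_add_neg, this, norm_neg, max_eq_left h.le]

theorem ultra_sub_eq_right {x y : K} (h : ‖x‖ < ‖y‖) : ‖x - y‖ = ‖y‖ := by
  rw [norm_sub_rev, ultra_sub_eq_left h]

theorem ultra_sub_eq_max {x y : K} (h : ‖x‖ ≠ ‖y‖) : ‖x - y‖ = max ‖x‖ ‖y‖ := by
  rcases lt_or_gt_of_ne h with h | h
  · rw [ultra_sub_eq_right h, max_eq_right h.le]
  · rw [ultra_sub_eq_left h, max_eq_left h.le]

theorem ultra_add_eq_left {x y : K} (h : ‖y‖ < ‖x‖) : ‖x + y‖ = ‖x‖ := by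
  rw [← sub_neg_eq_add, ultra_sub_eq_left (by rwa [norm_neg])]

theorem ultra_norm_eq_of_sub_lt {x y : K} (h : ‖x - y‖ < ‖y‖) : ‖x‖ = ‖y‖ := by
  have := ultra_add_eq_left h
  simpa using this

end Ultrametric

section Density

variable {K : Type*} [NontriviallyNormedField K] [IsAlgClosed K]

/-- The norms of an algebraically closed field are dense in the positive reals: a root of high
order of an element of norm less than `1` has norm close to `1`. -/
theorem exists_norm_mem_Ioo {a b : ℝ} (ha : 0 < a) (hab : a < b) :
    ∃ z : K, ‖z‖ ∈ Set.Ioo a b := by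
  obtain ⟨w, hw⟩ := NormedField.exists_one_lt_norm K
  have hb1 : 1 < b / a := by rwa [one_lt_div ha]
  obtain ⟨n, hn⟩ := pow_unbounded_of_one_lt ‖w‖ hb1
  have hn0 : n ≠ 0 := by
    rintro rfl
    simp at hn
    linarith
  obtain ⟨t, ht⟩ := IsAlgClosed.exists_pow_nat_eq w (Nat.pos_of_ne_zero hn0)
  have htn : ‖t‖ ^ n = ‖w‖ := by rw [← norm_pow, ht]
  have ht1 : 1 < ‖t‖ := by
    by_contra! h
    have := pow_le_one₀ (n := n) (norm_nonneg t) h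
    linarith
  have htb : ‖t‖ < b / a := by
    by_contra! h
    have := pow_le_pow_left₀ (by positivity) h n
    linarith
  obtain ⟨i, hi1, h⟩ := exists_mem_Ico_zpow ha ht1
  refine ⟨t ^ (i + 1), ?_⟩
  rw [norm_zpow]
  refine ⟨h, ?_⟩
  rw [zpow_add_one₀ (by positivity)]
  calc ‖t‖ ^ i * ‖t‖ < a * (b / a) := mul_lt_mul' hi1 htb (by positivity) ha
    _ = b := by field_simp

/-- Norms of elements can be chosen in any interval, away from finitely many values. -/
theorem exists_norm_mem_Ioo_notMem {a b : ℝ} (ha : 0 ≤ a) (hab : a < b) (s : Finset ℝ) :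
    ∃ z : K, ‖z‖ ∈ Set.Ioo a b ∧ ‖z‖ ∉ s := by
  have hopen : IsOpen (Set.Ioo a b \ (s : Set ℝ)) := isOpen_Ioo.sdiff s.finite_toSet.isClosed
  obtain ⟨t, ht⟩ : (Set.Ioo a b \ (s : Set ℝ)).Nonempty :=
    ((Set.Ioo_infinite hab).sdiff s.finite_toSet).nonempty
  obtain ⟨u, hu, hsub⟩ := exists_Ico_subset_of_mem_nhds (hopen.mem_nhds ht) ⟨b, ht.1.2⟩
  obtain ⟨z, hz⟩ := exists_norm_mem_Ioo (K := K) (ha.trans_lt ht.1.1) hu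
  have := hsub ⟨hz.1.le, hz.2⟩
  exact ⟨z, this.1, by simpa using this.2⟩

end Density

/-! ### The maximum modulus of a polynomial on a disc -/

section MaxMod

variable {K : Type*} [NontriviallyNormedField K] [IsUltrametricDist K] [IsAlgClosed K]

theorem norm_multiset_map_prod {α F : Type*} [NormedField F] (m : Multiset α) (f : α → F) :
    ‖(m.map f).prod‖ = (m.map fun x => ‖f x‖).prod := by
  induction m using Multiset.induction_on with
  | empty => simp
  | cons a m ih => simp [ih]

theorem norm_eval_eq_prod_roots {F : Type*} [NormedField F] [IsAlgClosed F] (P : Polynomial F)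
    (s : F) : ‖P.eval s‖ = ‖P.leadingCoeff‖ * (P.roots.map fun ζ => ‖s - ζ‖).prod := by
  rw [(IsAlgClosed.splits P).eval_eq_prod_roots, norm_mul, norm_multiset_map_prod]

/-- The maximum modulus of `P` on the disc with centre `a` and radius `σ`, computed from the roots
of `P`: each linear factor `s - ζ` contributes `max σ |ζ - a|`. -/
noncomputable def maxMod {F : Type*} [NormedField F] (P : Polynomial F) (a : F) (σ : ℝ) : ℝ :=
  ‖P.leadingCoeff‖ * (P.roots.map fun ζ => max σ ‖ζ - a‖).prod

theorem norm_eval_le_maxMod (P : Polynomial K) (a s : K) :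
    ‖P.eval s‖ ≤ maxMod P a ‖s - a‖ := by
  rw [norm_eval_eq_prod_roots, maxMod]
  gcongr
  refine Multiset.prod_map_le_prod_map₀ _ _ (fun _ _ => norm_nonneg _) fun ζ _ => ?_
  simpa using ultra_sub_le (s - a) (ζ - a)

theorem norm_eval_eq_maxMod (P : Polynomial K) (a s : K)
    (h : ∀ ζ ∈ P.roots, ‖s - a‖ ≠ ‖ζ - a‖) : ‖P.eval s‖ = maxMod P a ‖s - a‖ := by
  rw [norm_eval_eq_prod_roots, maxMod]
  congr 2
  refine Multiset.map_congr rfl fun ζ hζ => ?_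
  simpa using ultra_sub_eq_max (h ζ hζ)

theorem continuous_maxMod {F : Type*} [NormedField F] (P : Polynomial F) (a : F) : Continuous (maxMod P a) := by
  unfold maxMod
  refine continuous_const.mul ?_
  induction P.roots using Multiset.induction_on with
  | empty => simpa using continuous_const
  | cons ζ m ih =>
    simp only [Multiset.map_cons, Multiset.prod_cons]
    exact (continuous_id.max continuous_const).mul ih

theorem maxMod_mono {F : Type*} [NormedField F] (P : Polynomial F) (a : F) {σ r : ℝ} (hσ : 0 ≤ σ) (h : σ ≤ r) :
    maxMod P a σ ≤ maxMod P a r := by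
  unfold maxMod
  gcongr
  refine Multiset.prod_map_le_prod_map₀ _ _ (fun _ _ => by positivity) fun ζ _ => ?_
  exact max_le_max_right _ h

/-- A bound on the open disc bounds the maximum modulus of the closed disc. -/
theorem maxMod_le (P : Polynomial K) (a : K) {r C : ℝ} (hr : 0 < r)
    (h : ∀ s, ‖s - a‖ < r → ‖P.eval s‖ ≤ C) : maxMod P a r ≤ C := by
  by_contra! hC
  have hev : ∀ᶠ σ in 𝓝 r, C < maxMod P a σ :=
    (continuous_maxMod P a).continuousAt.eventually (lt_mem_nhds hC)
  obtain ⟨σ, hσ, hsub⟩ := exists_Ioc_subset_of_mem_nhds hev ⟨0, hr⟩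
  obtain ⟨z, hz, hzr⟩ := exists_norm_mem_Ioo_notMem (K := K) (le_max_left 0 σ)
    (max_lt hr hσ) (P.roots.map fun ζ => ‖ζ - a‖).toFinset
  have h1 := h (a + z) (by simpa using hz.2)
  rw [norm_eval_eq_maxMod P a (a + z) ?_] at h1
  · have h2 : C < maxMod P a ‖z‖ := hsub ⟨(le_max_right 0 σ).trans_lt hz.1, hz.2.le⟩
    simp at h1
    linarith
  · intro ζ hζ hne
    apply hzr
    rw [Multiset.mem_toFinset, Multiset.mem_map]
    exact ⟨ζ, hζ, by simpa using hne.symm⟩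

/-- The maximum modulus principle: a bound on the open disc extends to the closed disc. -/
theorem norm_eval_le_of_open (P : Polynomial K) (a : K) {r C : ℝ} (hr : 0 < r)
    (h : ∀ s, ‖s - a‖ < r → ‖P.eval s‖ ≤ C) {s : K} (hs : ‖s - a‖ ≤ r) : ‖P.eval s‖ ≤ C :=
  (norm_eval_le_maxMod P a s).trans
    ((maxMod_mono P a (norm_nonneg _) hs).trans (maxMod_le P a hr h))

/-- The Schwarz lemma for a polynomial that vanishes at the centre of the disc. -/
theorem norm_eval_le_mul_of_root (P : Polynomial K) (a : K) {r C : ℝ} (hr : 0 < r)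
    (h0 : P.eval a = 0) (h : ∀ s, ‖s - a‖ ≤ r → ‖P.eval s‖ ≤ C) {s : K} (hs : ‖s - a‖ ≤ r) :
    ‖P.eval s‖ ≤ C * ‖s - a‖ / r := by
  obtain ⟨Q, rfl⟩ := Polynomial.dvd_iff_isRoot.2 h0
  have hC : 0 ≤ C := by simpa using h a (by simpa using hr.le)
  rcases eq_or_ne Q 0 with rfl | hQ0
  · simp only [mul_zero, Polynomial.eval_zero, norm_zero]
    positivity
  have hmax : r * maxMod Q a r ≤ C := by
    refine le_of_eq_of_le ?_ (maxMod_le _ a hr fun s hs => h s hs.le)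
    have hne := mul_ne_zero (Polynomial.X_sub_C_ne_zero a) hQ0
    rw [maxMod, maxMod, Polynomial.roots_mul hne, Polynomial.leadingCoeff_mul]
    simp only [Polynomial.leadingCoeff_X_sub_C, one_mul, Polynomial.roots_X_sub_C,
      Multiset.map_add, Multiset.map_singleton, sub_self, norm_zero, Multiset.prod_add,
      Multiset.prod_singleton, max_eq_left hr.le]
    ring
  have hQ : ‖Q.eval s‖ ≤ C / r := by
    rw [le_div_iff₀' hr]
    refine le_trans ?_ hmax
    gcongr
    exact (norm_eval_le_maxMod Q a s).trans (maxMod_mono Q a (norm_nonneg _) hs)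
  simp only [Polynomial.eval_mul, Polynomial.eval_sub, Polynomial.eval_X, Polynomial.eval_C,
    norm_mul]
  calc ‖s - a‖ * ‖Q.eval s‖ ≤ ‖s - a‖ * (C / r) := by gcongr
    _ = _ := by ring

/-- A polynomial without roots in a disc has constant norm there. -/
theorem norm_eval_eq_of_no_root (P : Polynomial K) (a : K) {s : K}
    (h : ∀ ζ ∈ P.roots, ‖s - a‖ < ‖ζ - a‖) : ‖P.eval s‖ = ‖P.eval a‖ := by
  rw [norm_eval_eq_prod_roots, norm_eval_eq_prod_roots]
  congr 2
  refine Multiset.map_congr rfl fun ζ hζ => ?_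
  have := ultra_sub_eq_right (h ζ hζ)
  simp only [sub_sub_sub_cancel_right] at this
  rw [this, norm_sub_rev]

/-- Every root in the smaller disc forces the maximum modulus to grow by a factor `r₁ / r`. -/
theorem maxMod_mul_pow_le {F : Type*} [NormedField F] (P : Polynomial F) (a : F) {r r₁ : ℝ}
    (hr : 0 < r) (h : r ≤ r₁) :
    maxMod P a r * (r₁ / r) ^ (P.roots.filter fun ζ => ‖ζ - a‖ ≤ r).card ≤ maxMod P a r₁ := by
  have hr₁ : 0 < r₁ := hr.trans_le h
  unfold maxMod
  rw [mul_assoc]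
  gcongr
  induction P.roots using Multiset.induction_on with
  | empty => simp
  | cons ζ m ih =>
    have hm : 0 ≤ (m.map fun ζ => max r ‖ζ - a‖).prod :=
      Multiset.prod_nonneg fun x hx => by
        obtain ⟨ζ, -, rfl⟩ := Multiset.mem_map.1 hx
        positivity
    simp only [Multiset.map_cons, Multiset.prod_cons]
    by_cases hζ : ‖ζ - a‖ ≤ r
    · rw [Multiset.filter_cons_of_pos (p := fun ζ => ‖ζ - a‖ ≤ r) m hζ, Multiset.card_cons, pow_succ, max_eq_left hζ,
        max_eq_left (hζ.trans h)]
      calc _ = r₁ * ((m.map fun ζ => max r ‖ζ - a‖).prod *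
            (r₁ / r) ^ (m.filter fun ζ => ‖ζ - a‖ ≤ r).card) := by field_simp
        _ ≤ _ := by gcongr
    · rw [Multiset.filter_cons_of_neg (p := fun ζ => ‖ζ - a‖ ≤ r) m hζ, mul_assoc]
      gcongr

/-- If `P` is small at `z`, then it has a root near `z`. -/
theorem exists_root_near (P : Polynomial K) (a z : K) {r θ : ℝ} (hr : 0 < r) (hz : ‖z - a‖ ≤ r)
    (hθ : 0 < θ)
    (h : ‖P.eval z‖ < θ ^ (P.roots.filter fun ζ => ‖ζ - a‖ ≤ r).card * maxMod P a r) :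
    ∃ ζ ∈ P.roots, ‖ζ - z‖ ≤ θ * r := by
  by_contra! hno
  refine h.not_ge ?_
  rw [norm_eval_eq_prod_roots, maxMod, mul_left_comm]
  gcongr
  clear h
  revert hno
  induction P.roots using Multiset.induction_on with
  | empty => simp
  | cons ζ m ih =>
    intro hno
    have hm : 0 ≤ (m.map fun ζ => max r ‖ζ - a‖).prod :=
      Multiset.prod_nonneg fun x hx => by
        obtain ⟨ζ, -, rfl⟩ := Multiset.mem_map.1 hx
        positivity
    have hih := ih fun ζ hζ => hno ζ (Multiset.mem_cons_of_mem hζ)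
    have hζz := hno ζ (Multiset.mem_cons_self _ _)
    simp only [Multiset.map_cons, Multiset.prod_cons]
    by_cases hζ : ‖ζ - a‖ ≤ r
    · rw [Multiset.filter_cons_of_pos (p := fun ζ => ‖ζ - a‖ ≤ r) m hζ, Multiset.card_cons, pow_succ, max_eq_left hζ]
      rw [norm_sub_rev] at hζz
      calc _ = (θ * r) * (θ ^ (m.filter fun ζ => ‖ζ - a‖ ≤ r).card *
            (m.map fun ζ => max r ‖ζ - a‖).prod) := by ring
        _ ≤ _ := by gcongr
    · rw [Multiset.filter_cons_of_neg (p := fun ζ => ‖ζ - a‖ ≤ r) m hζ]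
      push Not at hζ
      have h1 : ‖z - ζ‖ = ‖ζ - a‖ := by
        have := ultra_sub_eq_right (hz.trans_lt hζ)
        simpa using this
      rw [h1, max_eq_right hζ.le, mul_left_comm]
      gcongr

end MaxMod

/-! ### Analytic functions on closed discs -/

/-- `h` is analytic on the closed disc `|s - a| ≤ r`: it is a uniform limit of polynomials there.
Values of `h` outside the disc are irrelevant. -/
def IsAnalyticOnDisc {K : Type*} [NormedField K] (a : K) (r : ℝ) (h : K → K) : Prop :=
  ∀ η : ℝ, 0 < η → ∃ P : Polynomial K, ∀ s, ‖s - a‖ ≤ r → ‖h s - P.eval s‖ ≤ η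

namespace IsAnalyticOnDisc

section Algebra

variable {K : Type*} [NontriviallyNormedField K] {a : K} {r : ℝ} {h h₁ h₂ : K → K}

theorem polynomial (P : Polynomial K) : IsAnalyticOnDisc a r fun s => P.eval s :=
  fun η hη => ⟨P, fun s _ => by simpa using hη.le⟩

theorem const (b : K) : IsAnalyticOnDisc a r fun _ => b := by
  simpa using polynomial (a := a) (r := r) (Polynomial.C b)

theorem id : IsAnalyticOnDisc a r fun s => s := by
  simpa using polynomial (a := a) (r := r) Polynomial.X

theorem congr (hh : IsAnalyticOnDisc a r h₁) (e : ∀ s, ‖s - a‖ ≤ r → h₁ s = h₂ s) :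
    IsAnalyticOnDisc a r h₂ := fun η hη => by
  obtain ⟨P, hP⟩ := hh η hη
  exact ⟨P, fun s hs => e s hs ▸ hP s hs⟩

theorem mono (hh : IsAnalyticOnDisc a r h) {r' : ℝ} (hr : r' ≤ r) :
    IsAnalyticOnDisc a r' h := fun η hη => by
  obtain ⟨P, hP⟩ := hh η hη
  exact ⟨P, fun s hs => hP s (hs.trans hr)⟩

theorem of_uniform_limit
    (hh : ∀ η : ℝ, 0 < η → ∃ g : K → K, IsAnalyticOnDisc a r g ∧
      ∀ s, ‖s - a‖ ≤ r → ‖h s - g s‖ ≤ η) : IsAnalyticOnDisc a r h := fun η hη => by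
  obtain ⟨g, hg, hle⟩ := hh (η / 2) (half_pos hη)
  obtain ⟨P, hP⟩ := hg (η / 2) (half_pos hη)
  refine ⟨P, fun s hs => ?_⟩
  have := norm_add_le (h s - g s) (g s - P.eval s)
  rw [sub_add_sub_cancel] at this
  linarith [hle s hs, hP s hs]

theorem polynomial_bounded (P : Polynomial K) (a : K) (r : ℝ) :
    ∃ C : ℝ, 0 < C ∧ ∀ s, ‖s - a‖ ≤ r → ‖P.eval s‖ ≤ C := by
  induction P using Polynomial.induction_on' with
  | add P Q hP hQ =>
    obtain ⟨C, hC, h1⟩ := hP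
    obtain ⟨D, hD, h2⟩ := hQ
    refine ⟨C + D, by positivity, fun s hs => ?_⟩
    rw [Polynomial.eval_add]
    exact (norm_add_le _ _).trans (add_le_add (h1 s hs) (h2 s hs))
  | monomial n b =>
    refine ⟨‖b‖ * (|r| + ‖a‖) ^ n + 1, by positivity, fun s hs => ?_⟩
    rw [Polynomial.eval_monomial, norm_mul, norm_pow]
    have : ‖s‖ ≤ |r| + ‖a‖ := by
      have := norm_add_le (s - a) a
      rw [sub_add_cancel] at this
      linarith [le_abs_self r]
    have : ‖b‖ * ‖s‖ ^ n ≤ ‖b‖ * (|r| + ‖a‖) ^ n := by gcongr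
    linarith

theorem bounded (hh : IsAnalyticOnDisc a r h) :
    ∃ C : ℝ, 0 < C ∧ ∀ s, ‖s - a‖ ≤ r → ‖h s‖ ≤ C := by
  obtain ⟨P, hP⟩ := hh 1 one_pos
  obtain ⟨C, hC, hle⟩ := polynomial_bounded P a r
  refine ⟨1 + C, by positivity, fun s hs => ?_⟩
  have := norm_add_le (h s - P.eval s) (P.eval s)
  rw [sub_add_cancel] at this
  linarith [hP s hs, hle s hs]

theorem add (hh₁ : IsAnalyticOnDisc a r h₁) (hh₂ : IsAnalyticOnDisc a r h₂) :
    IsAnalyticOnDisc a r fun s => h₁ s + h₂ s := fun η hη => by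
  obtain ⟨P, hP⟩ := hh₁ (η / 2) (half_pos hη)
  obtain ⟨Q, hQ⟩ := hh₂ (η / 2) (half_pos hη)
  refine ⟨P + Q, fun s hs => ?_⟩
  rw [Polynomial.eval_add, add_sub_add_comm]
  exact (norm_add_le _ _).trans (by linarith [hP s hs, hQ s hs])

theorem mul (hh₁ : IsAnalyticOnDisc a r h₁) (hh₂ : IsAnalyticOnDisc a r h₂) :
    IsAnalyticOnDisc a r fun s => h₁ s * h₂ s := fun η hη => by
  obtain ⟨C, hC, hle⟩ := hh₂.bounded
  obtain ⟨P, hP⟩ := hh₁ (η / 2 / C) (by positivity)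
  obtain ⟨D, hD, hle'⟩ := polynomial_bounded P a r
  obtain ⟨Q, hQ⟩ := hh₂ (η / 2 / D) (by positivity)
  refine ⟨P * Q, fun s hs => ?_⟩
  have e : h₁ s * h₂ s - P.eval s * Q.eval s =
    (h₁ s - P.eval s) * h₂ s + P.eval s * (h₂ s - Q.eval s) := by ring
  rw [Polynomial.eval_mul, e]
  refine (norm_add_le _ _).trans ?_
  rw [norm_mul, norm_mul]
  calc _ ≤ η / 2 / C * C + D * (η / 2 / D) :=
        add_le_add (mul_le_mul (hP s hs) (hle s hs) (norm_nonneg _) (by positivity))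
          (mul_le_mul (hle' s hs) (hQ s hs) (norm_nonneg _) hD.le)
    _ = η := by field_simp; ring

theorem const_mul (b : K) (hh : IsAnalyticOnDisc a r h) :
    IsAnalyticOnDisc a r fun s => b * h s := (const b).mul hh

theorem sub (hh₁ : IsAnalyticOnDisc a r h₁) (hh₂ : IsAnalyticOnDisc a r h₂) :
    IsAnalyticOnDisc a r fun s => h₁ s - h₂ s :=
  (hh₁.add (hh₂.const_mul (-1))).congr fun s _ => by ring

theorem pow (hh : IsAnalyticOnDisc a r h) (n : ℕ) : IsAnalyticOnDisc a r fun s => h s ^ n := by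
  induction n with
  | zero => simpa using const (a := a) (r := r) (1 : K)
  | succ n ih => simpa only [pow_succ] using ih.mul hh

theorem prod {ι : Type*} (t : Finset ι) {g : ι → K → K}
    (hg : ∀ i ∈ t, IsAnalyticOnDisc a r (g i)) :
    IsAnalyticOnDisc a r fun s => ∏ i ∈ t, g i s := by
  classical
  induction t using Finset.induction_on with
  | empty => simpa using const (a := a) (r := r) (1 : K)
  | insert i t hi ih =>
    simp only [Finset.prod_insert hi]
    exact (hg i (Finset.mem_insert_self _ _)).mul
      (ih fun j hj => hg j (Finset.mem_insert_of_mem hj))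

theorem sum {ι : Type*} (t : Finset ι) {g : ι → K → K}
    (hg : ∀ i ∈ t, IsAnalyticOnDisc a r (g i)) :
    IsAnalyticOnDisc a r fun s => ∑ i ∈ t, g i s := by
  classical
  induction t using Finset.induction_on with
  | empty => simpa using const (a := a) (r := r) (0 : K)
  | insert i t hi ih =>
    simp only [Finset.sum_insert hi]
    exact (hg i (Finset.mem_insert_self _ _)).add
      (ih fun j hj => hg j (Finset.mem_insert_of_mem hj))

/-- The inverse of a function that stays close to a nonzero constant is analytic, by the geometric
series. -/
theorem inv (hh : IsAnalyticOnDisc a r h) {b : K} (hb : b ≠ 0) {q : ℝ} (hq : q < 1)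
    (hclose : ∀ s, ‖s - a‖ ≤ r → ‖b - h s‖ ≤ q * ‖b‖) :
    IsAnalyticOnDisc a r fun s => (h s)⁻¹ := by
  have hb' : 0 < ‖b‖ := norm_pos_iff.2 hb
  refine of_uniform_limit fun η hη => ?_
  obtain ⟨n, hn⟩ : ∃ n : ℕ, (max q 0) ^ n * (‖b‖⁻¹ * (1 - max q 0)⁻¹) < η := by
    have : Tendsto (fun n : ℕ => (max q 0) ^ n * (‖b‖⁻¹ * (1 - max q 0)⁻¹)) atTop
        (𝓝 (0 * (‖b‖⁻¹ * (1 - max q 0)⁻¹))) :=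
      (tendsto_pow_atTop_nhds_zero_of_lt_one (le_max_right _ _)
        (max_lt hq one_pos)).mul_const _
    rw [zero_mul] at this
    exact (this.eventually (gt_mem_nhds hη)).exists
  refine ⟨fun s => b⁻¹ * ∑ i ∈ Finset.range n, (1 - b⁻¹ * h s) ^ i,
    (sum _ fun i _ => ((const 1).sub (hh.const_mul b⁻¹)).pow i).const_mul _, fun s hs => ?_⟩
  set x := 1 - b⁻¹ * h s with hx
  have hxq : ‖x‖ ≤ max q 0 := by
    have e : x = b⁻¹ * (b - h s) := by rw [hx]; field_simp
    rw [e, norm_mul, norm_inv, inv_mul_le_iff₀ hb', mul_comm]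
    refine (hclose s hs).trans ?_
    gcongr
    exact le_max_left _ _
  have hq1 : max q 0 < 1 := max_lt hq one_pos
  have hx1 : 1 - max q 0 ≤ ‖1 - x‖ := by
    have := norm_sub_norm_le (1 : K) x
    rw [norm_one] at this
    linarith
  have hx1' : 0 < ‖1 - x‖ := lt_of_lt_of_le (by linarith) hx1
  have hx0 : 1 - x ≠ 0 := norm_pos_iff.1 hx1'
  have hhs : h s = b * (1 - x) := by rw [hx]; field_simp; ring
  have key : (h s)⁻¹ - b⁻¹ * ∑ i ∈ Finset.range n, x ^ i = b⁻¹ * (1 - x)⁻¹ * x ^ n := by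
    have hgeom := geom_sum_mul_neg x n
    have : ∑ i ∈ Finset.range n, x ^ i = (1 - x ^ n) * (1 - x)⁻¹ := by
      rw [← hgeom]; field_simp
    rw [this, hhs, mul_inv]
    ring
  rw [key, norm_mul, norm_mul, norm_inv, norm_inv, norm_pow, mul_comm]
  refine le_trans ?_ hn.le
  have : 0 < 1 - max q 0 := by linarith
  gcongr

theorem continuousAt (hh : IsAnalyticOnDisc a r h) {z : K} (hz : ‖z - a‖ < r) :
    ContinuousAt h z := by
  have hev : ∀ᶠ s in 𝓝 z, ‖s - a‖ ≤ r := by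
    have : ContinuousAt (fun s => ‖s - a‖) z := by fun_prop
    filter_upwards [this.eventually (gt_mem_nhds hz)] with s hs using hs.le
  rw [Metric.continuousAt_iff']
  intro η hη
  obtain ⟨P, hP⟩ := hh (η / 3) (by positivity)
  have hPc := Metric.continuousAt_iff'.1 (P.continuous.continuousAt (x := z)) (η / 3)
    (by positivity)
  filter_upwards [hev, hPc] with s hs hs'
  rw [dist_eq_norm] at hs' ⊢
  have e : h s - h z = (h s - P.eval s) + ((P.eval s - P.eval z) - (h z - P.eval z)) := by ring
  rw [e]
  have h1 := norm_add_le (h s - P.eval s) ((P.eval s - P.eval z) - (h z - P.eval z))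
  have h2 := norm_sub_le (P.eval s - P.eval z) (h z - P.eval z)
  linarith [hP s hs, hP z hz.le]

end Algebra

end IsAnalyticOnDisc

/-! ### Zeros and values of analytic functions -/

namespace IsAnalyticOnDisc

variable {K : Type*} [NontriviallyNormedField K] [IsUltrametricDist K] [IsAlgClosed K]
  {a : K} {r r₁ : ℝ} {h : K → K}

/-- The maximum modulus principle: a bound on the open disc extends to the closed disc. -/
theorem norm_le_of_open (hh : IsAnalyticOnDisc a r h) (hr : 0 < r) {C : ℝ} (hC : 0 < C)
    (hle : ∀ s, ‖s - a‖ < r → ‖h s‖ ≤ C) {s : K} (hs : ‖s - a‖ ≤ r) : ‖h s‖ ≤ C := by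
  obtain ⟨P, hP⟩ := hh C hC
  have hPs : ‖P.eval s‖ ≤ C := by
    refine norm_eval_le_of_open P a hr (fun t ht => ?_) hs
    have := ultra_sub_le (h t) (h t - P.eval t)
    rw [sub_sub_cancel] at this
    exact this.trans (max_le (hle t ht) (hP t ht.le))
  have := ultra_add_le (hP s hs) hPs
  rwa [sub_add_cancel] at this

/-- The Schwarz lemma. -/
theorem norm_sub_le_mul (hh : IsAnalyticOnDisc a r h) (hr : 0 < r) {C : ℝ} (hC : 0 < C)
    (hle : ∀ s, ‖s - a‖ ≤ r → ‖h s - h a‖ ≤ C) {s : K} (hs : ‖s - a‖ ≤ r) :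
    ‖h s - h a‖ ≤ C * ‖s - a‖ / r := by
  rcases eq_or_ne s a with rfl | hsa
  · simp
  have hsa' : 0 < ‖s - a‖ := norm_pos_iff.2 (sub_ne_zero.2 hsa)
  have ha : ‖a - a‖ ≤ r := by simpa using hr.le
  obtain ⟨P, hP⟩ := hh (C * ‖s - a‖ / r) (by positivity)
  have hη : C * ‖s - a‖ / r ≤ C := by
    rw [div_le_iff₀ hr]
    gcongr
  have hdiff : ∀ t, ‖t - a‖ ≤ r →
      ‖(h t - h a) - (P - Polynomial.C (P.eval a)).eval t‖ ≤ C * ‖s - a‖ / r := by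
    intro t ht
    have := (ultra_sub_le (h t - P.eval t) (h a - P.eval a)).trans (max_le (hP t ht) (hP a ha))
    simp only [Polynomial.eval_sub, Polynomial.eval_C]
    rwa [sub_sub_sub_comm]
  have hQ := norm_eval_le_mul_of_root (P - Polynomial.C (P.eval a)) a (C := C) hr (by simp)
    (fun t ht => by
      have := ultra_sub_le (h t - h a) ((h t - h a) - (P - Polynomial.C (P.eval a)).eval t)
      rw [sub_sub_cancel] at this
      exact this.trans (max_le (hle t ht) ((hdiff t ht).trans hη))) hs
  have := ultra_add_le (hdiff s hs) hQ
  rwa [sub_add_cancel] at this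

/-- Near a point where `h` is small there are points where `h` is arbitrarily small.  The exponent
`d` bounds the number of zeros of all polynomials that are close to `h`. -/
theorem exists_near_small (hh : IsAnalyticOnDisc a r₁ h) (hr : 0 < r) (hrr : r < r₁)
    (ha : h a ≠ 0) : ∃ d : ℕ, 0 < d ∧ ∀ θ : ℝ, 0 < θ → θ ≤ 1 → ∀ w, ‖w - a‖ ≤ r →
      ‖h w‖ < θ ^ d * ‖h a‖ → ∀ η : ℝ, 0 < η →
        ∃ w', ‖w' - w‖ ≤ θ * r ∧ ‖h w'‖ ≤ η := by
  obtain ⟨M, hM, hle⟩ := hh.bounded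
  have ha' : 0 < ‖h a‖ := norm_pos_iff.2 ha
  have hr₁ : 0 < r₁ := hr.trans hrr
  obtain ⟨d, hd⟩ := pow_unbounded_of_one_lt (max M (‖h a‖) / ‖h a‖)
    ((one_lt_div hr).2 hrr)
  refine ⟨d + 1, d.succ_pos, fun θ hθ hθ1 w hw hwθ η hη => ?_⟩
  have hθd : θ ^ (d + 1) ≤ 1 := pow_le_one₀ hθ.le hθ1
  obtain ⟨P, hP⟩ := hh (min η (θ ^ (d + 1) * ‖h a‖ / 2)) (by positivity)
  have hhalf : θ ^ (d + 1) * ‖h a‖ / 2 < ‖h a‖ := by nlinarith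
  have hPa : ‖P.eval a‖ = ‖h a‖ := by
    refine ultra_norm_eq_of_sub_lt ?_
    rw [norm_sub_rev]
    exact ((hP a (by simpa using hr₁.le)).trans (min_le_right _ _)).trans_lt hhalf
  have hPmax : ‖h a‖ ≤ maxMod P a r := by
    rw [← hPa]
    refine (norm_eval_le_maxMod P a a).trans (maxMod_mono P a (norm_nonneg _) ?_)
    simpa using hr.le
  have hPM : maxMod P a r₁ ≤ max M ‖h a‖ := by
    refine maxMod_le P a hr₁ fun s hs => ?_
    have := ultra_sub_le (h s) (h s - P.eval s)
    rw [sub_sub_cancel] at this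
    refine this.trans (max_le_max (hle s hs.le) ((hP s hs.le).trans ?_))
    exact (min_le_right _ _).trans hhalf.le
  have hcard : (P.roots.filter fun ζ => ‖ζ - a‖ ≤ r).card < d + 1 := by
    by_contra! hcard
    have h1 := maxMod_mul_pow_le P a hr hrr.le
    have h2 : (r₁ / r) ^ d ≤ (r₁ / r) ^ (P.roots.filter fun ζ => ‖ζ - a‖ ≤ r).card :=
      pow_le_pow_right₀ ((one_le_div hr).2 hrr.le) (by omega)
    have h3 : ‖h a‖ * (r₁ / r) ^ d ≤ max M ‖h a‖ :=
      le_trans (mul_le_mul hPmax h2 (by positivity) (ha'.le.trans hPmax)) (h1.trans hPM)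
    rw [div_lt_iff₀ ha'] at hd
    linarith
  obtain ⟨ζ, hζ, hζw⟩ := exists_root_near P a w hr hw hθ (by
    calc ‖P.eval w‖ < θ ^ (d + 1) * ‖h a‖ := by
          have := ultra_sub_le (h w) (h w - P.eval w)
          rw [sub_sub_cancel] at this
          refine this.trans_lt (max_lt hwθ ?_)
          refine ((hP w (hw.trans hrr.le)).trans (min_le_right _ _)).trans_lt ?_
          have : 0 < θ ^ (d + 1) * ‖h a‖ := by positivity
          linarith
      _ ≤ _ := by
          have := pow_le_pow_of_le_one hθ.le hθ1 hcard.le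
          gcongr)
  refine ⟨ζ, hζw, ?_⟩
  have hζ0 : P.eval ζ = 0 := (Polynomial.mem_roots'.1 hζ).2
  have hζa : ‖ζ - a‖ ≤ r₁ := by
    refine ultra_sub_trans_le (hζw.trans ?_) (hw.trans hrr.le)
    nlinarith
  have := hP ζ hζa
  rw [hζ0, sub_zero] at this
  exact this.trans (min_le_left _ _)

/-- An analytic function whose norm is not constant has a zero.  The zero is chosen as close to
the centre as possible, so that the norm is constant on the open disc up to it.  Polynomials close
to `h` have such zeros, and their zeros are corrected to a zero of `h` by successive
approximation. -/
theorem exists_closest_zero [CompleteSpace K] (hh : IsAnalyticOnDisc a r₁ h) (hrr : r < r₁)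
    (ha : h a ≠ 0) {s' : K} (hs' : ‖s' - a‖ ≤ r) (hne : ‖h s'‖ ≠ ‖h a‖) :
    ∃ z, ‖z - a‖ ≤ r ∧ h z = 0 ∧ ∀ s, ‖s - a‖ < ‖z - a‖ → ‖h s‖ = ‖h a‖ := by
  classical
  have ha' : 0 < ‖h a‖ := norm_pos_iff.2 ha
  have hr : 0 < r := by
    refine lt_of_lt_of_le (norm_pos_iff.2 (sub_ne_zero.2 ?_)) hs'
    rintro rfl
    exact hne rfl
  obtain ⟨d, hd0, hd⟩ := hh.exists_near_small hr hrr ha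
  -- A zero `ζ`, closest to `a`, of a polynomial close to `h`.
  have key : ∀ η : ℝ, 0 < η → η < ‖h a‖ → ∃ ζ, ζ ≠ a ∧ ‖ζ - a‖ ≤ r ∧ ‖h ζ‖ ≤ η ∧
      ∀ s, ‖s - a‖ < ‖ζ - a‖ → ‖h s‖ = ‖h a‖ := by
    intro η hη hηa
    obtain ⟨P, hP⟩ := hh η hη
    have hPa : ‖P.eval a‖ = ‖h a‖ := by
      refine ultra_norm_eq_of_sub_lt ?_
      rw [norm_sub_rev]
      exact (hP a (by simpa using (hr.trans hrr).le)).trans_lt hηa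
    have hconst : ∀ s, ‖s - a‖ ≤ r₁ → (∀ ζ ∈ P.roots, ‖s - a‖ < ‖ζ - a‖) → ‖h s‖ = ‖h a‖ := by
      intro s hs hroots
      have h1 := norm_eval_eq_of_no_root P a hroots
      rw [← hPa, ← h1]
      refine ultra_norm_eq_of_sub_lt ?_
      rw [h1, hPa]
      exact (hP s hs).trans_lt hηa
    have hex : ∃ ζ ∈ P.roots.toFinset, ‖ζ - a‖ ≤ ‖s' - a‖ := by
      by_contra! hno
      exact hne (hconst s' (hs'.trans hrr.le) fun ζ hζ => hno ζ (by simpa using hζ))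
    obtain ⟨ζ₀, hζ₀, hle₀⟩ := hex
    obtain ⟨ζ, hζ, hmin⟩ := P.roots.toFinset.exists_min_image (fun ζ => ‖ζ - a‖) ⟨ζ₀, hζ₀⟩
    have hζ0 : P.eval ζ = 0 := (Polynomial.mem_roots'.1 (Multiset.mem_toFinset.1 hζ)).2
    have hζr : ‖ζ - a‖ ≤ r := (hmin ζ₀ hζ₀).trans (hle₀.trans hs')
    refine ⟨ζ, ?_, hζr, ?_, fun s hs => ?_⟩
    · rintro rfl
      rw [hζ0, norm_zero] at hPa
      exact ha'.ne hPa
    · simpa [hζ0] using hP ζ (hζr.trans hrr.le)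
    · refine hconst s (hs.le.trans (hζr.trans hrr.le)) fun ξ hξ => hs.trans_le ?_
      exact hmin ξ (by simpa using hξ)
  obtain ⟨ζ, hζa, -, hζh, hζ⟩ := key (‖h a‖ / 2) (half_pos ha') (half_lt_self ha')
  set t := ‖ζ - a‖ with ht
  have ht0 : 0 < t := norm_pos_iff.2 (sub_ne_zero.2 hζa)
  set θ : ℕ → ℝ := fun n => min 1 (t / (4 * r)) / 2 ^ n with hθdef
  have hθ0 : ∀ n, 0 < θ n := fun n => by positivity
  have hθ1 : ∀ n, θ n ≤ 1 := fun n =>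
    (div_le_self (by positivity) (one_le_pow₀ one_le_two)).trans (min_le_left _ _)
  have hη : ∀ n, 0 < θ n ^ d * ‖h a‖ / 2 := fun n => by
    have := hθ0 n
    positivity
  have hη' : ∀ n, θ n ^ d * ‖h a‖ / 2 < ‖h a‖ := fun n => by
    have := pow_le_one₀ (n := d) (hθ0 n).le (hθ1 n)
    nlinarith
  -- All zeros produced by `key` lie on the same circle `|ζ - a| = t`.
  obtain ⟨w₀, -, hw₀r, hw₀h, hw₀⟩ := key (θ 0 ^ d * ‖h a‖ / 2) (hη 0) (hη' 0)
  have hw₀t : ‖w₀ - a‖ = t := by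
    apply le_antisymm
    · by_contra! hlt
      have := hw₀ ζ hlt
      linarith
    · by_contra! hlt
      have := hζ w₀ hlt
      linarith [hη' 0]
  have step : ∀ n w, (‖w - a‖ ≤ r ∧ ‖h w‖ ≤ θ n ^ d * ‖h a‖ / 2) → ∃ w', ‖w' - w‖ ≤ θ n * r ∧
      ‖w' - a‖ ≤ r ∧ ‖h w'‖ ≤ θ (n + 1) ^ d * ‖h a‖ / 2 := by
    rintro n w ⟨hw, hwh⟩
    obtain ⟨w', h1, h2⟩ := hd (θ n) (hθ0 n) (hθ1 n) w hw
      (hwh.trans_lt (by linarith [hη n])) _ (hη (n + 1))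
    refine ⟨w', h1, ultra_sub_trans_le (h1.trans ?_) hw, h2⟩
    nlinarith [hθ1 n]
  choose! F hF using step
  let w : ℕ → K := fun n => Nat.rec w₀ (fun n w => F n w) n
  have hw : ∀ n, ‖w n - a‖ ≤ r ∧ ‖h (w n)‖ ≤ θ n ^ d * ‖h a‖ / 2 := by
    intro n
    induction n with
    | zero => exact ⟨hw₀r, hw₀h⟩
    | succ n ih => exact (hF n (w n) ih).2
  have hdist : ∀ n, dist (w n) (w (n + 1)) ≤ t / 2 / 2 / 2 ^ n := by
    intro n
    rw [dist_comm, dist_eq_norm]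
    refine (hF n (w n) (hw n)).1.trans ?_
    have : min 1 (t / (4 * r)) ≤ t / (4 * r) := min_le_right _ _
    calc θ n * r ≤ t / (4 * r) / 2 ^ n * r := by
          simp only [hθdef]
          gcongr
      _ = t / 2 / 2 / 2 ^ n := by field_simp; norm_num
  obtain ⟨z, hz⟩ := cauchySeq_tendsto_of_complete (cauchySeq_of_le_geometric_two hdist)
  have hzw : ‖z - w₀‖ < t := by
    have := dist_le_of_le_geometric_two_of_tendsto₀ hdist hz
    rw [dist_comm, dist_eq_norm] at this
    exact this.trans_lt (half_lt_self ht0)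
  have hza : ‖z - a‖ = t := by
    rw [← hw₀t]
    refine ultra_norm_eq_of_sub_lt ?_
    simpa [hw₀t] using hzw
  refine ⟨z, by rw [hza, ← hw₀t]; exact hw₀r, ?_, fun s hs => hζ s (by rwa [hza] at hs)⟩
  have hcont := (hh.continuousAt (z := z)
    ((by rw [hza, ← hw₀t]; exact hw₀r : ‖z - a‖ ≤ r).trans_lt hrr)).tendsto.comp hz
  refine tendsto_nhds_unique hcont (squeeze_zero_norm (fun n => (hw n).2) ?_)
  have hθlim : Tendsto θ atTop (𝓝 0) := by
    have : Tendsto (fun n : ℕ => min 1 (t / (4 * r)) * (1 / 2) ^ n) atTop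
        (𝓝 (min 1 (t / (4 * r)) * 0)) :=
      (tendsto_pow_atTop_nhds_zero_of_lt_one (by norm_num) (by norm_num)).const_mul _
    rw [mul_zero] at this
    refine this.congr fun n => ?_
    simp [hθdef, div_eq_mul_inv]
  have := ((hθlim.pow d).mul_const ‖h a‖).div_const 2
  simpa [hd0.ne'] using this

/-- A zero-free analytic function has constant norm. -/
theorem norm_eq_of_ne_zero [CompleteSpace K] (hh : IsAnalyticOnDisc a r₁ h) (hrr : r < r₁)
    (hne : ∀ s, ‖s - a‖ ≤ r → h s ≠ 0) {s : K} (hs : ‖s - a‖ ≤ r) : ‖h s‖ = ‖h a‖ := by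
  by_contra hsa
  obtain ⟨z, hz, hz0, -⟩ := hh.exists_closest_zero hrr
    (hne a (by simpa using (norm_nonneg _).trans hs)) hs hsa
  exact hne z hz hz0

/-- The image of a disc is a disc: an analytic function that vanishes at the centre takes all
values that are smaller than one of its values. -/
theorem exists_eq_of_lt [CompleteSpace K] (hh : IsAnalyticOnDisc a r₁ h) (hrr : r < r₁)
    (ha : h a = 0) {s' : K} (hs' : ‖s' - a‖ ≤ r) {v : K} (hv : ‖v‖ < ‖h s'‖) :
    ∃ s, ‖s - a‖ ≤ r ∧ h s = v := by
  by_contra! hno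
  have := (hh.sub (const v)).norm_eq_of_ne_zero hrr
    (fun s hs => sub_ne_zero.2 (hno s hs)) hs'
  rw [ultra_sub_eq_left hv, ha, zero_sub, norm_neg] at this
  exact hv.ne' this

/-- Analytic functions are differentiable at interior points. -/
theorem exists_hasDerivAt [CompleteSpace K] (hh : IsAnalyticOnDisc a r h) (hr : 0 < r) :
    ∃ d, HasDerivAt h d a := by
  have hcauchy : Cauchy (map (slope h a) (𝓝[≠] a)) := by
    rw [Metric.cauchy_iff]
    refine ⟨inferInstance, fun η hη => ?_⟩
    obtain ⟨P, hP⟩ := hh (η / 4 * r) (by positivity)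
    have hev := (hasDerivAt_iff_tendsto_slope.1 (P.hasDerivAt a)).eventually
      (Metric.ball_mem_nhds _ (show 0 < η / 4 by positivity))
    have hball : ∀ᶠ s in 𝓝[≠] a, ‖s - a‖ ≤ r ∧ s ≠ a := by
      refine (eventually_nhdsWithin_of_eventually_nhds ?_).and self_mem_nhdsWithin
      filter_upwards [Metric.closedBall_mem_nhds a hr] with s hs
      rwa [← dist_eq_norm]
    have hclose : ∀ᶠ s in 𝓝[≠] a,
        dist (slope h a s) (P.derivative.eval a) < η / 2 := by
      filter_upwards [hev, hball] with s hs hs'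
      have hs0 : 0 < ‖s - a‖ := norm_pos_iff.2 (sub_ne_zero.2 hs'.2)
      have hD := (hh.sub (polynomial P)).norm_sub_le_mul hr (C := η / 4 * r) (by positivity)
        (fun t ht => (ultra_sub_le _ _).trans
          (max_le (hP t ht) (hP a (by simpa using hr.le)))) hs'.1
      have h1 : dist (slope h a s) (slope (fun t => P.eval t) a s) ≤ η / 4 := by
        rw [dist_eq_norm, slope_def_field, slope_def_field, ← sub_div, norm_div,
          div_le_iff₀ hs0]
        calc _ = ‖h s - P.eval s - (h a - P.eval a)‖ := by congr 1; ring
          _ ≤ _ := hD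
          _ = _ := by field_simp
      have h2 : dist (slope (fun t => P.eval t) a s) (P.derivative.eval a) < η / 4 := hs
      have := dist_triangle (slope h a s) (slope (fun t => P.eval t) a s) (P.derivative.eval a)
      linarith
    refine ⟨slope h a '' {s | dist (slope h a s) (P.derivative.eval a) < η / 2},
      image_mem_map hclose, ?_⟩
    rintro _ ⟨x, hx, rfl⟩ _ ⟨y, hy, rfl⟩
    have hx' : dist (slope h a x) (P.derivative.eval a) < η / 2 := hx
    have hy' : dist (slope h a y) (P.derivative.eval a) < η / 2 := hy
    have := dist_triangle_right (slope h a x) (slope h a y) (P.derivative.eval a)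
    linarith
  obtain ⟨d, hd⟩ := CompleteSpace.complete hcauchy
  exact ⟨d, hasDerivAt_iff_tendsto_slope.2 hd⟩

end IsAnalyticOnDisc

/-! ### Infinite products over an ultrametric field -/

/-- The entire function `∏ⱼ (1 - bⱼ z)` attached to a null sequence `b`; entries `bⱼ = 0`
contribute trivial factors. -/
noncomputable def linearProd {K : Type*} [NormedField K] (b : ℕ → K) (z : K) : K :=
  ∏' j, (1 - b j * z)

/-- The maximum modulus `∏ⱼ max 1 (βⱼ r)` of `∏ⱼ (1 - bⱼ z)` on `|z| ≤ r`, where `βⱼ = |bⱼ|`.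
Only finitely many factors differ from `1`. -/
noncomputable def linearProdMax (β : ℕ → ℝ) (r : ℝ) : ℝ := ∏' j, max 1 (β j * r)

theorem eventually_norm_mul_le {K : Type*} [NormedField K] {b : ℕ → K}
    (hb : Tendsto b atTop (𝓝 0)) (ρ : ℝ) {q : ℝ}
    (hq : 0 < q) : ∃ J, ∀ j, J ≤ j → ∀ z, ‖z‖ ≤ ρ → ‖b j * z‖ ≤ q := by
  have h : Tendsto (fun j => ‖b j‖ * ρ) atTop (𝓝 0) := by
    simpa using hb.norm.mul_const ρ
  obtain ⟨J, hJ⟩ := eventually_atTop.1 (h.eventually (gt_mem_nhds hq))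
  refine ⟨J, fun j hj z hz => ?_⟩
  rw [norm_mul]
  exact (by gcongr : ‖b j‖ * ‖z‖ ≤ ‖b j‖ * ρ).trans (hJ j hj).le

section LinearProd

variable {K : Type*} [NontriviallyNormedField K] [IsUltrametricDist K]

theorem norm_prod_sub_prod_le {ι : Type*} (t : Finset ι) {u u' : ι → K} {q : ℝ} (hq0 : 0 ≤ q)
    (hq : q ≤ 1) (h : ∀ i ∈ t, ‖u' i - u i‖ ≤ q * ‖u i‖) :
    ‖∏ i ∈ t, u' i - ∏ i ∈ t, u i‖ ≤ q * ‖∏ i ∈ t, u i‖ := by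
  classical
  induction t using Finset.induction_on with
  | empty => simpa using hq0
  | insert i t hi ih =>
    have ih := ih fun j hj => h j (Finset.mem_insert_of_mem hj)
    have hi' := h i (Finset.mem_insert_self _ _)
    have hle : ‖∏ i ∈ t, u' i‖ ≤ ‖∏ i ∈ t, u i‖ := by
      have := ultra_add_le (ih.trans (mul_le_of_le_one_left (norm_nonneg _) hq)) le_rfl
      rwa [sub_add_cancel] at this
    rw [Finset.prod_insert hi, Finset.prod_insert hi]
    have e : u' i * ∏ i ∈ t, u' i - u i * ∏ i ∈ t, u i =
      (u' i - u i) * ∏ i ∈ t, u' i + u i * (∏ i ∈ t, u' i - ∏ i ∈ t, u i) := by ring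
    rw [e, norm_mul]
    refine ultra_add_le ?_ ?_
    · rw [norm_mul, ← mul_assoc]
      gcongr
    · rw [norm_mul, mul_left_comm]
      gcongr

theorem norm_prod_range_sub_le (b : ℕ → K) (z : K) {q : ℝ} (hq0 : 0 ≤ q) (hq : q ≤ 1) {J : ℕ}
    (hJ : ∀ j, J ≤ j → ‖b j * z‖ ≤ q) (s : Finset ℕ) (hs : Finset.range J ⊆ s) :
    ‖∏ j ∈ s, (1 - b j * z) - ∏ j ∈ Finset.range J, (1 - b j * z)‖ ≤
      q * ‖∏ j ∈ Finset.range J, (1 - b j * z)‖ := by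
  have h1 : ‖∏ j ∈ s \ Finset.range J, (1 - b j * z) - ∏ j ∈ s \ Finset.range J, (1 : K)‖ ≤
      q * ‖∏ j ∈ s \ Finset.range J, (1 : K)‖ := by
    refine norm_prod_sub_prod_le _ hq0 hq fun j hj => ?_
    have := hJ j (by simpa using (Finset.mem_sdiff.1 hj).2)
    simpa using this
  rw [Finset.prod_const_one, norm_one, mul_one] at h1
  rw [← Finset.prod_sdiff hs]
  calc _ = ‖(∏ j ∈ s \ Finset.range J, (1 - b j * z) - 1) *
        ∏ j ∈ Finset.range J, (1 - b j * z)‖ := by congr 1; ring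
    _ ≤ _ := by
      rw [norm_mul]
      gcongr

variable [CompleteSpace K]

theorem multipliable_linear {b : ℕ → K} (hb : Tendsto b atTop (𝓝 0)) (z : K) :
    Multipliable fun j => 1 - b j * z := by
  have hc : CauchySeq fun s : Finset ℕ => ∏ j ∈ s, (1 - b j * z) := by
    obtain ⟨J₀, hJ₀⟩ := eventually_norm_mul_le hb ‖z‖ one_pos
    refine Metric.cauchySeq_iff'.2 fun η hη => ?_
    set C := ‖∏ j ∈ Finset.range J₀, (1 - b j * z)‖ + 1 with hC
    have hC0 : 0 < C := by positivity
    obtain ⟨J₁, hJ₁⟩ := eventually_norm_mul_le hb ‖z‖ (q := min 1 (η / 2 / C)) (by positivity)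
    refine ⟨Finset.range (max J₀ J₁), fun s hs => ?_⟩
    rw [dist_eq_norm]
    have h1 := norm_prod_range_sub_le b z (q := min 1 (η / 2 / C)) (by positivity)
      (min_le_left _ _) (J := max J₀ J₁)
      (fun j hj => hJ₁ j ((le_max_right _ _).trans hj) z le_rfl) s hs
    have h2 := norm_prod_range_sub_le b z zero_le_one le_rfl
      (fun j hj => hJ₀ j hj z le_rfl) (Finset.range (max J₀ J₁))
      (Finset.range_mono (le_max_left _ _))
    have h3 : ‖∏ j ∈ Finset.range (max J₀ J₁), (1 - b j * z)‖ ≤ C := by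
      have := ultra_add_le h2 (one_mul ‖∏ j ∈ Finset.range J₀, (1 - b j * z)‖).ge
      rw [sub_add_cancel, one_mul] at this
      linarith
    calc _ ≤ min 1 (η / 2 / C) * ‖∏ j ∈ Finset.range (max J₀ J₁), (1 - b j * z)‖ := h1
      _ ≤ (η / 2 / C) * C := by
        gcongr
        exact min_le_right _ _
      _ = η / 2 := by field_simp
      _ < η := half_lt_self hη
  obtain ⟨L, hL⟩ := cauchySeq_tendsto_of_complete hc
  exact ⟨L, by simpa [HasProd] using hL⟩

theorem tendsto_linearProd {b : ℕ → K} (hb : Tendsto b atTop (𝓝 0)) (z : K) :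
    Tendsto (fun n => ∏ j ∈ Finset.range n, (1 - b j * z)) atTop (𝓝 (linearProd b z)) :=
  (multipliable_linear hb z).hasProd.tendsto_prod_nat

theorem norm_linearProd_sub_range_le {b : ℕ → K} (hb : Tendsto b atTop (𝓝 0)) (z : K) {q : ℝ}
    (hq0 : 0 ≤ q) (hq : q ≤ 1) {J : ℕ} (hJ : ∀ j, J ≤ j → ‖b j * z‖ ≤ q) :
    ‖linearProd b z - ∏ j ∈ Finset.range J, (1 - b j * z)‖ ≤
      q * ‖∏ j ∈ Finset.range J, (1 - b j * z)‖ := by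
  refine le_of_tendsto ((tendsto_linearProd hb z).sub_const _).norm ?_
  filter_upwards [eventually_ge_atTop J] with n hn
  exact norm_prod_range_sub_le b z hq0 hq hJ _ (Finset.range_mono hn)

/-- If every factor changes by a relative amount of at most `q`, so does the product. -/
theorem norm_linearProd_sub_le {b : ℕ → K} (hb : Tendsto b atTop (𝓝 0)) {z z' : K} {q : ℝ}
    (hq0 : 0 ≤ q) (hq : q ≤ 1) (h : ∀ j, ‖b j * (z' - z)‖ ≤ q * ‖1 - b j * z‖) :
    ‖linearProd b z' - linearProd b z‖ ≤ q * ‖linearProd b z‖ := by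
  refine le_of_tendsto_of_tendsto ((tendsto_linearProd hb z').sub (tendsto_linearProd hb z)).norm
    ((tendsto_linearProd hb z).norm.const_mul q) (Eventually.of_forall fun n => ?_)
  refine norm_prod_sub_prod_le _ hq0 hq fun j _ => ?_
  refine le_of_eq_of_le ?_ (h j)
  rw [← norm_neg]
  congr 1
  ring

theorem linearProd_eq_mul_update {b : ℕ → K} (hb : Tendsto b atTop (𝓝 0)) (i : ℕ) (x : K)
    (z : K) : linearProd (Function.update b i x) z =
      (1 - x * z) * linearProd (Function.update b i 0) z := by
  have hb' : ∀ y, Tendsto (Function.update b i y) atTop (𝓝 0) := fun y => by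
    refine hb.congr' ?_
    filter_upwards [eventually_gt_atTop i] with n hn
    rw [Function.update_of_ne hn.ne']
  refine tendsto_nhds_unique (tendsto_linearProd (hb' x) z)
    (((tendsto_linearProd (hb' 0) z).const_mul (1 - x * z)).congr' ?_)
  filter_upwards [eventually_gt_atTop i] with n hn
  have hi : i ∈ Finset.range n := Finset.mem_range.2 hn
  rw [← Finset.mul_prod_erase _ _ hi, ← Finset.mul_prod_erase (Finset.range n)
    (fun j => 1 - Function.update b i x j * z) hi]
  simp only [Function.update_self, zero_mul, sub_zero, one_mul]
  congr 1
  refine Finset.prod_congr rfl fun j hj => ?_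
  rw [Function.update_of_ne (Finset.ne_of_mem_erase hj),
    Function.update_of_ne (Finset.ne_of_mem_erase hj)]

theorem linearProdMax_eq_prod {β : ℕ → ℝ} {r : ℝ} {J : ℕ} (hJ : ∀ j, J ≤ j → β j * r ≤ 1) :
    linearProdMax β r = ∏ j ∈ Finset.range J, max 1 (β j * r) :=
  tprod_eq_prod fun j hj => max_eq_left (hJ j (by simpa using hj))

theorem norm_linearProd_eq_prod {b : ℕ → K} (hb : Tendsto b atTop (𝓝 0)) (z : K) {J : ℕ}
    (hJ : ∀ j, J ≤ j → ‖b j * z‖ ≤ 1 / 2) :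
    ‖linearProd b z‖ = ∏ j ∈ Finset.range J, ‖1 - b j * z‖ := by
  rw [← norm_prod]
  have h := norm_linearProd_sub_range_le hb z (q := 1 / 2) (by norm_num) (by norm_num) hJ
  rcases (norm_nonneg (∏ j ∈ Finset.range J, (1 - b j * z))).eq_or_lt with h0 | h0
  · rw [← h0, mul_zero, norm_le_zero_iff, sub_eq_zero] at h
    rw [h]
  · exact ultra_norm_eq_of_sub_lt (by linarith)

theorem norm_linearProd_le {b : ℕ → K} (hb : Tendsto b atTop (𝓝 0)) (z : K) :
    ‖linearProd b z‖ ≤ linearProdMax (fun j => ‖b j‖) ‖z‖ := by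
  obtain ⟨J, hJ⟩ := eventually_norm_mul_le hb ‖z‖ one_half_pos
  have hJ' := fun j hj => hJ j hj z le_rfl
  rw [norm_linearProd_eq_prod hb z hJ', linearProdMax_eq_prod (J := J) fun j hj => by
    have := hJ' j hj
    rw [norm_mul] at this
    linarith]
  refine Finset.prod_le_prod (fun _ _ => norm_nonneg _) fun j _ => ?_
  simpa using ultra_sub_le 1 (b j * z)

/-- The norm of the product is maximal off the discs around its zeros. -/
theorem norm_linearProd_eq {b : ℕ → K} (hb : Tendsto b atTop (𝓝 0)) (z : K)
    (h : ∀ j, ‖b j * z‖ = 1 → 1 ≤ ‖1 - b j * z‖) :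
    ‖linearProd b z‖ = linearProdMax (fun j => ‖b j‖) ‖z‖ := by
  obtain ⟨J, hJ⟩ := eventually_norm_mul_le hb ‖z‖ one_half_pos
  have hJ' := fun j hj => hJ j hj z le_rfl
  rw [norm_linearProd_eq_prod hb z hJ', linearProdMax_eq_prod (J := J) fun j hj => by
    have := hJ' j hj
    rw [norm_mul] at this
    linarith]
  refine Finset.prod_congr rfl fun j _ => ?_
  rw [← norm_mul]
  rcases eq_or_ne ‖b j * z‖ 1 with h1 | h1
  · refine le_antisymm (by simpa using ultra_sub_le 1 (b j * z)) ?_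
    rw [h1, max_self]
    exact h j h1
  · have := ultra_sub_eq_max (x := (1 : K)) (y := b j * z) (by rw [norm_one]; exact h1.symm)
    rwa [norm_one] at this

theorem IsAnalyticOnDisc.linearProd {b : ℕ → K} (hb : Tendsto b atTop (𝓝 0)) {a : K} {r : ℝ}
    {h : K → K} (hh : IsAnalyticOnDisc a r h) :
    IsAnalyticOnDisc a r fun s => linearProd b (h s) := by
  have hfin : ∀ J, IsAnalyticOnDisc a r fun s => ∏ j ∈ Finset.range J, (1 - b j * h s) :=
    fun J => prod _ fun j _ => (const 1).sub (hh.const_mul (b j))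
  obtain ⟨ρ, hρ, hle⟩ := hh.bounded
  obtain ⟨J₀, hJ₀⟩ := eventually_norm_mul_le hb ρ one_pos
  obtain ⟨C, hC, hleC⟩ := (hfin J₀).bounded
  refine of_uniform_limit fun η hη => ?_
  obtain ⟨J₁, hJ₁⟩ := eventually_norm_mul_le hb ρ (q := min 1 (η / C)) (by positivity)
  refine ⟨_, hfin (max J₀ J₁), fun s hs => ?_⟩
  have h1 := norm_linearProd_sub_range_le hb (h s) (q := min 1 (η / C)) (by positivity)
    (min_le_left _ _) (J := max J₀ J₁)
    (fun j hj => hJ₁ j ((le_max_right _ _).trans hj) _ (hle s hs))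
  have h2 := norm_prod_range_sub_le b (h s) zero_le_one le_rfl
    (fun j hj => hJ₀ j hj _ (hle s hs)) (Finset.range (max J₀ J₁))
    (Finset.range_mono (le_max_left _ _))
  have h3 : ‖∏ j ∈ Finset.range (max J₀ J₁), (1 - b j * h s)‖ ≤ C := by
    have := ultra_add_le h2 (one_mul ‖∏ j ∈ Finset.range J₀, (1 - b j * h s)‖).ge
    rw [sub_add_cancel, one_mul] at this
    exact this.trans (hleC s hs)
  calc _ ≤ min 1 (η / C) * ‖∏ j ∈ Finset.range (max J₀ J₁), (1 - b j * h s)‖ := h1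
    _ ≤ (η / C) * C := by
      gcongr
      exact min_le_right _ _
    _ = η := by field_simp

end LinearProd

section LinearProdMax

variable {β : ℕ → ℝ}

theorem exists_index_mul_le_one (hβ : Tendsto β atTop (𝓝 0)) (hβ0 : ∀ j, 0 ≤ β j) (ρ : ℝ) :
    ∃ J, ∀ j, J ≤ j → ∀ r ≤ ρ, β j * r ≤ 1 := by
  have h : Tendsto (fun j => β j * ρ) atTop (𝓝 0) := by
    simpa using hβ.mul_const ρ
  obtain ⟨J, hJ⟩ := eventually_atTop.1 (h.eventually (gt_mem_nhds one_pos))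
  exact ⟨J, fun j hj r hr => (mul_le_mul_of_nonneg_left hr (hβ0 j)).trans (hJ j hj).le⟩

theorem continuous_linearProdMax (hβ : Tendsto β atTop (𝓝 0)) (hβ0 : ∀ j, 0 ≤ β j) :
    Continuous (linearProdMax β) := by
  refine continuous_iff_continuousAt.2 fun r => ?_
  obtain ⟨J, hJ⟩ := exists_index_mul_le_one hβ hβ0 (r + 1)
  have hc : Continuous fun r => ∏ j ∈ Finset.range J, max 1 (β j * r) := by fun_prop
  refine hc.continuousAt.congr ?_
  filter_upwards [gt_mem_nhds (lt_add_one r)] with t ht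
  rw [linearProdMax_eq_prod fun j hj => hJ j hj t (le_of_lt ht)]

theorem linearProdMax_mono (hβ : Tendsto β atTop (𝓝 0)) (hβ0 : ∀ j, 0 ≤ β j) :
    Monotone (linearProdMax β) := by
  intro r r' h
  obtain ⟨J, hJ⟩ := exists_index_mul_le_one hβ hβ0 r'
  rw [linearProdMax_eq_prod fun j hj => hJ j hj r h,
    linearProdMax_eq_prod fun j hj => hJ j hj r' le_rfl]
  refine Finset.prod_le_prod (fun _ _ => by positivity) fun j _ => ?_
  exact max_le_max_left _ (mul_le_mul_of_nonneg_left h (hβ0 j))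

theorem one_le_linearProdMax (hβ : Tendsto β atTop (𝓝 0)) (hβ0 : ∀ j, 0 ≤ β j) (r : ℝ) :
    1 ≤ linearProdMax β r := by
  obtain ⟨J, hJ⟩ := exists_index_mul_le_one hβ hβ0 r
  rw [linearProdMax_eq_prod fun j hj => hJ j hj r le_rfl]
  calc (1 : ℝ) = ∏ _j ∈ Finset.range J, 1 := by simp
    _ ≤ _ := Finset.prod_le_prod (fun _ _ => zero_le_one) fun _ _ => le_max_left _ _

/-- Removing a factor that equals `1` at `r` does not change the value at `r`. -/
theorem linearProdMax_update (i : ℕ) {r : ℝ} (h : β i * r ≤ 1) :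
    linearProdMax (Function.update β i 0) r = linearProdMax β r := by
  refine tprod_congr fun j => ?_
  rcases eq_or_ne j i with rfl | hj
  · simp [max_eq_left h]
  · rw [Function.update_of_ne hj]

end LinearProdMax

/-! ### The growth function -/

/-- The sequence `(1 / c_{j+1})_{j ≥ 0}` of inverse zeros. -/
noncomputable def invSeq {F : Type*} [Field F] (c : ℕ → F) (j : ℕ) : F := (c (j + 1))⁻¹

/-- The explicit growth function `Φ(r) = p r ^ p ∏_{j ≥ 1} max(1, r / R_j)`. -/
noncomputable def radialGrowth (p : ℕ) (R : ℕ → ℝ) (r : ℝ) : ℝ :=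
  p * r ^ p * linearProdMax (invSeq R) r

theorem ultra_mul_sub_mul_le {K : Type*} [NontriviallyNormedField K] [IsUltrametricDist K]
    {u u' v v' : K} {q : ℝ} (hq0 : 0 ≤ q) (hq : q ≤ 1) (hu : ‖u' - u‖ ≤ q * ‖u‖)
    (hv : ‖v' - v‖ ≤ q * ‖v‖) : ‖u' * v' - u * v‖ ≤ q * ‖u * v‖ := by
  have hle : ‖v'‖ ≤ ‖v‖ := by
    have := ultra_add_le (hv.trans (mul_le_of_le_one_left (norm_nonneg _) hq)) le_rfl
    rwa [sub_add_cancel] at this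
  have e : u' * v' - u * v = (u' - u) * v' + u * (v' - v) := by ring
  rw [e, norm_mul u v]
  refine ultra_add_le ?_ ?_
  · rw [norm_mul, ← mul_assoc]
    gcongr
  · rw [norm_mul, mul_left_comm]
    gcongr

theorem ultra_pow_sub_pow_le {K : Type*} [NontriviallyNormedField K] [IsUltrametricDist K]
    {u u' : K} {q : ℝ} (hq0 : 0 ≤ q) (hq : q ≤ 1) (hu : ‖u' - u‖ ≤ q * ‖u‖) (n : ℕ) :
    ‖u' ^ n - u ^ n‖ ≤ q * ‖u ^ n‖ := by
  simpa using norm_prod_sub_prod_le (Finset.range n) (u := fun _ => u) (u' := fun _ => u') hq0 hq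
    fun _ _ => hu

section Growth

variable {p : ℕ} [hp : Fact p.Prime] {R : ℕ → ℝ}

theorem one_lt_prime : (1 : ℝ) < p := by exact_mod_cast hp.out.one_lt

theorem prime_pos : (0 : ℝ) < p := one_pos.trans one_lt_prime

theorem norm_prime : ‖(p : ℂ_[p])‖ = (p : ℝ)⁻¹ := by
  rw [← PadicComplex.coe_natCast, PadicComplex.norm_extends,
    ← map_natCast (algebraMap ℚ_[p] (PadicAlgCl p)) p, PadicAlgCl.norm_extends, Padic.norm_p]

namespace IsGenericRadii

theorem prime_lt (hR : IsGenericRadii p R) {j : ℕ} (hj : 1 ≤ j) : (p : ℝ) < R j := by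
  rcases hj.eq_or_lt with rfl | hj
  · exact hR.lower
  · exact hR.lower.trans (hR.increasing 1 j le_rfl hj)

theorem one_lt (hR : IsGenericRadii p R) {j : ℕ} (hj : 1 ≤ j) : 1 < R j :=
  one_lt_prime.trans (hR.prime_lt hj)

theorem pos (hR : IsGenericRadii p R) {j : ℕ} (hj : 1 ≤ j) : 0 < R j :=
  one_pos.trans (hR.one_lt hj)

theorem eq_of_eq (hR : IsGenericRadii p R) {i j : ℕ} (hi : 1 ≤ i) (hj : 1 ≤ j)
    (h : R i = R j) : i = j := by
  rcases lt_trichotomy i j with hij | hij | hij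
  · exact absurd h (hR.increasing i j hi hij).ne
  · exact hij
  · exact absurd h (hR.increasing j i hj hij).ne'

theorem tendsto_invSeq (hR : IsGenericRadii p R) : Tendsto (invSeq R) atTop (𝓝 0) :=
  (hR.tendsto.comp (tendsto_add_atTop_nat 1)).inv_tendsto_atTop

theorem invSeq_nonneg (hR : IsGenericRadii p R) (j : ℕ) : 0 ≤ invSeq R j :=
  inv_nonneg.2 (hR.pos (Nat.le_add_left 1 j)).le

theorem growth_continuous (hR : IsGenericRadii p R) : Continuous (radialGrowth p R) := by
  unfold radialGrowth
  have := continuous_linearProdMax hR.tendsto_invSeq hR.invSeq_nonneg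
  fun_prop

theorem growth_pos (hR : IsGenericRadii p R) {r : ℝ} (hr : 0 < r) : 0 < radialGrowth p R r := by
  have h1 := one_le_linearProdMax hR.tendsto_invSeq hR.invSeq_nonneg r
  have h2 := prime_pos (p := p)
  unfold radialGrowth
  positivity

theorem growth_zero : radialGrowth p R 0 = 0 := by
  simp [radialGrowth, hp.out.ne_zero]

theorem growth_div_lt (hR : IsGenericRadii p R) {r r' : ℝ} (hr : 0 < r) (h : r < r') :
    radialGrowth p R r / r < radialGrowth p R r' / r' := by
  have hr' := hr.trans h
  have e : ∀ t : ℝ, 0 < t → radialGrowth p R t / t =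
      p * t ^ (p - 1) * linearProdMax (invSeq R) t := by
    intro t ht
    have : t ^ p = t ^ (p - 1) * t := (pow_sub_one_mul hp.out.ne_zero t).symm
    rw [radialGrowth, this]
    field_simp
  rw [e r hr, e r' hr']
  have h1 := one_le_linearProdMax hR.tendsto_invSeq hR.invSeq_nonneg r
  have h2 := prime_pos (p := p)
  have h3 : r ^ (p - 1) < r' ^ (p - 1) :=
    pow_lt_pow_left₀ h hr.le (Nat.sub_ne_zero_of_lt hp.out.one_lt)
  have h4 := linearProdMax_mono hR.tendsto_invSeq hR.invSeq_nonneg h.le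
  calc _ < p * r' ^ (p - 1) * linearProdMax (invSeq R) r := by gcongr
    _ ≤ _ := by gcongr

theorem growth_lt (hR : IsGenericRadii p R) {r r' : ℝ} (hr : 0 ≤ r) (h : r < r') :
    radialGrowth p R r < radialGrowth p R r' := by
  rcases hr.eq_or_lt with rfl | hr
  · rw [growth_zero]
    exact hR.growth_pos h
  have hr' := hr.trans h
  have := hR.growth_div_lt hr h
  rw [div_lt_div_iff₀ hr hr'] at this
  nlinarith [hR.growth_pos hr, hR.growth_pos hr']

theorem growth_le (hR : IsGenericRadii p R) {r r' : ℝ} (hr : 0 ≤ r) (h : r ≤ r') :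
    radialGrowth p R r ≤ radialGrowth p R r' := by
  rcases h.eq_or_lt with rfl | h
  · exact le_rfl
  · exact (hR.growth_lt hr h).le

theorem growth_inj (hR : IsGenericRadii p R) {r r' : ℝ} (hr : 0 ≤ r) (hr' : 0 ≤ r')
    (h : radialGrowth p R r = radialGrowth p R r') : r = r' := by
  rcases lt_trichotomy r r' with hlt | heq | hlt
  · exact absurd h (hR.growth_lt hr hlt).ne
  · exact heq
  · exact absurd h (hR.growth_lt hr' hlt).ne'

theorem lt_of_growth_lt (hR : IsGenericRadii p R) {r r' : ℝ} (hr' : 0 ≤ r')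
    (h : radialGrowth p R r < radialGrowth p R r') : r < r' := by
  by_contra! hle
  exact h.not_ge (hR.growth_le hr' hle)

theorem le_of_growth_le (hR : IsGenericRadii p R) {r r' : ℝ} (hr' : 0 ≤ r')
    (h : radialGrowth p R r ≤ radialGrowth p R r') : r ≤ r' := by
  by_contra! hlt
  exact h.not_gt (hR.growth_lt hr' hlt)

theorem prime_mul_le_growth (hR : IsGenericRadii p R) {r : ℝ} (hr : 1 ≤ r) :
    p * r ≤ radialGrowth p R r := by
  have h1 := one_le_linearProdMax hR.tendsto_invSeq hR.invSeq_nonneg r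
  have h2 := prime_pos (p := p)
  have h3 : r ≤ r ^ p := le_self_pow₀ hr hp.out.ne_zero
  calc p * r ≤ p * r ^ p * 1 := by rw [mul_one]; gcongr
    _ ≤ _ := by unfold radialGrowth; gcongr

theorem lt_growth (hR : IsGenericRadii p R) {r : ℝ} (hr : 1 ≤ r) : r < radialGrowth p R r := by
  refine lt_of_lt_of_le ?_ (hR.prime_mul_le_growth hr)
  nlinarith [one_lt_prime (p := p)]

theorem growth_eq_of_le_one (hR : IsGenericRadii p R) {r : ℝ} (hr : r ≤ 1) :
    radialGrowth p R r = p * r ^ p := by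
  rw [radialGrowth, linearProdMax_eq_prod (J := 0), Finset.prod_range_zero, mul_one]
  intro j _
  have := hR.one_lt (Nat.le_add_left 1 j)
  have h0 := hR.invSeq_nonneg j
  have h1 : invSeq R j ≤ 1 := inv_le_one_of_one_le₀ this.le
  nlinarith

theorem exists_growth_eq (hR : IsGenericRadii p R) {y : ℝ} (hy : 0 < y) :
    ∃ r, 0 < r ∧ radialGrowth p R r = y := by
  have h1 : y ≤ radialGrowth p R (max 1 y) := by
    exact (le_max_right 1 y).trans (hR.lt_growth (le_max_left 1 y)).le
  obtain ⟨r, hr, hry⟩ := intermediate_value_Icc (zero_le_one.trans (le_max_left 1 y))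
    hR.growth_continuous.continuousOn ⟨by rw [growth_zero]; exact hy.le, h1⟩
  refine ⟨r, hr.1.lt_of_ne ?_, hry⟩
  rintro rfl
  rw [growth_zero] at hry
  exact hy.ne hry

end IsGenericRadii

/-! ### The entire map -/

section Map

variable {c : ℕ → ℂ_[p]}

theorem norm_invSeq (hc : c ∈ paramSpace p R) (j : ℕ) : ‖invSeq c j‖ = invSeq R j := by
  rw [invSeq, invSeq, norm_inv, hc (j + 1) (Nat.le_add_left 1 j)]

theorem tendsto_invSeq_param (hR : IsGenericRadii p R) (hc : c ∈ paramSpace p R) :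
    Tendsto (invSeq c) atTop (𝓝 0) := by
  refine squeeze_zero_norm (fun j => (norm_invSeq hc j).le) hR.tendsto_invSeq

theorem param_ne_zero (hR : IsGenericRadii p R) (hc : c ∈ paramSpace p R) {j : ℕ} (hj : 1 ≤ j) :
    c j ≠ 0 := by
  rw [← norm_pos_iff, hc j hj]
  exact hR.pos hj

theorem entireMap_eq (c : ℕ → ℂ_[p]) (z : ℂ_[p]) :
    entireMap p c z = z ^ p / p * linearProd (invSeq c) z := by
  unfold entireMap linearProd invSeq
  simp only [div_eq_inv_mul]

theorem mem_diskB_iff (c : ℕ → ℂ_[p]) {j : ℕ} (hj : 1 ≤ j) (z : ℂ_[p]) :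
    z ∈ diskB p R c j ↔ ‖z - c j‖ < R j := by
  rw [diskB, if_neg (by omega)]
  rfl

theorem mem_diskB_zero_iff (c : ℕ → ℂ_[p]) (z : ℂ_[p]) : z ∈ diskB p R c 0 ↔ ‖z‖ < 1 := by
  rw [diskB, if_pos rfl]
  rfl

theorem norm_of_mem_diskB (hc : c ∈ paramSpace p R) {j : ℕ} (hj : 1 ≤ j) {z : ℂ_[p]}
    (hz : z ∈ diskB p R c j) : ‖z‖ = R j := by
  rw [mem_diskB_iff c hj] at hz
  rw [← hc j hj] at hz ⊢
  exact ultra_norm_eq_of_sub_lt hz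

theorem norm_one_sub_invSeq (hR : IsGenericRadii p R) (hc : c ∈ paramSpace p R) (j : ℕ)
    (z : ℂ_[p]) : ‖1 - invSeq c j * z‖ = ‖z - c (j + 1)‖ / R (j + 1) := by
  have h0 := param_ne_zero hR hc (Nat.le_add_left 1 j)
  have e : 1 - invSeq c j * z = -((z - c (j + 1)) / c (j + 1)) := by
    rw [invSeq]
    field_simp
    ring
  rw [e, norm_neg, norm_div, hc (j + 1) (Nat.le_add_left 1 j)]

theorem one_sub_invSeq_of_notMem (hR : IsGenericRadii p R) (hc : c ∈ paramSpace p R) (j : ℕ)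
    {z : ℂ_[p]} (hz : z ∉ diskB p R c (j + 1)) : 1 ≤ ‖1 - invSeq c j * z‖ := by
  rw [mem_diskB_iff c (Nat.le_add_left 1 j)] at hz
  rw [norm_one_sub_invSeq hR hc, one_le_div (hR.pos (Nat.le_add_left 1 j))]
  exact not_lt.1 hz

/-- Off the disc `B_{j+1}` the factor `1 - z / c_{j+1}` has the largest possible norm. -/
theorem norm_mul_le_of_notMem (hR : IsGenericRadii p R) (hc : c ∈ paramSpace p R) (j : ℕ)
    {z : ℂ_[p]} (hz : z ∉ diskB p R c (j + 1)) :
    ‖invSeq c j * z‖ ≤ ‖1 - invSeq c j * z‖ := by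
  rcases eq_or_ne ‖invSeq c j * z‖ 1 with h | h
  · rw [h]
    exact one_sub_invSeq_of_notMem hR hc j hz
  · have := ultra_sub_eq_max (x := (1 : ℂ_[p])) (y := invSeq c j * z)
      (by rw [norm_one]; exact h.symm)
    rw [this]
    exact le_max_right _ _

theorem growth_norm_eq (hc : c ∈ paramSpace p R) (z : ℂ_[p]) :
    ‖z ^ p / (p : ℂ_[p])‖ * linearProdMax (fun j => ‖invSeq c j‖) ‖z‖ =
      radialGrowth p R ‖z‖ := by
  simp only [norm_invSeq hc]
  rw [radialGrowth, norm_div, norm_pow, norm_prime, div_inv_eq_mul, mul_comm (‖z‖ ^ p)]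

theorem norm_entireMap_le (hR : IsGenericRadii p R) (hc : c ∈ paramSpace p R) (z : ℂ_[p]) :
    ‖entireMap p c z‖ ≤ radialGrowth p R ‖z‖ := by
  rw [entireMap_eq, norm_mul, ← growth_norm_eq hc]
  gcongr
  exact norm_linearProd_le (tendsto_invSeq_param hR hc) z

theorem norm_entireMap_eq (hR : IsGenericRadii p R) (hc : c ∈ paramSpace p R) {z : ℂ_[p]}
    (hz : ∀ j, 1 ≤ j → z ∉ diskB p R c j) : ‖entireMap p c z‖ = radialGrowth p R ‖z‖ := by
  rw [entireMap_eq, norm_mul, ← growth_norm_eq hc,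
    norm_linearProd_eq (tendsto_invSeq_param hR hc) z]
  exact fun j _ => one_sub_invSeq_of_notMem hR hc j (hz (j + 1) (Nat.le_add_left 1 j))

theorem norm_entireMap_eq_of_norm_ne (hR : IsGenericRadii p R) (hc : c ∈ paramSpace p R)
    {z : ℂ_[p]} (hz : ∀ j, 1 ≤ j → ‖z‖ ≠ R j) : ‖entireMap p c z‖ = radialGrowth p R ‖z‖ :=
  norm_entireMap_eq hR hc fun j hj hmem => hz j hj (norm_of_mem_diskB hc hj hmem)

theorem entireMap_zero (c : ℕ → ℂ_[p]) : entireMap p c 0 = 0 := by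
  simp [entireMap, hp.out.ne_zero]

/-- Norms can be chosen in any interval so that they differ from all radii `R_j`. -/
theorem exists_norm_mem_Ioo_ne_radii (hR : IsGenericRadii p R) {a b : ℝ} (ha : 0 ≤ a)
    (hab : a < b) : ∃ z : ℂ_[p], ‖z‖ ∈ Set.Ioo a b ∧ ∀ j, 1 ≤ j → ‖z‖ ≠ R j := by
  obtain ⟨J, hJ⟩ := (hR.tendsto.eventually_ge_atTop b).exists_forall_of_atTop
  obtain ⟨z, hz, hzJ⟩ := exists_norm_mem_Ioo_notMem (K := ℂ_[p]) ha hab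
    ((Finset.range J).image R)
  refine ⟨z, hz, fun j _ h => hzJ ?_⟩
  rw [Finset.mem_image]
  refine ⟨j, Finset.mem_range.2 ?_, h.symm⟩
  by_contra! hj
  have := hJ j hj
  linarith [hz.2]

/-- The growth of `f_c` is the explicit function `Φ`, for all parameters. -/
theorem growth_eq (hR : IsGenericRadii p R) (hc : c ∈ paramSpace p R) {r : ℝ} (hr : 0 < r) :
    growth p c r = radialGrowth p R r := by
  have hub : ∀ y ∈ {y : ℝ | ∃ z : ℂ_[p], ‖z‖ ≤ r ∧ y = ‖entireMap p c z‖},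
      y ≤ radialGrowth p R r := by
    rintro _ ⟨z, hz, rfl⟩
    exact (norm_entireMap_le hR hc z).trans (hR.growth_le (norm_nonneg z) hz)
  refine csSup_eq_of_forall_le_of_forall_lt_exists_gt ⟨_, 0, by simpa using hr.le, rfl⟩ hub ?_
  intro w hw
  obtain ⟨σ, hσ, hsub⟩ := exists_Ioc_subset_of_mem_nhds
    (hR.growth_continuous.continuousAt.eventually (lt_mem_nhds hw)) ⟨0, hr⟩
  obtain ⟨z, hz, hzR⟩ := exists_norm_mem_Ioo_ne_radii hR (le_max_left 0 σ) (max_lt hr hσ)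
  refine ⟨_, ⟨z, hz.2.le, rfl⟩, ?_⟩
  rw [norm_entireMap_eq_of_norm_ne hR hc hzR]
  exact hsub ⟨(le_max_right 0 σ).trans_lt hz.1, hz.2.le⟩

theorem isAnalyticOnDisc_entireMap (hR : IsGenericRadii p R) (hc : c ∈ paramSpace p R)
    {a : ℂ_[p]} {r : ℝ} {h : ℂ_[p] → ℂ_[p]} (hh : IsAnalyticOnDisc a r h) :
    IsAnalyticOnDisc a r fun s => entireMap p c (h s) := by
  refine (((hh.pow p).const_mul (p : ℂ_[p])⁻¹).mul
    (hh.linearProd (tendsto_invSeq_param hR hc))).congr fun s _ => ?_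
  rw [entireMap_eq, div_eq_inv_mul]

/-- Off the discs `B_j`, `j ≥ 1`, the map `f_c` does not increase small relative distances. -/
theorem norm_entireMap_sub_le (hR : IsGenericRadii p R) (hc : c ∈ paramSpace p R)
    {z z' : ℂ_[p]} (hz : ∀ j, 1 ≤ j → z ∉ diskB p R c j) {q : ℝ} (hq0 : 0 ≤ q) (hq : q ≤ 1)
    (h : ‖z' - z‖ ≤ q * ‖z‖) :
    ‖entireMap p c z' - entireMap p c z‖ ≤ q * ‖entireMap p c z‖ := by
  rw [entireMap_eq, entireMap_eq]
  refine ultra_mul_sub_mul_le hq0 hq ?_ ?_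
  · rw [← sub_div, norm_div, norm_div, ← mul_div_assoc]
    gcongr
    exact ultra_pow_sub_pow_le hq0 hq h p
  · refine norm_linearProd_sub_le (tendsto_invSeq_param hR hc) hq0 hq fun j => ?_
    have := norm_mul_le_of_notMem hR hc j (hz (j + 1) (Nat.le_add_left 1 j))
    rw [norm_mul] at this ⊢
    calc ‖invSeq c j‖ * ‖z' - z‖ ≤ ‖invSeq c j‖ * (q * ‖z‖) := by gcongr
      _ = q * (‖invSeq c j‖ * ‖z‖) := by ring
      _ ≤ _ := by gcongr

end Map

end Growth

section

variable {p : ℕ} [hp : Fact p.Prime] {R : ℕ → ℝ} {c : ℕ → ℂ_[p]}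

/-! ### Wild contraction on the unit disc -/

theorem rho_pos : 0 < rho p := Real.rpow_pos_of_pos prime_pos _

theorem rho_pow : rho p ^ (p - 1) = (p : ℝ)⁻¹ := by
  have h1 : (p : ℝ) - 1 ≠ 0 := (sub_pos.2 one_lt_prime).ne'
  rw [rho, ← Real.rpow_natCast, ← Real.rpow_mul prime_pos.le,
    Nat.cast_sub hp.out.one_lt.le, Nat.cast_one, div_mul_cancel₀ _ h1, Real.rpow_neg_one]

theorem rho_lt_one : rho p < 1 := by
  by_contra! h
  have := one_le_pow₀ (n := p - 1) h
  rw [rho_pow] at this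
  exact (inv_lt_one_of_one_lt₀ (one_lt_prime (p := p))).not_ge this

theorem norm_choose_le {i : ℕ} (hi : i ≠ 0) (hip : i < p) :
    ‖((p.choose i : ℕ) : ℂ_[p])‖ ≤ (p : ℝ)⁻¹ := by
  obtain ⟨m, hm⟩ := hp.out.dvd_choose_self hi hip
  rw [hm, Nat.cast_mul, norm_mul, norm_prime]
  exact mul_le_of_le_one_right (inv_nonneg.2 prime_pos.le)
    (IsUltrametricDist.norm_natCast_le_one ℂ_[p] m)

/-- The power map `z ↦ z ^ p` contracts relative distances that are at most `ϱ` by the factor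
`1 / p`. -/
theorem norm_pow_sub_pow_le {z z' : ℂ_[p]} {q : ℝ} (hq0 : 0 ≤ q) (hq : q ≤ rho p)
    (h : ‖z' - z‖ ≤ q * ‖z‖) : ‖z' ^ p - z ^ p‖ ≤ q / p * ‖z ^ p‖ := by
  have hq1 : q ≤ 1 := hq.trans rho_lt_one.le
  have hpp := prime_pos (p := p)
  obtain ⟨d, rfl⟩ : ∃ d, z' = z + d := ⟨z' - z, by ring⟩
  rw [add_sub_cancel_left] at h
  rw [add_pow, Finset.sum_range_succ]
  simp only [Nat.sub_self, pow_zero, mul_one, Nat.choose_self, Nat.cast_one, add_sub_cancel_right]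
  refine IsUltrametricDist.norm_sum_le_of_forall_le_of_nonneg (by positivity) fun i hi => ?_
  have hi := Finset.mem_range.1 hi
  rw [norm_mul, norm_mul, norm_pow, norm_pow, norm_pow]
  have hz : ‖z‖ ^ p = ‖z‖ ^ i * ‖z‖ ^ (p - i) := by
    rw [← pow_add, Nat.add_sub_cancel' hi.le]
  have hd : ‖d‖ ^ (p - i) ≤ q ^ (p - i) * ‖z‖ ^ (p - i) := by
    rw [← mul_pow]
    gcongr
  have key : q ^ (p - i) * ‖((p.choose i : ℕ) : ℂ_[p])‖ ≤ q / p := by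
    rcases eq_or_ne i 0 with rfl | hi0
    · rw [Nat.choose_zero_right, Nat.cast_one, norm_one, mul_one, Nat.sub_zero,
        ← mul_pow_sub_one hp.out.ne_zero, div_eq_mul_inv, ← rho_pow]
      gcongr
    · rw [div_eq_mul_inv]
      gcongr
      · exact pow_le_of_le_one hq0 hq1 (Nat.sub_ne_zero_of_lt hi)
      · exact norm_choose_le hi0 hi
  calc _ ≤ ‖z‖ ^ i * (q ^ (p - i) * ‖z‖ ^ (p - i)) * ‖((p.choose i : ℕ) : ℂ_[p])‖ := by gcongr
    _ = (q ^ (p - i) * ‖((p.choose i : ℕ) : ℂ_[p])‖) * ‖z‖ ^ p := by rw [hz]; ring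
    _ ≤ _ := by gcongr

/-- On the unit disc `f_c` contracts relative distances that are at most `ϱ` by the factor
`1 / p`. -/
theorem norm_entireMap_sub_le_of_unit (hR : IsGenericRadii p R) (hc : c ∈ paramSpace p R)
    {z z' : ℂ_[p]} (hz : ‖z‖ < 1) {q : ℝ} (hq0 : 0 ≤ q) (hq : q ≤ rho p)
    (h : ‖z' - z‖ ≤ q * ‖z‖) :
    ‖entireMap p c z' - entireMap p c z‖ ≤ q / p * ‖entireMap p c z‖ := by
  have hpp := prime_pos (p := p)
  have hq1 : q / p ≤ 1 := by
    rw [div_le_one hpp]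
    exact hq.trans (rho_lt_one.le.trans one_lt_prime.le)
  have hqp0 : 0 ≤ q / p := by positivity
  rw [entireMap_eq, entireMap_eq]
  refine ultra_mul_sub_mul_le hqp0 hq1 ?_ ?_
  · rw [← sub_div, norm_div, norm_div, ← mul_div_assoc]
    gcongr
    exact norm_pow_sub_pow_le hq0 hq h
  · refine norm_linearProd_sub_le (tendsto_invSeq_param hR hc) hqp0 hq1 fun j => ?_
    have hRj := hR.prime_lt (Nat.le_add_left 1 j)
    have hj : z ∉ diskB p R c (j + 1) := fun hmem => by
      have := norm_of_mem_diskB hc (Nat.le_add_left 1 j) hmem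
      linarith [one_lt_prime (p := p)]
    have h1 := one_sub_invSeq_of_notMem hR hc j hj
    rw [norm_mul, norm_invSeq hc, invSeq]
    calc (R (j + 1))⁻¹ * ‖z' - z‖ ≤ (p : ℝ)⁻¹ * (q * 1) := by
          gcongr
          exact h.trans (by gcongr)
      _ = q / p * 1 := by ring
      _ ≤ _ := by gcongr

/-! ### Expansion on the discs around the zeros -/

/-- The map `f_c` without its factor `1 - z / c_j`. -/
noncomputable def cofactor (p : ℕ) [Fact p.Prime] (c : ℕ → ℂ_[p]) (j : ℕ) (z : ℂ_[p]) : ℂ_[p] :=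
  z ^ p / p * linearProd (Function.update (invSeq c) (j - 1) 0) z

theorem invSeq_update (c : ℕ → ℂ_[p]) {j : ℕ} (hj : 1 ≤ j) (x : ℂ_[p]) :
    invSeq (Function.update c j x) = Function.update (invSeq c) (j - 1) x⁻¹ := by
  funext i
  rw [invSeq]
  rcases eq_or_ne i (j - 1) with rfl | hi
  · rw [Nat.sub_add_cancel hj, Function.update_self, Function.update_self]
  · rw [Function.update_of_ne (by omega), Function.update_of_ne hi, invSeq]

theorem entireMap_update (hR : IsGenericRadii p R) (hc : c ∈ paramSpace p R) {j : ℕ}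
    (hj : 1 ≤ j) (x z : ℂ_[p]) :
    entireMap p (Function.update c j x) z = (1 - x⁻¹ * z) * cofactor p c j z := by
  rw [entireMap_eq, invSeq_update c hj, linearProd_eq_mul_update (tendsto_invSeq_param hR hc),
    cofactor]
  ring

theorem entireMap_eq_cofactor (hR : IsGenericRadii p R) (hc : c ∈ paramSpace p R) {j : ℕ}
    (hj : 1 ≤ j) (z : ℂ_[p]) :
    entireMap p c z = (1 - (c j)⁻¹ * z) * cofactor p c j z := by
  rw [← entireMap_update hR hc hj, Function.update_eq_self]

theorem tendsto_update_invSeq (hR : IsGenericRadii p R) (hc : c ∈ paramSpace p R) (i : ℕ) :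
    Tendsto (Function.update (invSeq c) i 0) atTop (𝓝 0) := by
  refine (tendsto_invSeq_param hR hc).congr' ?_
  filter_upwards [eventually_gt_atTop i] with n hn
  rw [Function.update_of_ne hn.ne']

theorem isAnalyticOnDisc_cofactor (hR : IsGenericRadii p R) (hc : c ∈ paramSpace p R) (j : ℕ)
    {a : ℂ_[p]} {r : ℝ} {h : ℂ_[p] → ℂ_[p]} (hh : IsAnalyticOnDisc a r h) :
    IsAnalyticOnDisc a r fun s => cofactor p c j (h s) := by
  refine (((hh.pow p).const_mul (p : ℂ_[p])⁻¹).mul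
    (hh.linearProd (tendsto_update_invSeq hR hc (j - 1)))).congr fun s _ => ?_
  rw [cofactor, div_eq_inv_mul]

theorem norm_cofactor_eq (hR : IsGenericRadii p R) (hc : c ∈ paramSpace p R) {j : ℕ}
    (hj : 1 ≤ j) {z : ℂ_[p]} (hzR : ‖z‖ ≤ R j) (hz : ∀ i, 1 ≤ i → i ≠ j → z ∉ diskB p R c i) :
    ‖cofactor p c j z‖ = radialGrowth p R ‖z‖ := by
  have e : (fun i => ‖Function.update (invSeq c) (j - 1) 0 i‖) =
      Function.update (fun i => ‖invSeq c i‖) (j - 1) 0 := by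
    funext i
    rcases eq_or_ne i (j - 1) with rfl | hi
    · simp
    · rw [Function.update_of_ne hi, Function.update_of_ne hi]
  rw [cofactor, norm_mul, norm_linearProd_eq (tendsto_update_invSeq hR hc _), e,
    linearProdMax_update, growth_norm_eq hc]
  · rw [norm_invSeq hc, invSeq, Nat.sub_add_cancel hj]
    exact (inv_mul_le_one₀ (hR.pos hj)).2 hzR
  · intro i _
    rcases eq_or_ne i (j - 1) with rfl | hi
    · simp
    · rw [Function.update_of_ne hi]
      exact one_sub_invSeq_of_notMem hR hc i (hz (i + 1) (Nat.le_add_left 1 i) (by omega))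

theorem norm_cofactor_sub_le (hR : IsGenericRadii p R) (hc : c ∈ paramSpace p R) {j : ℕ}
    {z z' : ℂ_[p]} (hz : ∀ i, 1 ≤ i → i ≠ j → z ∉ diskB p R c i) {q : ℝ} (hq0 : 0 ≤ q)
    (hq : q ≤ 1) (h : ‖z' - z‖ ≤ q * ‖z‖) :
    ‖cofactor p c j z' - cofactor p c j z‖ ≤ q * ‖cofactor p c j z‖ := by
  rw [cofactor, cofactor]
  refine ultra_mul_sub_mul_le hq0 hq ?_ ?_
  · rw [← sub_div, norm_div, norm_div, ← mul_div_assoc]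
    gcongr
    exact ultra_pow_sub_pow_le hq0 hq h p
  · refine norm_linearProd_sub_le (tendsto_update_invSeq hR hc _) hq0 hq fun i => ?_
    rcases eq_or_ne i (j - 1) with rfl | hi
    · simpa using hq0
    rw [Function.update_of_ne hi]
    have := norm_mul_le_of_notMem hR hc i (hz (i + 1) (Nat.le_add_left 1 i) (by omega))
    rw [norm_mul] at this ⊢
    calc ‖invSeq c i‖ * ‖z' - z‖ ≤ ‖invSeq c i‖ * (q * ‖z‖) := by gcongr
      _ = q * (‖invSeq c i‖ * ‖z‖) := by ring
      _ ≤ _ := by gcongr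

theorem notMem_diskB_of_mem (hR : IsGenericRadii p R) (hc : c ∈ paramSpace p R) {j : ℕ}
    (hj : 1 ≤ j) {z : ℂ_[p]} (hz : z ∈ diskB p R c j) {i : ℕ} (hi : 1 ≤ i) (hij : i ≠ j) :
    z ∉ diskB p R c i := fun h =>
  hij (hR.eq_of_eq hi hj ((norm_of_mem_diskB hc hi h).symm.trans (norm_of_mem_diskB hc hj hz)))

/-- `f_c` scales all distances in `B_j` by the factor `Φ(R_j) / R_j`. -/
theorem norm_entireMap_sub_eq (hR : IsGenericRadii p R) (hc : c ∈ paramSpace p R) {j : ℕ}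
    (hj : 1 ≤ j) {z z' : ℂ_[p]} (hz : z ∈ diskB p R c j) (hz' : z' ∈ diskB p R c j) :
    ‖entireMap p c z' - entireMap p c z‖ = radialGrowth p R (R j) / R j * ‖z' - z‖ := by
  have hRj := hR.pos hj
  have hc0 := param_ne_zero hR hc hj
  have hzn := norm_of_mem_diskB hc hj hz
  have hG : ‖cofactor p c j z‖ = radialGrowth p R (R j) := by
    rw [norm_cofactor_eq hR hc hj hzn.le fun i => notMem_diskB_of_mem hR hc hj hz, hzn]
  have hz1 := (mem_diskB_iff c hj z).1 hz
  have hz1' := (mem_diskB_iff c hj z').1 hz'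
  have hdist : ‖z' - z‖ < R j := by
    have := ultra_sub_lt hz1' hz1
    rwa [sub_sub_sub_cancel_right] at this
  have hG' : ‖cofactor p c j z' - cofactor p c j z‖ ≤
      ‖z' - z‖ / R j * radialGrowth p R (R j) := by
    rw [← hG]
    refine norm_cofactor_sub_le hR hc (fun i => notMem_diskB_of_mem hR hc hj hz)
      (by positivity) ((div_le_one hRj).2 hdist.le) ?_
    rw [hzn, div_mul_cancel₀ _ hRj.ne']
  rcases eq_or_ne z' z with rfl | hne
  · simp
  have hd0 : 0 < ‖z' - z‖ := norm_pos_iff.2 (sub_ne_zero.2 hne)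
  have hΦ := hR.growth_pos hRj
  have e : entireMap p c z' - entireMap p c z =
      -((c j)⁻¹ * (z' - z) * cofactor p c j z) +
        (1 - (c j)⁻¹ * z') * (cofactor p c j z' - cofactor p c j z) := by
    rw [entireMap_eq_cofactor hR hc hj, entireMap_eq_cofactor hR hc hj]
    ring
  have h1 : ‖-((c j)⁻¹ * (z' - z) * cofactor p c j z)‖ =
      radialGrowth p R (R j) / R j * ‖z' - z‖ := by
    rw [norm_neg, norm_mul, norm_mul, norm_inv, hc j hj, hG]
    ring
  have h2 : ‖1 - (c j)⁻¹ * z'‖ < 1 := by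
    have e : 1 - (c j)⁻¹ * z' = -((c j)⁻¹ * (z' - c j)) := by field_simp; ring
    rw [e, norm_neg, norm_mul, norm_inv, hc j hj, inv_mul_lt_one₀ hRj]
    exact hz1'
  rw [e, ultra_add_eq_left, h1]
  rw [h1, norm_mul]
  calc _ ≤ ‖1 - (c j)⁻¹ * z'‖ * (‖z' - z‖ / R j * radialGrowth p R (R j)) := by gcongr
    _ < 1 * (‖z' - z‖ / R j * radialGrowth p R (R j)) := by gcongr
    _ = _ := by ring

theorem center_mem_diskB (hR : IsGenericRadii p R) (c : ℕ → ℂ_[p]) {j : ℕ} (hj : 1 ≤ j) :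
    c j ∈ diskB p R c j := by
  rw [mem_diskB_iff c hj, sub_self, norm_zero]
  exact hR.pos hj

theorem entireMap_center (hR : IsGenericRadii p R) (hc : c ∈ paramSpace p R) {j : ℕ}
    (hj : 1 ≤ j) : entireMap p c (c j) = 0 := by
  rw [entireMap_eq_cofactor hR hc hj, inv_mul_cancel₀ (param_ne_zero hR hc hj), sub_self,
    zero_mul]

theorem norm_entireMap_of_mem (hR : IsGenericRadii p R) (hc : c ∈ paramSpace p R) {j : ℕ}
    (hj : 1 ≤ j) {z : ℂ_[p]} (hz : z ∈ diskB p R c j) :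
    ‖entireMap p c z‖ = radialGrowth p R (R j) / R j * ‖z - c j‖ := by
  have := norm_entireMap_sub_eq hR hc hj (center_mem_diskB hR c hj) hz
  rwa [entireMap_center hR hc hj, sub_zero] at this

/-- A point of norm `R_j` whose image is smaller than `Φ(R_j)` lies in `B_j`. -/
theorem mem_diskB_of_norm_lt (hR : IsGenericRadii p R) (hc : c ∈ paramSpace p R) {j : ℕ}
    (hj : 1 ≤ j) {z : ℂ_[p]} (hz : ‖z‖ = R j)
    (h : ‖entireMap p c z‖ < radialGrowth p R (R j)) : z ∈ diskB p R c j := by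
  by_contra hno
  refine h.ne ?_
  rw [← hz]
  refine norm_entireMap_eq hR hc fun i hi hmem => ?_
  rcases eq_or_ne i j with rfl | hij
  · exact hno hmem
  · exact hij (hR.eq_of_eq hi hj ((norm_of_mem_diskB hc hi hmem).symm.trans hz))

theorem exists_fixedPt (hR : IsGenericRadii p R) (hc : c ∈ paramSpace p R) {j : ℕ}
    (hj : 1 ≤ j) : ∃ w, w ∈ diskB p R c j ∧ entireMap p c w = w := by
  have hRj := hR.pos hj
  have hΦ := hR.lt_growth (hR.one_lt hj).le
  have hΦ0 := hRj.trans hΦ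
  have hlt : R j * R j / radialGrowth p R (R j) < R j := by
    rw [div_lt_iff₀ hΦ0]
    gcongr
  obtain ⟨d, hd1, hd2⟩ := exists_norm_mem_Ioo (K := ℂ_[p])
    (show 0 < R j * R j / radialGrowth p R (R j) by positivity) hlt
  have hmem : c j + d ∈ diskB p R c j := by
    rw [mem_diskB_iff c hj, add_sub_cancel_left]
    exact hd2
  have hbig : R j < ‖entireMap p c (c j + d)‖ := by
    rw [norm_entireMap_of_mem hR hc hj hmem, add_sub_cancel_left]
    rw [div_lt_iff₀ hΦ0] at hd1
    rw [div_mul_eq_mul_div, lt_div_iff₀ hRj]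
    linarith
  have hana := (isAnalyticOnDisc_entireMap hR hc (IsAnalyticOnDisc.id (a := c j)
    (r := ‖d‖ + 1))).sub IsAnalyticOnDisc.id
  obtain ⟨w, hw, hw0, -⟩ := hana.exists_closest_zero (r := ‖d‖) (s' := c j + d)
    (lt_add_one _)
    (by
      rw [entireMap_center hR hc hj, zero_sub, neg_ne_zero]
      exact param_ne_zero hR hc hj)
    (by rw [add_sub_cancel_left])
    (by
      rw [entireMap_center hR hc hj, zero_sub, norm_neg, hc j hj, ultra_sub_eq_left]
      · exact hbig.ne'
      · rwa [norm_of_mem_diskB hc hj hmem])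
  refine ⟨w, ?_, sub_eq_zero.1 hw0⟩
  rw [mem_diskB_iff c hj]
  exact hw.trans_lt hd2

theorem fixedPt_spec (hR : IsGenericRadii p R) (hc : c ∈ paramSpace p R) {j : ℕ} (hj : 1 ≤ j) :
    fixedPt p R c j ∈ diskB p R c j ∧ entireMap p c (fixedPt p R c j) = fixedPt p R c j :=
  Classical.epsilon_spec (exists_fixedPt hR hc hj)

theorem norm_multiplier (hR : IsGenericRadii p R) (hc : c ∈ paramSpace p R) {j : ℕ}
    (hj : 1 ≤ j) : ‖multiplier p R c j‖ = radialGrowth p R (R j) / R j := by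
  set w := fixedPt p R c j with hw
  have hwmem : w ∈ diskB p R c j := (fixedPt_spec hR hc hj).1
  have hRj := hR.pos hj
  obtain ⟨d, hd⟩ := (isAnalyticOnDisc_entireMap hR hc (IsAnalyticOnDisc.id (a := w)
    (r := R j))).exists_hasDerivAt hRj
  rw [multiplier, ← hw, hd.deriv]
  refine tendsto_nhds_unique (hasDerivAt_iff_tendsto_slope.1 hd).norm
    (tendsto_const_nhds.congr' ?_)
  have hball : ∀ᶠ s in 𝓝[≠] w, ‖s - w‖ < R j ∧ s ≠ w := by
    refine (eventually_nhdsWithin_of_eventually_nhds ?_).and self_mem_nhdsWithin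
    filter_upwards [Metric.ball_mem_nhds w hRj] with s hs
    rwa [← dist_eq_norm]
  filter_upwards [hball] with s hs
  have hs0 : 0 < ‖s - w‖ := norm_pos_iff.2 (sub_ne_zero.2 hs.2)
  have hsmem : s ∈ diskB p R c j := by
    rw [mem_diskB_iff c hj] at hwmem ⊢
    exact ultra_sub_trans_lt hs.1 hwmem
  rw [slope_def_field, norm_div, norm_entireMap_sub_eq hR hc hj hwmem hsmem]
  field_simp

theorem radiusS_spec (hR : IsGenericRadii p R) (hc : c ∈ paramSpace p R) {j : ℕ} (hj : 1 ≤ j) :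
    0 < radiusS p R c j ∧ radialGrowth p R (radiusS p R c j) = R j := by
  obtain ⟨r, hr, hrj⟩ := hR.exists_growth_eq (hR.pos hj)
  have hex : ∃ a ∈ Set.Ioi (0 : ℝ), growth p c a = R j :=
    ⟨r, hr, by rw [growth_eq hR hc hr, hrj]⟩
  have h1 : 0 < radiusS p R c j := Function.invFunOn_mem hex
  refine ⟨h1, ?_⟩
  rw [← growth_eq hR hc h1]
  exact Function.invFunOn_eq hex

end

/-! ### Iterated inverse growth and transition times -/

/-- The inverse `Φ⁻¹` of the growth function on the positive reals. -/
noncomputable def growthInv (p : ℕ) (R : ℕ → ℝ) : ℝ → ℝ :=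
  Function.invFunOn (radialGrowth p R) (Set.Ioi 0)

section

variable {p : ℕ} [hp : Fact p.Prime] {R : ℕ → ℝ} {c : ℕ → ℂ_[p]}

namespace IsGenericRadii

theorem growthInv_pos (hR : IsGenericRadii p R) {y : ℝ} (hy : 0 < y) : 0 < growthInv p R y :=
  Function.invFunOn_mem (hR.exists_growth_eq hy)

theorem growth_growthInv (hR : IsGenericRadii p R) {y : ℝ} (hy : 0 < y) :
    radialGrowth p R (growthInv p R y) = y :=
  Function.invFunOn_eq (hR.exists_growth_eq hy)

theorem growthInv_iterate_pos (hR : IsGenericRadii p R) {y : ℝ} (hy : 0 < y) (n : ℕ) :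
    0 < (growthInv p R)^[n] y := by
  induction n with
  | zero => exact hy
  | succ n ih => rw [Function.iterate_succ_apply']; exact hR.growthInv_pos ih

theorem growth_growthInv_iterate (hR : IsGenericRadii p R) {y : ℝ} (hy : 0 < y) (n : ℕ) :
    radialGrowth p R ((growthInv p R)^[n + 1] y) = (growthInv p R)^[n] y := by
  rw [Function.iterate_succ_apply', hR.growth_growthInv (hR.growthInv_iterate_pos hy n)]

theorem growth_one (hR : IsGenericRadii p R) : radialGrowth p R 1 = p := by
  rw [hR.growth_eq_of_le_one le_rfl, one_pow, mul_one]

theorem growthInv_iterate_succ_lt_one (hR : IsGenericRadii p R) {y : ℝ} (hy : 0 < y) {n : ℕ}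
    (h : (growthInv p R)^[n] y < 1) : (growthInv p R)^[n + 1] y < 1 := by
  refine hR.lt_of_growth_lt zero_le_one ?_
  rw [hR.growth_growthInv_iterate hy, hR.growth_one]
  exact h.trans one_lt_prime

theorem growthInv_iterate_lt_one (hR : IsGenericRadii p R) {y : ℝ} (hy : 0 < y) {n m : ℕ}
    (h : (growthInv p R)^[n] y < 1) (hnm : n ≤ m) : (growthInv p R)^[m] y < 1 := by
  induction m, hnm using Nat.le_induction with
  | base => exact h
  | succ m _ ih => exact hR.growthInv_iterate_succ_lt_one hy ih

theorem one_le_growthInv_iterate (hR : IsGenericRadii p R) {y : ℝ} (hy : 0 < y) {n m : ℕ}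
    (h : 1 ≤ (growthInv p R)^[m] y) (hnm : n ≤ m) : 1 ≤ (growthInv p R)^[n] y := by
  by_contra! hlt
  exact (hR.growthInv_iterate_lt_one hy hlt hnm).not_ge h

theorem exists_growthInv_iterate_lt_one (hR : IsGenericRadii p R) {y : ℝ} (hy : 0 < y) :
    ∃ n, (growthInv p R)^[n] y < 1 := by
  by_contra! h
  have key : ∀ n, (p : ℝ) ^ n ≤ y := by
    intro n
    suffices (p : ℝ) ^ n * (growthInv p R)^[n] y ≤ y by
      have hpn : 0 < (p : ℝ) ^ n := pow_pos prime_pos n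
      nlinarith [h n]
    induction n with
    | zero => simp
    | succ n ih =>
      refine le_trans ?_ ih
      rw [pow_succ, mul_assoc, ← hR.growth_growthInv_iterate hy n]
      have := prime_pos (p := p)
      gcongr
      exact hR.prime_mul_le_growth (h (n + 1))
  obtain ⟨n, hn⟩ := pow_unbounded_of_one_lt y (one_lt_prime (p := p))
  exact (key n).not_gt hn

/-- Preimages under the growth function that are at least `1` are smaller than the target. -/
theorem growthInv_iterate_lt (hR : IsGenericRadii p R) {y : ℝ} (hy : 0 < y) {n : ℕ} (hn : 1 ≤ n)
    (h : 1 ≤ (growthInv p R)^[n] y) : (growthInv p R)^[n] y < y := by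
  induction n, hn using Nat.le_induction with
  | base =>
    have := hR.lt_growth h
    rwa [hR.growth_growthInv_iterate hy 0] at this
  | succ n _ ih =>
    have := hR.lt_growth h
    rw [hR.growth_growthInv_iterate hy n] at this
    exact this.trans (ih (h.trans this.le))

/-- Iterated preimages of `R_j` under the growth function avoid all radii `R_i`. -/
theorem growthInv_iterate_ne (hR : IsGenericRadii p R) (hc : c ∈ paramSpace p R) {i j n : ℕ}
    (hi : 1 ≤ i) (hj : 1 ≤ j) (hn : 1 ≤ n) : (growthInv p R)^[n] (R j) ≠ R i := by
  intro h
  have hpos := hR.growthInv_iterate_pos (hR.pos hj)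
  have hit : ∀ n m, (growth p c)^[n] ((growthInv p R)^[n + m] (R j)) =
      (growthInv p R)^[m] (R j) := by
    intro n
    induction n with
    | zero => intro m; rw [Nat.zero_add]; rfl
    | succ n ih =>
      intro m
      rw [Function.iterate_succ_apply, growth_eq hR hc (hpos _), Nat.add_right_comm,
        hR.growth_growthInv_iterate (hR.pos hj), ih]
  have h1 := hit n 0
  rw [Nat.add_zero, h, Function.iterate_zero, id] at h1
  rcases lt_or_ge i j with hij | hij
  · exact hR.independent c hc i j n hi hij hn h1
  · -- For `j ≤ i` the backward orbit of `R_j` cannot increase to `R_i`.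
    have hle : R j ≤ R i := by
      rcases hij.eq_or_lt with rfl | hij
      · exact le_rfl
      · exact (hR.increasing j i hj hij).le
    have := hR.growthInv_iterate_lt (hR.pos hj) hn (by rw [h]; exact (hR.one_lt hi).le)
    rw [h] at this
    exact this.not_ge hle

end IsGenericRadii

/-- If `h` vanishes at the centre of a disc and `h'` has the generic norm `Φ(|h|)`, then a bound
`Φ(ρ)` for `h'` on the disc gives the bound `ρ` for `h`, because `h` takes values of all smaller
norms. -/
theorem norm_le_of_growth_le (hR : IsGenericRadii p R) {a : ℂ_[p]} {r r₁ : ℝ} (hr : r < r₁)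
    {h h' : ℂ_[p] → ℂ_[p]} (hh : IsAnalyticOnDisc a r₁ h) (ha : h a = 0)
    (hh' : ∀ s, ‖s - a‖ ≤ r → (∀ j, 1 ≤ j → ‖h s‖ ≠ R j) → ‖h' s‖ = radialGrowth p R ‖h s‖)
    {ρ : ℝ} (hρ : 0 ≤ ρ) (hle : ∀ s, ‖s - a‖ ≤ r → ‖h' s‖ ≤ radialGrowth p R ρ) {s : ℂ_[p]}
    (hs : ‖s - a‖ ≤ r) : ‖h s‖ ≤ ρ := by
  by_contra! hlt
  obtain ⟨v, hv, hvR⟩ := exists_norm_mem_Ioo_ne_radii hR hρ hlt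
  obtain ⟨t, ht, rfl⟩ := hh.exists_eq_of_lt hr ha hs hv.2
  have := hle t ht
  rw [hh' t ht hvR] at this
  exact this.not_gt (hR.growth_lt hρ hv.1)

theorem norm_le_growthInv_iterate (hR : IsGenericRadii p R) {a : ℂ_[p]} {r r₁ : ℝ} (hr : r < r₁)
    {x : ℕ → ℂ_[p] → ℂ_[p]} (hx : ∀ i, IsAnalyticOnDisc a r₁ (x i)) {n : ℕ}
    (ha : ∀ i, x i a = 0)
    (hstep : ∀ i s, ‖s - a‖ ≤ r → (∀ j, 1 ≤ j → ‖x i s‖ ≠ R j) →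
      ‖x (i + 1) s‖ = radialGrowth p R ‖x i s‖)
    {y : ℝ} (hy : 0 < y) (hle : ∀ s, ‖s - a‖ ≤ r → ‖x n s‖ ≤ y) {i : ℕ} (hi : i ≤ n)
    {s : ℂ_[p]} (hs : ‖s - a‖ ≤ r) : ‖x (n - i) s‖ ≤ (growthInv p R)^[i] y := by
  induction i generalizing s with
  | zero => exact hle s hs
  | succ i ih =>
    refine norm_le_of_growth_le hR hr (hx _) (ha _) (hstep _)
      (hR.growthInv_iterate_pos hy _).le (fun t ht => ?_) hs
    rw [hR.growth_growthInv_iterate hy, show n - (i + 1) + 1 = n - i by omega]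
    exact ih (by omega) ht

theorem norm_iterate_lt (hR : IsGenericRadii p R) (hc : c ∈ paramSpace p R) {y : ℝ} (hy : 0 < y)
    {m : ℕ} {z : ℂ_[p]} (h : ‖z‖ < (growthInv p R)^[m] y) : ‖(entireMap p c)^[m] z‖ < y := by
  induction m generalizing z with
  | zero => exact h
  | succ m ih =>
    rw [Function.iterate_succ_apply]
    refine ih ((norm_entireMap_le hR hc z).trans_lt ?_)
    rw [← hR.growth_growthInv_iterate hy]
    exact hR.growth_lt (norm_nonneg z) h

theorem isAnalyticOnDisc_iterate (hR : IsGenericRadii p R) (hc : c ∈ paramSpace p R)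
    (a : ℂ_[p]) (r : ℝ) (n : ℕ) : IsAnalyticOnDisc a r fun s => (entireMap p c)^[n] s := by
  induction n with
  | zero => exact IsAnalyticOnDisc.id
  | succ n ih =>
    simp only [Function.iterate_succ_apply']
    exact isAnalyticOnDisc_entireMap hR hc ih

theorem entireMap_iterate_zero (c : ℕ → ℂ_[p]) (n : ℕ) : (entireMap p c)^[n] 0 = 0 :=
  Function.iterate_fixed (entireMap_zero c) n

/-- Points of the unit disc can reach `B_j` in `m` steps exactly when `Φ^{-m}(R_j) < 1`. -/
theorem preimage_inter_nonempty_iff (hR : IsGenericRadii p R) (hc : c ∈ paramSpace p R) {j : ℕ}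
    (hj : 1 ≤ j) (m : ℕ) :
    (((entireMap p c)^[m]) ⁻¹' diskB p R c j ∩ diskB p R c 0).Nonempty ↔
      (growthInv p R)^[m] (R j) < 1 := by
  have hRj := hR.pos hj
  constructor
  · rintro ⟨z, hz, hz0⟩
    rw [mem_diskB_zero_iff] at hz0
    by_contra! hge
    have := norm_iterate_lt hR hc hRj (hz0.trans_le hge)
    exact this.ne (norm_of_mem_diskB hc hj hz)
  · intro hlt
    obtain ⟨z₀, hz₀, hz₁⟩ := exists_norm_mem_Ioo (K := ℂ_[p])
      (hR.growthInv_iterate_pos hRj m) hlt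
    by_contra hno
    rw [Set.not_nonempty_iff_eq_empty, Set.eq_empty_iff_forall_notMem] at hno
    have hne : ∀ z : ℂ_[p], ‖z - 0‖ ≤ ‖z₀‖ → (entireMap p c)^[m] z - c j ≠ 0 := by
      intro z hz h0
      refine hno z ⟨?_, ?_⟩
      · rw [Set.mem_preimage, sub_eq_zero.1 h0]
        exact center_mem_diskB hR c hj
      · rw [sub_zero] at hz
        rw [mem_diskB_zero_iff]
        exact hz.trans_lt hz₁
    have hconst := fun z (hz : ‖z - 0‖ ≤ ‖z₀‖) =>
      ((isAnalyticOnDisc_iterate hR hc 0 1 m).sub (.const (c j))).norm_eq_of_ne_zero hz₁ hne hz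
    rw [entireMap_iterate_zero, zero_sub, norm_neg, hc j hj] at hconst
    have := norm_le_growthInv_iterate hR hz₁ (x := fun i z => (entireMap p c)^[i] z) (n := m)
      (isAnalyticOnDisc_iterate hR hc 0 1) (entireMap_iterate_zero c)
      (fun i z _ hz => by
        rw [Function.iterate_succ_apply', norm_entireMap_eq_of_norm_ne hR hc hz])
      hRj (fun z hz => by
        have := ultra_add_le (hconst z hz).le (hc j hj).le
        rwa [sub_add_cancel] at this) le_rfl (s := z₀) (by rw [sub_zero])
    rw [Nat.sub_self] at this
    exact this.not_gt hz₀

theorem transitTime_spec (hR : IsGenericRadii p R) (hc : c ∈ paramSpace p R) {j : ℕ}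
    (hj : 1 ≤ j) : 1 ≤ transitTime p R c j ∧
      1 ≤ (growthInv p R)^[transitTime p R c j] (R j) ∧
      (growthInv p R)^[transitTime p R c j + 1] (R j) < 1 := by
  have hRj := hR.pos hj
  have hset : {n : ℕ | 1 ≤ n ∧
      (((entireMap p c)^[n + 1]) ⁻¹' diskB p R c j ∩ diskB p R c 0).Nonempty} =
      {n | 1 ≤ n ∧ (growthInv p R)^[n + 1] (R j) < 1} := by
    ext n
    exact and_congr_right fun _ => preimage_inter_nonempty_iff hR hc hj (n + 1)
  have hne : {n | 1 ≤ n ∧ (growthInv p R)^[n + 1] (R j) < 1}.Nonempty := by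
    obtain ⟨n, hn⟩ := hR.exists_growthInv_iterate_lt_one hRj
    exact ⟨n + 1, Nat.le_add_left 1 n, hR.growthInv_iterate_lt_one hRj hn (by omega)⟩
  have hmem := Nat.sInf_mem hne
  rw [← hset] at hmem
  change transitTime p R c j ∈ _ at hmem
  rw [hset] at hmem
  refine ⟨hmem.1, ?_, hmem.2⟩
  rcases hmem.1.eq_or_lt with h1 | h1
  · rw [← h1]
    refine hR.le_of_growth_le (hR.growthInv_iterate_pos hRj 1).le ?_
    rw [hR.growth_growthInv_iterate hRj 0, hR.growth_one]
    exact (hR.prime_lt hj).le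
  · by_contra! hlt
    have hle : transitTime p R c j ≤ transitTime p R c j - 1 := by
      refine Nat.sInf_le ?_
      rw [hset]
      refine ⟨by omega, ?_⟩
      rwa [Nat.sub_add_cancel hmem.1]
    omega

end

/-! ### The symbolic words -/

/-- The word `∏_{1 ≤ j < k} B_0^{m_j} A^{n_j} B_j^{ℓ_{j+1}}`, so that
`α^{(k)} = prefixWord k · B_0^{m_k} A^{n_k} B_k`. -/
def prefixWord (m l n : ℕ → ℕ) (k : ℕ) : List Letter :=
  (List.Ico 1 k).flatMap
    fun j => wildWord m n j ++ List.replicate (l (j + 1)) (Letter.B j)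

/-- The starting time of the `k`-th block, that is, the length of `prefixWord k`. -/
def blockStart (m l n : ℕ → ℕ) (k : ℕ) : ℕ := (prefixWord m l n k).length

section Words

variable (m l n : ℕ → ℕ)

theorem prefixWord_one : prefixWord m l n 1 = [] := by simp [prefixWord]

theorem prefixWord_succ {k : ℕ} (hk : 1 ≤ k) : prefixWord m l n (k + 1) =
    prefixWord m l n k ++ (wildWord m n k ++ List.replicate (l (k + 1)) (Letter.B k)) := by
  simp [prefixWord, List.Ico.succ_top hk]

theorem blockStart_one : blockStart m l n 1 = 0 := by
  rw [blockStart, prefixWord_one, List.length_nil]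

theorem blockStart_succ {k : ℕ} (hk : 1 ≤ k) : blockStart m l n (k + 1) =
    blockStart m l n k + (m k + n k + l (k + 1)) := by
  rw [blockStart, blockStart, prefixWord_succ m l n hk]
  simp only [wildWord, List.length_append, List.length_replicate]

theorem blockStart_mono {i k : ℕ} (hi : 1 ≤ i) (hik : i ≤ k) :
    blockStart m l n i ≤ blockStart m l n k := by
  induction k, hik using Nat.le_induction with
  | base => exact le_rfl
  | succ k hik ih =>
    rw [blockStart_succ m l n (hi.trans hik)]
    omega

theorem getD_append_replicate {α : Type*} (w : List α) (s : α) (r j : ℕ) :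
    (w ++ List.replicate r s).getD j s = w.getD j s := by
  rcases lt_or_ge j w.length with h | h
  · rw [List.getD_append _ _ _ _ h]
  · rw [List.getD_append_right _ _ _ _ h, List.getD_eq_default _ _ h]
    rcases lt_or_ge (j - w.length) r with h' | h'
    · rw [List.getD_replicate _ h']
    · rw [List.getD_eq_default]
      simpa using h'

theorem padWord_truncWord {k : ℕ} (j : ℕ) : padWord (truncWord m l n k) (Letter.B k) j =
    (prefixWord m l n k ++ wildWord m n k).getD j (Letter.B k) :=
  getD_append_replicate _ _ 1 j

theorem padWord_truncWord_eq_prefixWord_succ {k : ℕ} (hk : 1 ≤ k) (j : ℕ) :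
    padWord (truncWord m l n k) (Letter.B k) j =
      (prefixWord m l n (k + 1)).getD j (Letter.B k) := by
  rw [padWord_truncWord, prefixWord_succ m l n hk, ← List.append_assoc, getD_append_replicate]

theorem getD_wildWord_zero {k t : ℕ} (ht : t < m k) (s : Letter) :
    (wildWord m n k).getD t s = Letter.B 0 := by
  rw [wildWord, List.getD_append _ _ _ _ (by simpa using ht), List.getD_replicate _ ht]

theorem getD_wildWord_A {k t : ℕ} (ht : t < n k) (s : Letter) :
    (wildWord m n k).getD (m k + t) s = Letter.A := by
  rw [wildWord, List.getD_append_right _ _ _ _ (by simp), List.length_replicate,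
    Nat.add_sub_cancel_left, List.getD_replicate _ ht]

theorem getD_wildWord_default {k t : ℕ} (s : Letter) :
    (wildWord m n k).getD (m k + n k + t) s = s := by
  rw [List.getD_eq_default]
  simp [wildWord]

theorem getD_prefixWord_of_le {i k : ℕ} (hi : 1 ≤ i) (hik : i ≤ k) {j : ℕ}
    (hj : j < blockStart m l n i) (s : Letter) :
    (prefixWord m l n k).getD j s = (prefixWord m l n i).getD j s := by
  induction k, hik using Nat.le_induction with
  | base => rfl
  | succ k hik ih =>
    rw [prefixWord_succ m l n (hi.trans hik), ← ih, List.getD_append]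
    exact hj.trans_le (blockStart_mono m l n hi hik)

/-- The letters of the `i`-th block. -/
theorem getD_prefixWord_block {i k t : ℕ} (hi : 1 ≤ i) (hik : i < k)
    (ht : t < m i + n i + l (i + 1)) (s : Letter) :
    (prefixWord m l n k).getD (blockStart m l n i + t) s =
      (wildWord m n i ++ List.replicate (l (i + 1)) (Letter.B i)).getD t s := by
  rw [getD_prefixWord_of_le m l n (i := i + 1) (by omega) hik
      (by rw [blockStart_succ m l n hi]; omega),
    prefixWord_succ m l n hi, List.getD_append_right _ _ _ _ (by rw [blockStart]; omega),
    blockStart, Nat.add_sub_cancel_left]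

theorem getD_block_B {i t : ℕ} (ht : t < l (i + 1)) (s : Letter) :
    (wildWord m n i ++ List.replicate (l (i + 1)) (Letter.B i)).getD (m i + n i + t) s =
      Letter.B i := by
  have hlen : (wildWord m n i).length = m i + n i := by simp [wildWord]
  rw [List.getD_append_right _ _ _ _ (by omega), hlen, Nat.add_sub_cancel_left,
    List.getD_replicate _ ht]

end Words

section

variable {p : ℕ} [hp : Fact p.Prime] {R : ℕ → ℝ} {c : ℕ → ℂ_[p]}

/-! ### Perturbing one zero: a single step -/

theorem update_mem_paramSpace (hc : c ∈ paramSpace p R) {κ : ℕ} {ξ : ℂ_[p]} (hξ : ‖ξ‖ = R κ) :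
    Function.update c κ ξ ∈ paramSpace p R := by
  intro j hj
  rcases eq_or_ne j κ with rfl | hne
  · rwa [Function.update_self]
  · rw [Function.update_of_ne hne, hc j hj]

theorem mem_diskB_update_iff (c : ℕ → ℂ_[p]) {j κ : ℕ} (hjκ : j ≠ κ) (ξ z : ℂ_[p]) :
    z ∈ diskB p R (Function.update c κ ξ) j ↔ z ∈ diskB p R c j := by
  unfold diskB
  rw [Function.update_of_ne hjκ]

theorem notMem_piece_A (c : ℕ → ℂ_[p]) {z : ℂ_[p]} (hz : z ∈ piece p R c Letter.A) (j : ℕ) :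
    z ∉ diskB p R c j := fun h => hz (Set.mem_iUnion.2 ⟨j, h⟩)

theorem one_le_norm_of_piece_A (c : ℕ → ℂ_[p]) {z : ℂ_[p]} (hz : z ∈ piece p R c Letter.A) :
    1 ≤ ‖z‖ := by
  have := notMem_piece_A c hz 0
  rw [mem_diskB_zero_iff] at this
  exact not_lt.1 this

/-- The piece containing a point `z` is determined by the norms of `z` and `f_c(z)`. -/
theorem mem_piece_of_norm_eq (hR : IsGenericRadii p R) (hc : c ∈ paramSpace p R)
    {c' : ℕ → ℂ_[p]} (hc' : c' ∈ paramSpace p R) {z z' : ℂ_[p]} {α : Letter}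
    (hz : z ∈ piece p R c α) (h : ‖z'‖ = ‖z‖)
    (hf : ‖entireMap p c' z'‖ = ‖entireMap p c z‖) : z' ∈ piece p R c' α := by
  -- The image of a point of `B_j` is smaller than the generic value `Φ(R_j)`.
  have hsmall : ∀ {c : ℕ → ℂ_[p]}, c ∈ paramSpace p R → ∀ {j : ℕ} {z : ℂ_[p]}, 1 ≤ j →
      z ∈ diskB p R c j → ‖entireMap p c z‖ < radialGrowth p R (R j) := by
    intro c hc j z hj hz
    have hRj := hR.pos hj
    have hΦ := hR.growth_pos hRj
    rw [norm_entireMap_of_mem hR hc hj hz, div_mul_eq_mul_div, div_lt_iff₀ hRj]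
    gcongr
    exact (mem_diskB_iff c hj z).1 hz
  cases α with
  | A =>
    have hgen := norm_entireMap_eq hR hc fun j _ => notMem_piece_A c hz j
    intro hmem
    obtain ⟨j, hj⟩ := Set.mem_iUnion.1 hmem
    rcases Nat.eq_zero_or_pos j with rfl | hj0
    · rw [mem_diskB_zero_iff, h] at hj
      exact hj.not_ge (one_le_norm_of_piece_A c hz)
    · have := hsmall hc' hj0 hj
      rw [hf, hgen, ← h, norm_of_mem_diskB hc' hj0 hj] at this
      exact lt_irrefl _ this
  | B j =>
    change z' ∈ diskB p R c' j
    change z ∈ diskB p R c j at hz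
    rcases Nat.eq_zero_or_pos j with rfl | hj0
    · rw [mem_diskB_zero_iff] at hz ⊢
      rwa [h]
    · refine mem_diskB_of_norm_lt hR hc' hj0 (h.trans (norm_of_mem_diskB hc hj0 hz)) ?_
      rw [hf]
      exact hsmall hc hj0 hz

theorem norm_one_sub_inv_mul {ξ z : ℂ_[p]} {ρ : ℝ} (hξ : ‖ξ‖ = ρ) (hz : ‖z‖ < ρ) :
    ‖1 - ξ⁻¹ * z‖ = 1 := by
  have hρ : 0 < ρ := (norm_nonneg z).trans_lt hz
  have : ‖ξ⁻¹ * z‖ < ‖(1 : ℂ_[p])‖ := by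
    rw [norm_mul, norm_inv, hξ, norm_one, inv_mul_lt_one₀ hρ]
    exact hz
  rw [ultra_sub_eq_left this, norm_one]

theorem norm_entireMap_update (hR : IsGenericRadii p R) (hc : c ∈ paramSpace p R) {κ : ℕ}
    (hκ : 1 ≤ κ) {ξ : ℂ_[p]} (hξ : ‖ξ‖ = R κ) {z : ℂ_[p]} (hz : ‖z‖ < R κ) :
    ‖entireMap p (Function.update c κ ξ) z‖ = ‖entireMap p c z‖ := by
  rw [entireMap_update hR hc hκ, entireMap_eq_cofactor hR hc hκ, norm_mul, norm_mul,
    norm_one_sub_inv_mul hξ hz, norm_one_sub_inv_mul (hc κ hκ) hz]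

/-- The effect of moving the zero `c_κ` on the value at a point `z` with `|z| < R_κ`. -/
theorem norm_entireMap_update_sub (hR : IsGenericRadii p R) (hc : c ∈ paramSpace p R) {κ : ℕ}
    (hκ : 1 ≤ κ) (ξ : ℂ_[p]) {z : ℂ_[p]} (hz : ‖z‖ < R κ) :
    ‖entireMap p (Function.update c κ ξ) z - entireMap p c z‖ =
      ‖ξ⁻¹ - (c κ)⁻¹‖ * ‖z‖ * ‖entireMap p c z‖ := by
  have e : entireMap p (Function.update c κ ξ) z - entireMap p c z =
      -((ξ⁻¹ - (c κ)⁻¹) * z * cofactor p c κ z) := by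
    rw [entireMap_update hR hc hκ, entireMap_eq_cofactor hR hc hκ]
    ring
  have e' : ‖entireMap p c z‖ = ‖cofactor p c κ z‖ := by
    rw [entireMap_eq_cofactor hR hc hκ, norm_mul, norm_one_sub_inv_mul (hc κ hκ) hz, one_mul]
  rw [e, norm_neg, norm_mul, norm_mul, e']

/-- One step outside the unit disc and the discs `B_j`: the relative deviation of the perturbed
orbit does not grow, except for the deviation `δ |z|` created by the perturbation. -/
theorem deviation_A (hR : IsGenericRadii p R) (hc : c ∈ paramSpace p R) {κ : ℕ} (hκ : 1 ≤ κ)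
    {ξ : ℂ_[p]} (hξ : ‖ξ‖ = R κ) {z z' : ℂ_[p]} (hz : z ∈ piece p R c Letter.A)
    (hzκ : ‖z‖ < R κ) {Q : ℝ} (hclose : ‖z' - z‖ ≤ ‖z‖) (hD : ‖z' - z‖ < Q * ‖z‖) :
    ‖entireMap p (Function.update c κ ξ) z' - entireMap p (Function.update c κ ξ) z‖ <
      Q * ‖entireMap p c z‖ := by
  have hc' := update_mem_paramSpace hc hξ
  have hz0 : 0 < ‖z‖ := one_pos.trans_le (one_le_norm_of_piece_A c hz)
  have hf : 0 < ‖entireMap p c z‖ := by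
    rw [norm_entireMap_eq hR hc fun j _ => notMem_piece_A c hz j]
    exact hR.growth_pos hz0
  refine (norm_entireMap_sub_le hR hc' (z := z) (q := ‖z' - z‖ / ‖z‖) (fun j hj => ?_)
    (by positivity) ((div_le_one hz0).2 hclose) (by field_simp; exact le_rfl)).trans_lt ?_
  · rcases eq_or_ne j κ with rfl | hne
    · intro h
      exact hzκ.ne (norm_of_mem_diskB hc' hj h)
    · rw [mem_diskB_update_iff c hne]
      exact notMem_piece_A c hz j
  · rw [norm_entireMap_update hR hc hκ hξ hzκ]
    gcongr
    rwa [div_lt_iff₀ hz0]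

/-- One step in the unit disc: relative deviations that are at most `ϱ` are divided by `p`. -/
theorem deviation_wild (hR : IsGenericRadii p R) (hc : c ∈ paramSpace p R) {κ : ℕ} (hκ : 1 ≤ κ)
    {ξ : ℂ_[p]} (hξ : ‖ξ‖ = R κ) {z z' : ℂ_[p]} (hz : ‖z‖ < 1) (hz0 : z ≠ 0)
    {Q : ℝ} (hclose : ‖z' - z‖ ≤ rho p * ‖z‖) (hD : ‖z' - z‖ < Q * ‖z‖) :
    ‖entireMap p (Function.update c κ ξ) z' - entireMap p (Function.update c κ ξ) z‖ <
      Q / p * ‖entireMap p c z‖ := by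
  have hc' := update_mem_paramSpace hc hξ
  have hz0 : 0 < ‖z‖ := norm_pos_iff.2 hz0
  have hf : 0 < ‖entireMap p c z‖ := by
    rw [norm_entireMap_eq_of_norm_ne hR hc]
    · exact hR.growth_pos hz0
    · intro j hj h
      linarith [hR.one_lt hj]
  have hpp := prime_pos (p := p)
  refine (norm_entireMap_sub_le_of_unit hR hc' hz (q := ‖z' - z‖ / ‖z‖)
    (by positivity) ((div_le_iff₀ hz0).2 hclose) (by field_simp; exact le_rfl)).trans_lt ?_
  rw [norm_entireMap_update hR hc hκ hξ (hz.trans (hR.one_lt hκ))]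
  gcongr
  rwa [div_lt_iff₀ hz0]

/-- In the disc `|z| ≤ ϱ` the map `f_c` does not increase norms. -/
theorem norm_iterate_le_rho (hR : IsGenericRadii p R) (hc : c ∈ paramSpace p R) {z : ℂ_[p]}
    (hz : ‖z‖ ≤ rho p) (n : ℕ) : ‖(entireMap p c)^[n] z‖ ≤ rho p := by
  induction n with
  | zero => exact hz
  | succ n ih =>
    rw [Function.iterate_succ_apply']
    refine (norm_entireMap_le hR hc _).trans ((hR.growth_le (norm_nonneg _) ih).trans_eq ?_)
    rw [hR.growth_eq_of_le_one rho_lt_one.le, ← pow_sub_one_mul hp.out.ne_zero, rho_pow,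
      ← mul_assoc, mul_inv_cancel₀ (prime_pos (p := p)).ne', one_mul]

end

/-! ### Perturbing one zero: the deviation along the itinerary -/

/-- The orbit of `x` under `f_c` starts with the blocks `B_0^{m_i} A^{n_i} B_i^{ℓ_{i+1}}`,
`1 ≤ i ≤ k`, and is in `B_k` at the end of the last block. -/
structure HasBlocks (p : ℕ) [Fact p.Prime] (R : ℕ → ℝ) (c : ℕ → ℂ_[p]) (m l n : ℕ → ℕ) (k : ℕ)
    (x : ℂ_[p]) : Prop where
  wild : ∀ i t, 1 ≤ i → i ≤ k → t < m i → ‖(entireMap p c)^[blockStart m l n i + t] x‖ < 1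
  transit : ∀ i t, 1 ≤ i → i ≤ k → t < n i →
    (entireMap p c)^[blockStart m l n i + m i + t] x ∈ piece p R c Letter.A
  tame : ∀ i t, 1 ≤ i → i ≤ k → t < l (i + 1) →
    (entireMap p c)^[blockStart m l n i + m i + n i + t] x ∈ diskB p R c i
  final : (entireMap p c)^[blockStart m l n (k + 1)] x ∈ diskB p R c k

section

variable {p : ℕ} [hp : Fact p.Prime] {R : ℕ → ℝ} {c : ℕ → ℂ_[p]} {m l n : ℕ → ℕ} {k : ℕ}
  {x : ℂ_[p]}

theorem hasBlocks_of_hasItinerary (hk : 1 ≤ k)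
    (hx : HasItinerary p R c x (padWord (truncWord m l n k) (Letter.B k))) :
    HasBlocks p R c m l n k x := by
  have hx' : ∀ j, (entireMap p c)^[j] x ∈
      piece p R c ((prefixWord m l n (k + 1)).getD j (Letter.B k)) := fun j => by
    rw [← padWord_truncWord_eq_prefixWord_succ m l n hk]
    exact hx j
  have hblock : ∀ i t, 1 ≤ i → i ≤ k → t < m i + n i + l (i + 1) →
      (entireMap p c)^[blockStart m l n i + t] x ∈ piece p R c
        ((wildWord m n i ++ List.replicate (l (i + 1)) (Letter.B i)).getD t (Letter.B k)) := by
    intro i t hi hik ht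
    rw [← getD_prefixWord_block m l n hi (Nat.lt_succ_of_le hik) ht]
    exact hx' _
  have hlen : ∀ i, (wildWord m n i).length = m i + n i := fun i => by simp [wildWord]
  refine ⟨fun i t hi hik ht => ?_, fun i t hi hik ht => ?_, fun i t hi hik ht => ?_, ?_⟩
  · have := hblock i t hi hik (by omega)
    rw [List.getD_append _ _ _ _ (by rw [hlen]; omega), getD_wildWord_zero m n ht] at this
    exact (mem_diskB_zero_iff (R := R) c _).1 this
  · have := hblock i (m i + t) hi hik (by omega)
    rwa [List.getD_append _ _ _ _ (by rw [hlen]; omega), getD_wildWord_A m n ht,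
      ← Nat.add_assoc] at this
  · have := hblock i (m i + n i + t) hi hik (by omega)
    rw [getD_block_B m l n ht] at this
    rw [Nat.add_assoc, Nat.add_assoc, ← Nat.add_assoc (m i)]
    exact this
  · have := hx' (blockStart m l n (k + 1))
    rwa [List.getD_eq_default _ _ (le_refl (blockStart m l n (k + 1)))] at this

namespace HasBlocks

theorem norm_transit (hR : IsGenericRadii p R) (hc : c ∈ paramSpace p R)
    (hb : HasBlocks p R c m l n k x) (hl : ∀ i, 1 ≤ i → 1 ≤ l (i + 1)) {i : ℕ} (hi : 1 ≤ i)
    (hik : i ≤ k) {s : ℕ} (hs : s ≤ n i) :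
    ‖(entireMap p c)^[blockStart m l n i + m i + (n i - s)] x‖ = (growthInv p R)^[s] (R i) := by
  induction s with
  | zero => exact norm_of_mem_diskB hc hi (hb.tame i 0 hi hik (hl i hi))
  | succ s ih =>
    have ih := ih (by omega)
    have hA := hb.transit i (n i - (s + 1)) hi hik (by omega)
    have hstep := norm_entireMap_eq hR hc fun j _ => notMem_piece_A c hA j
    rw [← Function.iterate_succ_apply' (entireMap p c), show (blockStart m l n i + m i + (n i - (s + 1))).succ =
      blockStart m l n i + m i + (n i - s) by omega, ih,
      ← hR.growth_growthInv_iterate (hR.pos hi)] at hstep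
    exact (hR.growth_inj (hR.growthInv_iterate_pos (hR.pos hi) _).le (norm_nonneg _) hstep).symm

theorem ne_zero (hR : IsGenericRadii p R) (hc : c ∈ paramSpace p R) (hk : 1 ≤ k)
    (hb : HasBlocks p R c m l n k x) {j : ℕ} (hj : j ≤ blockStart m l n (k + 1)) :
    (entireMap p c)^[j] x ≠ 0 := by
  intro h
  have hL := norm_of_mem_diskB hc hk hb.final
  rw [← Nat.sub_add_cancel hj, Function.iterate_add_apply, h, entireMap_iterate_zero,
    norm_zero] at hL
  exact (hR.pos hk).ne hL

theorem norm_transit_lt (hR : IsGenericRadii p R) (hc : c ∈ paramSpace p R)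
    (hb : HasBlocks p R c m l n k x) (hl : ∀ i, 1 ≤ i → 1 ≤ l (i + 1)) {i t : ℕ} (hi : 1 ≤ i)
    (hik : i ≤ k) (ht : t < n i) :
    ‖(entireMap p c)^[blockStart m l n i + m i + t] x‖ < R (k + 1) := by
  have h1 := one_le_norm_of_piece_A c (hb.transit i t hi hik ht)
  have h2 := hb.norm_transit hR hc hl hi hik (s := n i - t) (by omega)
  rw [show n i - (n i - t) = t by omega] at h2
  rw [h2] at h1 ⊢
  exact (hR.growthInv_iterate_lt (hR.pos hi) (by omega) h1).trans
    (hR.increasing i (k + 1) hi (by omega))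

/-- Points that enter the unit disc and leave it later have norm larger than `ϱ`. -/
theorem rho_lt_norm (hR : IsGenericRadii p R) (hc : c ∈ paramSpace p R)
    (hb : HasBlocks p R c m l n k x) {i : ℕ} (hi : 1 ≤ i) (hik : i ≤ k) (hn : 1 ≤ n i) :
    rho p < ‖(entireMap p c)^[blockStart m l n i] x‖ := by
  by_contra! h
  have h1 := norm_iterate_le_rho hR hc h (m i)
  rw [← Function.iterate_add_apply, Nat.add_comm] at h1
  have h2 := one_le_norm_of_piece_A c (hb.transit i 0 hi hik hn)
  rw [Nat.add_zero] at h2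
  linarith [rho_lt_one (p := p)]

/-- The deviation `|f_{c'}^j(x) - f_c^j(x)|` after the block `B_0^{m_i} A^{n_i} B_i^{ℓ_{i+1}}`,
where `c'` arises from `c` by moving `c_{k+1}`.  If the deviation is small at the beginning of the
block, then the contraction in the unit disc makes it negligible against the deviation
`R_i Φ⁻¹(R_i) δ` that the perturbation creates at the entry into `B_i`; the latter is multiplied by
`Φ(R_i) / R_i` in each step in `B_i`. -/
theorem deviation_block (hR : IsGenericRadii p R) (hc : c ∈ paramSpace p R)
    (hb : HasBlocks p R c m l n k x) (hl : ∀ i, 1 ≤ i → 1 ≤ l (i + 1))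
    (hm : ∀ i, 1 ≤ i → 1 ≤ m i) (hn : ∀ i, 1 ≤ i → 1 ≤ n i)
    {ξ : ℂ_[p]} (hξ : ‖ξ‖ = R (k + 1)) {δ : ℝ} (hδ : ‖ξ⁻¹ - (c (k + 1))⁻¹‖ = δ) (hδ0 : 0 < δ)
    (hclose : ∀ j ≤ blockStart m l n (k + 1),
      ‖(entireMap p (Function.update c (k + 1) ξ))^[j] x - (entireMap p c)^[j] x‖ ≤
        rho p * ‖(entireMap p c)^[j] x‖)
    {i : ℕ} (hi : 1 ≤ i) (hik : i ≤ k)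
    (hstart : ‖(entireMap p (Function.update c (k + 1) ξ))^[blockStart m l n i] x -
      (entireMap p c)^[blockStart m l n i] x‖ <
        (p : ℝ) ^ m i * δ * ‖(entireMap p c)^[blockStart m l n i] x‖) :
    ‖(entireMap p (Function.update c (k + 1) ξ))^[blockStart m l n (i + 1)] x -
      (entireMap p c)^[blockStart m l n (i + 1)] x‖ =
        (radialGrowth p R (R i) / R i) ^ l (i + 1) * (R i * growthInv p R (R i) * δ) := by
  have hk : 1 ≤ k := hi.trans hik
  have hκ : 1 ≤ k + 1 := by omega
  have hRi := hR.pos hi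
  have hRik : R i < R (k + 1) := hR.increasing i (k + 1) hi (by omega)
  have hc' := update_mem_paramSpace hc hξ
  have hρ1 := rho_lt_one (p := p)
  have hp0 := prime_pos (p := p)
  have hp1 := one_lt_prime (p := p)
  set f := entireMap p c with hf
  set f' := entireMap p (Function.update c (k + 1) ξ) with hf'
  set T := blockStart m l n i with hT
  have hTs : blockStart m l n (i + 1) = T + m i + n i + l (i + 1) := by
    rw [blockStart_succ m l n hi]; omega
  have hTL : T + m i + n i + l (i + 1) ≤ blockStart m l n (k + 1) := by
    rw [← hTs]
    exact blockStart_mono m l n (by omega) (by omega)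
  have hz0 : ∀ j ≤ blockStart m l n (k + 1), 0 < ‖f^[j] x‖ := fun j hj =>
    norm_pos_iff.2 (hb.ne_zero hR hc hk hj)
  have hsplit : ∀ j, f'^[j + 1] x - f^[j + 1] x =
      (f' (f'^[j] x) - f' (f^[j] x)) + (f' (f^[j] x) - f (f^[j] x)) := fun j => by
    rw [Function.iterate_succ_apply', Function.iterate_succ_apply']
    ring
  have hinj : ∀ j, ‖f^[j] x‖ < R (k + 1) →
      ‖f' (f^[j] x) - f (f^[j] x)‖ = δ * ‖f^[j] x‖ * ‖f^[j + 1] x‖ := fun j hj => by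
    rw [← hδ, Function.iterate_succ_apply']
    exact norm_entireMap_update_sub hR hc hκ ξ hj
  have hclose1 : ∀ j ≤ blockStart m l n (k + 1), ‖f'^[j] x - f^[j] x‖ < ‖f^[j] x‖ :=
    fun j hj => (hclose j hj).trans_lt (mul_lt_of_lt_one_left (hz0 j hj) hρ1)
  -- In the unit disc the relative deviation is divided by `p` in each step.
  have hwild : ∀ t ≤ m i, ‖f'^[T + t] x - f^[T + t] x‖ <
      (p : ℝ) ^ (m i - t) * δ * ‖f^[T + t] x‖ := by
    intro t
    induction t with
    | zero => exact fun _ => hstart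
    | succ t ih =>
      intro ht
      have hlt := hb.wild i t hi hik (by omega)
      rw [← Nat.add_assoc, hsplit]
      have hpow : (p : ℝ) ^ (m i - t) = p ^ (m i - (t + 1)) * p := by
        rw [← pow_succ]
        congr 1
        omega
      refine ultra_add_lt ?_ ?_
      · have := deviation_wild hR hc hκ hξ hlt (hb.ne_zero hR hc hk (by omega))
          (hclose (T + t) (by omega)) (ih (by omega))
        rw [hpow] at this
        rw [Function.iterate_succ_apply' f]
        calc _ < _ := this
          _ = _ := by field_simp; rfl
      · rw [hinj _ (hlt.trans (hR.one_lt hκ))]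
        have h1 := hz0 (T + t + 1) (by omega)
        have h2 : 1 ≤ (p : ℝ) ^ (m i - (t + 1)) := one_le_pow₀ hp1.le
        calc δ * ‖f^[T + t] x‖ * ‖f^[T + t + 1] x‖ < δ * 1 * ‖f^[T + t + 1] x‖ := by gcongr
          _ ≤ δ * (p : ℝ) ^ (m i - (t + 1)) * ‖f^[T + t + 1] x‖ := by gcongr
          _ = _ := by ring
  -- In `A` the relative deviation is bounded by the deviation created in the last step.
  have hstepA : ∀ t, t < n i → ‖f^[T + m i + t + 1] x‖ = radialGrowth p R ‖f^[T + m i + t] x‖ := by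
    intro t ht
    rw [Function.iterate_succ_apply']
    exact norm_entireMap_eq hR hc fun j _ => notMem_piece_A c (hb.transit i t hi hik ht) j
  have htransit : ∀ t < n i, ‖f'^[T + m i + t] x - f^[T + m i + t] x‖ <
      ‖f^[T + m i + t] x‖ * δ * ‖f^[T + m i + t] x‖ := by
    intro t
    induction t with
    | zero =>
      intro ht
      have h1 := hwild (m i) le_rfl
      have h2 := one_le_norm_of_piece_A c (hb.transit i 0 hi hik ht)
      rw [Nat.sub_self, pow_zero] at h1
      refine h1.trans_le ?_
      rw [Nat.add_zero] at h2 ⊢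
      gcongr
    | succ t ih =>
      intro ht
      have hA := hb.transit i t hi hik (by omega)
      have hlt := hb.norm_transit_lt hR hc hl hi hik (t := t) (by omega)
      have hgrow : ‖f^[T + m i + t] x‖ < ‖f^[T + m i + t + 1] x‖ := by
        rw [hstepA t (by omega)]
        exact hR.lt_growth (one_le_norm_of_piece_A c hA)
      have h0 := hz0 (T + m i + t) (by omega)
      have h1 := hz0 (T + m i + t + 1) (by omega)
      rw [← Nat.add_assoc, hsplit]
      refine ultra_add_lt ?_ ?_
      · have := deviation_A hR hc hκ hξ hA hlt (hclose1 (T + m i + t) (by omega)).le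
          (Q := ‖f^[T + m i + t + 1] x‖ * δ) ((ih (by omega)).trans (by gcongr))
        rwa [← hf', ← hf, ← Function.iterate_succ_apply' f] at this
      · rw [hinj _ hlt, mul_comm δ]
        gcongr
  -- The deviation created at the entry into `B_i` dominates.
  have hentry : ‖f'^[T + m i + n i] x - f^[T + m i + n i] x‖ = R i * growthInv p R (R i) * δ := by
    have hni := hn i hi
    have hA := hb.transit i (n i - 1) hi hik (by omega)
    have hlt := hb.norm_transit_lt hR hc hl hi hik (t := n i - 1) (by omega)
    have hS := hb.norm_transit hR hc hl hi hik (s := 1) hni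
    have hRn := hb.norm_transit hR hc hl hi hik (s := 0) (by omega)
    have h1 := hsplit (T + m i + (n i - 1))
    have h2 := hinj _ hlt
    have h3 := deviation_A hR hc hκ hξ hA hlt (hclose1 (T + m i + (n i - 1)) (by omega)).le
      (htransit (n i - 1) (by omega))
    rw [← hf', ← hf, ← Function.iterate_succ_apply' f] at h3
    rw [Nat.succ_eq_add_one] at h3
    have e : T + m i + (n i - 1) + 1 = T + m i + n i := by omega
    rw [mul_comm (‖f^[T + m i + (n i - 1)] x‖) δ, ← h2] at h3
    rw [e] at h1 h2
    rw [h1, add_comm, ultra_add_eq_left h3, h2]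
    rw [Nat.sub_zero, Function.iterate_zero, id] at hRn
    rw [Function.iterate_one] at hS
    rw [hS, hRn]
    ring
  -- In `B_i` all distances are multiplied by `Φ(R_i) / R_i`.
  have htame : ∀ t ≤ l (i + 1), ‖f'^[T + m i + n i + t] x - f^[T + m i + n i + t] x‖ =
      (radialGrowth p R (R i) / R i) ^ t * (R i * growthInv p R (R i) * δ) := by
    have hS0 := hR.growthInv_pos hRi
    have hΦS := hR.growth_growthInv hRi
    have hS1 : 1 ≤ growthInv p R (R i) := by
      refine hR.le_of_growth_le hS0.le ?_
      rw [hΦS, hR.growth_one]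
      exact (hR.prime_lt hi).le
    have hSR : growthInv p R (R i) < R i := by
      have := hR.lt_growth hS1
      rwa [hΦS] at this
    have hslope := hR.growth_div_lt hS0 hSR
    rw [hΦS, div_lt_iff₀ hS0] at hslope
    have hlam : 1 ≤ radialGrowth p R (R i) / R i := by
      rw [one_le_div hRi]
      exact (hR.lt_growth (hR.one_lt hi).le).le
    intro t
    induction t with
    | zero => intro _; rw [pow_zero, one_mul]; exact hentry
    | succ t ih =>
      intro ht
      have ih := ih (by omega)
      have hmem := hb.tame i t hi hik (by omega)
      have hnorm := norm_of_mem_diskB hc hi hmem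
      have hcl := hclose1 (T + m i + n i + t) (by omega)
      rw [← hf, ← hT] at hmem hnorm
      rw [hnorm] at hcl
      have hmem' : f'^[T + m i + n i + t] x ∈ diskB p R c i := by
        rw [mem_diskB_iff c hi] at hmem ⊢
        exact ultra_sub_trans_lt hcl hmem
      rw [← mem_diskB_update_iff c (κ := k + 1) (by omega) ξ] at hmem hmem'
      have h1 := norm_entireMap_sub_eq hR hc' hi hmem hmem'
      rw [← hf', ih, ← mul_assoc, ← pow_succ'] at h1
      have h2 := hinj (T + m i + n i + t) (by rw [hnorm]; exact hRik)
      have hnext : ‖f^[T + m i + n i + t + 1] x‖ ≤ R i := by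
        rcases Nat.lt_or_ge (t + 1) (l (i + 1)) with h | h
        · exact (norm_of_mem_diskB hc hi (hb.tame i (t + 1) hi hik h)).le
        · have e : T + m i + n i + t + 1 = blockStart m l n (i + 1) := by rw [hTs]; omega
          rw [e]
          rcases hik.eq_or_lt with rfl | hik'
          · exact (norm_of_mem_diskB hc hi hb.final).le
          · exact (hb.wild (i + 1) 0 (by omega) hik' (hm _ (by omega))).le.trans
              (hR.one_lt hi).le
      rw [← Nat.add_assoc, hsplit, ultra_add_eq_left, h1]
      rw [h1, h2, hnorm]
      have h3 : radialGrowth p R (R i) / R i ≤ (radialGrowth p R (R i) / R i) ^ (t + 1) :=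
        le_self_pow₀ hlam (by omega)
      calc δ * R i * ‖f^[T + m i + n i + t + 1] x‖ ≤ δ * R i * R i := by gcongr
        _ < δ * R i * (radialGrowth p R (R i) / R i * growthInv p R (R i)) := by gcongr
        _ = radialGrowth p R (R i) / R i * (R i * growthInv p R (R i) * δ) := by ring
        _ ≤ _ := by gcongr
  rw [hTs]
  exact htame _ le_rfl

/-- By transversality, the deviation at the beginning of each block is small enough for
`deviation_block`. -/
theorem deviation_start (hR : IsGenericRadii p R) (hc : c ∈ paramSpace p R) (hk : 1 ≤ k)
    (hb : HasBlocks p R c m l n k x) (hl : ∀ i, 1 ≤ i → 1 ≤ l (i + 1))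
    (hm : ∀ i, 1 ≤ i → 1 ≤ m i) (hn : ∀ i, 1 ≤ i → 1 ≤ n i)
    (htrans : ∀ i, 1 ≤ i → i < k → R i * growthInv p R (R i) *
      (radialGrowth p R (R i) / R i) ^ l (i + 1) < rho p ^ 2 * (p : ℝ) ^ m (i + 1))
    {ξ : ℂ_[p]} (hξ : ‖ξ‖ = R (k + 1)) {δ : ℝ} (hδ : ‖ξ⁻¹ - (c (k + 1))⁻¹‖ = δ) (hδ0 : 0 < δ)
    (hclose : ∀ j ≤ blockStart m l n (k + 1),
      ‖(entireMap p (Function.update c (k + 1) ξ))^[j] x - (entireMap p c)^[j] x‖ ≤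
        rho p * ‖(entireMap p c)^[j] x‖)
    {i : ℕ} (hi : 1 ≤ i) (hik : i ≤ k) :
    ‖(entireMap p (Function.update c (k + 1) ξ))^[blockStart m l n i] x -
      (entireMap p c)^[blockStart m l n i] x‖ <
        (p : ℝ) ^ m i * δ * ‖(entireMap p c)^[blockStart m l n i] x‖ := by
  have hp0 := prime_pos (p := p)
  induction i, hi using Nat.le_induction with
  | base =>
    have h0 := norm_pos_iff.2 (hb.ne_zero hR hc hk (j := 0) (Nat.zero_le _))
    rw [blockStart_one, Function.iterate_zero, Function.iterate_zero, sub_self, norm_zero]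
    positivity
  | succ i hi ih =>
    rw [hb.deviation_block hR hc hl hm hn hξ hδ hδ0 hclose hi (by omega) (ih (by omega))]
    have h1 := htrans i hi (by omega)
    have h2 := hb.rho_lt_norm hR hc (i := i + 1) (by omega) hik (hn _ (by omega))
    have hρ0 := rho_pos (p := p)
    have hρ1 := rho_lt_one (p := p)
    have h3 : rho p ^ 2 ≤ rho p := pow_le_of_le_one hρ0.le hρ1.le two_ne_zero
    calc _ = R i * growthInv p R (R i) * (radialGrowth p R (R i) / R i) ^ l (i + 1) * δ := by ring
      _ < rho p ^ 2 * (p : ℝ) ^ m (i + 1) * δ := by gcongr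
      _ = (p : ℝ) ^ m (i + 1) * δ * rho p ^ 2 := by ring
      _ ≤ _ := by
        gcongr
        exact h3.trans h2.le

end HasBlocks

end

/-! ### Parametrization by the fixed point -/

section

variable {p : ℕ} [hp : Fact p.Prime] {R : ℕ → ℝ} {c : ℕ → ℂ_[p]} {κ : ℕ}

/-- The inverse of the zero that `c_κ` has to be replaced with in order to make `y` a fixed
point. -/
noncomputable def fixingInv (p : ℕ) [Fact p.Prime] (c : ℕ → ℂ_[p]) (κ : ℕ) (y : ℂ_[p]) : ℂ_[p] :=
  y⁻¹ - (cofactor p c κ y)⁻¹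

/-- The parameter that differs from `c` only in the entry `κ` and for which `y` is a fixed
point. -/
noncomputable def fixingParam (p : ℕ) [Fact p.Prime] (c : ℕ → ℂ_[p]) (κ : ℕ) (y : ℂ_[p]) :
    ℕ → ℂ_[p] :=
  Function.update c κ (fixingInv p c κ y)⁻¹

theorem norm_cofactor_of_mem (hR : IsGenericRadii p R) (hc : c ∈ paramSpace p R) (hκ : 1 ≤ κ)
    {y : ℂ_[p]} (hy : y ∈ diskB p R c κ) :
    ‖cofactor p c κ y‖ = radialGrowth p R (R κ) := by
  have hn := norm_of_mem_diskB hc hκ hy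
  rw [norm_cofactor_eq hR hc hκ hn.le fun i => notMem_diskB_of_mem hR hc hκ hy, hn]

theorem norm_fixingInv (hR : IsGenericRadii p R) (hc : c ∈ paramSpace p R) (hκ : 1 ≤ κ)
    {y : ℂ_[p]} (hy : y ∈ diskB p R c κ) : ‖fixingInv p c κ y‖ = (R κ)⁻¹ := by
  have hRκ := hR.pos hκ
  have hΦ := hR.lt_growth (hR.one_lt hκ).le
  have h1 : ‖y⁻¹‖ = (R κ)⁻¹ := by rw [norm_inv, norm_of_mem_diskB hc hκ hy]
  rw [fixingInv, ultra_sub_eq_left, h1]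
  rw [h1, norm_inv, norm_cofactor_of_mem hR hc hκ hy]
  exact inv_strictAnti₀ hRκ hΦ

theorem norm_inv_fixingInv (hR : IsGenericRadii p R) (hc : c ∈ paramSpace p R) (hκ : 1 ≤ κ)
    {y : ℂ_[p]} (hy : y ∈ diskB p R c κ) : ‖(fixingInv p c κ y)⁻¹‖ = R κ := by
  rw [norm_inv, norm_fixingInv hR hc hκ hy, inv_inv]

theorem fixingParam_mem (hR : IsGenericRadii p R) (hc : c ∈ paramSpace p R) (hκ : 1 ≤ κ)
    {y : ℂ_[p]} (hy : y ∈ diskB p R c κ) : fixingParam p c κ y ∈ paramSpace p R :=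
  update_mem_paramSpace hc (norm_inv_fixingInv hR hc hκ hy)

theorem entireMap_fixingParam (hR : IsGenericRadii p R) (hc : c ∈ paramSpace p R) (hκ : 1 ≤ κ)
    (y z : ℂ_[p]) : entireMap p (fixingParam p c κ y) z =
      (1 - fixingInv p c κ y * z) * cofactor p c κ z := by
  rw [fixingParam, entireMap_update hR hc hκ, inv_inv]

theorem entireMap_fixingParam_self (hR : IsGenericRadii p R) (hc : c ∈ paramSpace p R)
    (hκ : 1 ≤ κ) {y : ℂ_[p]} (hy : y ∈ diskB p R c κ) :
    entireMap p (fixingParam p c κ y) y = y := by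
  have h0 : y ≠ 0 := by
    rw [← norm_pos_iff, norm_of_mem_diskB hc hκ hy]
    exact hR.pos hκ
  have hg : cofactor p c κ y ≠ 0 := by
    rw [← norm_pos_iff, norm_cofactor_of_mem hR hc hκ hy]
    exact hR.growth_pos (hR.pos hκ)
  rw [entireMap_fixingParam hR hc hκ, fixingInv]
  field_simp
  ring

theorem mem_diskB_fixingParam (hR : IsGenericRadii p R) (hc : c ∈ paramSpace p R) (hκ : 1 ≤ κ)
    {y : ℂ_[p]} (hy : y ∈ diskB p R c κ) : y ∈ diskB p R (fixingParam p c κ y) κ := by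
  have hn := norm_of_mem_diskB hc hκ hy
  refine mem_diskB_of_norm_lt hR (fixingParam_mem hR hc hκ hy) hκ hn ?_
  rw [entireMap_fixingParam_self hR hc hκ hy, hn]
  exact hR.lt_growth (hR.one_lt hκ).le

theorem fixingInv_of_fixed (hR : IsGenericRadii p R) (hc : c ∈ paramSpace p R)
    (hκ : 1 ≤ κ) {y : ℂ_[p]} (hy : y ∈ diskB p R c κ) (hfix : entireMap p c y = y) :
    fixingInv p c κ y = (c κ)⁻¹ := by
  have h0 : y ≠ 0 := by
    rw [← norm_pos_iff, norm_of_mem_diskB hc hκ hy]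
    exact hR.pos hκ
  have hg : cofactor p c κ y ≠ 0 := by
    rw [← norm_pos_iff, norm_cofactor_of_mem hR hc hκ hy]
    exact hR.growth_pos (hR.pos hκ)
  rw [entireMap_eq_cofactor hR hc hκ] at hfix
  have h1 : 1 - (c κ)⁻¹ * y = y / cofactor p c κ y := by
    rw [eq_div_iff hg, hfix]
  have h2 : (c κ)⁻¹ = (1 - y / cofactor p c κ y) / y := by
    rw [← h1]
    field_simp
    ring
  rw [h2, fixingInv]
  field_simp

theorem fixingParam_of_fixed (hR : IsGenericRadii p R) (hc : c ∈ paramSpace p R)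
    (hκ : 1 ≤ κ) {y : ℂ_[p]} (hy : y ∈ diskB p R c κ) (hfix : entireMap p c y = y) :
    fixingParam p c κ y = c := by
  rw [fixingParam, fixingInv_of_fixed hR hc hκ hy hfix, inv_inv, Function.update_eq_self]

/-- The parametrization by the fixed point is an isometry up to the factor `R_κ²`. -/
theorem norm_fixingInv_sub (hR : IsGenericRadii p R) (hc : c ∈ paramSpace p R) (hκ : 1 ≤ κ)
    {y y' : ℂ_[p]} (hy : y ∈ diskB p R c κ) (hy' : y' ∈ diskB p R c κ) :
    ‖fixingInv p c κ y' - fixingInv p c κ y‖ = ‖y' - y‖ / R κ ^ 2 := by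
  have hRκ := hR.pos hκ
  have hΦ := hR.lt_growth (hR.one_lt hκ).le
  have hΦ0 := hRκ.trans hΦ
  have hn := norm_of_mem_diskB hc hκ hy
  have hn' := norm_of_mem_diskB hc hκ hy'
  have hg := norm_cofactor_of_mem hR hc hκ hy
  have hg' := norm_cofactor_of_mem hR hc hκ hy'
  have hy0 : y ≠ 0 := by rw [← norm_pos_iff, hn]; exact hRκ
  have hy0' : y' ≠ 0 := by rw [← norm_pos_iff, hn']; exact hRκ
  have hg0 : cofactor p c κ y ≠ 0 := by rw [← norm_pos_iff, hg]; exact hΦ0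
  have hg0' : cofactor p c κ y' ≠ 0 := by rw [← norm_pos_iff, hg']; exact hΦ0
  rcases eq_or_ne y' y with rfl | hne
  · simp
  have hd0 : 0 < ‖y' - y‖ := norm_pos_iff.2 (sub_ne_zero.2 hne)
  have hdist : ‖y' - y‖ < R κ := by
    have := ultra_sub_lt ((mem_diskB_iff c hκ _).1 hy') ((mem_diskB_iff c hκ _).1 hy)
    rwa [sub_sub_sub_cancel_right] at this
  have hgd : ‖cofactor p c κ y' - cofactor p c κ y‖ ≤
      ‖y' - y‖ / R κ * radialGrowth p R (R κ) := by
    rw [← hg]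
    refine norm_cofactor_sub_le hR hc (fun i => notMem_diskB_of_mem hR hc hκ hy)
      (by positivity) ((div_le_one hRκ).2 hdist.le) ?_
    rw [hn, div_mul_cancel₀ _ hRκ.ne']
  have e : fixingInv p c κ y' - fixingInv p c κ y =
      -((y' - y) / (y' * y)) +
        (cofactor p c κ y' - cofactor p c κ y) / (cofactor p c κ y' * cofactor p c κ y) := by
    rw [fixingInv, fixingInv]
    field_simp
    ring
  have h1 : ‖-((y' - y) / (y' * y))‖ = ‖y' - y‖ / R κ ^ 2 := by
    rw [norm_neg, norm_div, norm_mul, hn, hn', sq]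
  rw [e, ultra_add_eq_left, h1]
  rw [h1, norm_div, norm_mul, hg, hg']
  calc _ ≤ ‖y' - y‖ / R κ * radialGrowth p R (R κ) /
        (radialGrowth p R (R κ) * radialGrowth p R (R κ)) := by gcongr
    _ = ‖y' - y‖ / (R κ * radialGrowth p R (R κ)) := by field_simp
    _ < ‖y' - y‖ / (R κ * R κ) := by gcongr
    _ = _ := by rw [sq]

theorem norm_fixingParam_sub (hR : IsGenericRadii p R) (hc : c ∈ paramSpace p R) (hκ : 1 ≤ κ)
    {w y : ℂ_[p]} (hw : w ∈ diskB p R c κ) (hfix : entireMap p c w = w)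
    (hy : y ∈ diskB p R c κ) : ‖fixingParam p c κ y κ - c κ‖ = ‖y - w‖ := by
  have hRκ := hR.pos hκ
  have h1 := norm_fixingInv_sub hR hc hκ hw hy
  rw [fixingInv_of_fixed hR hc hκ hw hfix] at h1
  have h2 := norm_fixingInv hR hc hκ hy
  have h0 : fixingInv p c κ y ≠ 0 := by
    rw [← norm_pos_iff, h2]
    positivity
  have hc0 := param_ne_zero hR hc hκ
  have e : fixingParam p c κ y κ - c κ =
      -((fixingInv p c κ y - (c κ)⁻¹) * ((fixingInv p c κ y)⁻¹ * c κ)) := by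
    rw [fixingParam, Function.update_self]
    field_simp
    ring
  rw [e, norm_neg, norm_mul, norm_mul, norm_inv, h1, h2, hc κ hκ]
  field_simp

theorem isAnalyticOnDisc_fixingInv (hR : IsGenericRadii p R) (hc : c ∈ paramSpace p R)
    (hκ : 1 ≤ κ) {w : ℂ_[p]} (hw : w ∈ diskB p R c κ) {r : ℝ} (hr : r < R κ) :
    IsAnalyticOnDisc w r (fixingInv p c κ) := by
  have hRκ := hR.pos hκ
  have hn := norm_of_mem_diskB hc hκ hw
  have hg := norm_cofactor_of_mem hR hc hκ hw
  have hw0 : w ≠ 0 := by rw [← norm_pos_iff, hn]; exact hRκ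
  have hg0 : cofactor p c κ w ≠ 0 := by
    rw [← norm_pos_iff, hg]; exact hR.growth_pos hRκ
  have hq : r / R κ < 1 := (div_lt_one hRκ).2 hr
  refine IsAnalyticOnDisc.sub (IsAnalyticOnDisc.id.inv hw0 hq fun s hs => ?_)
    ((isAnalyticOnDisc_cofactor hR hc κ IsAnalyticOnDisc.id).inv hg0 hq fun s hs => ?_)
  · rw [norm_sub_rev, hn, div_mul_cancel₀ _ hRκ.ne']
    exact hs
  · have hr0 : 0 ≤ r := (norm_nonneg _).trans hs
    rw [norm_sub_rev]
    refine norm_cofactor_sub_le hR hc (fun i => notMem_diskB_of_mem hR hc hκ hw)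
      (by positivity) hq.le ?_
    rw [hn, div_mul_cancel₀ _ hRκ.ne']
    exact hs

theorem isAnalyticOnDisc_fixingParam_iterate (hR : IsGenericRadii p R) (hc : c ∈ paramSpace p R)
    (hκ : 1 ≤ κ) {w : ℂ_[p]} (hw : w ∈ diskB p R c κ) {r : ℝ} (hr : r < R κ) (x : ℂ_[p])
    (j : ℕ) : IsAnalyticOnDisc w r fun y => (entireMap p (fixingParam p c κ y))^[j] x := by
  induction j with
  | zero => exact IsAnalyticOnDisc.const x
  | succ j ih =>
    simp only [Function.iterate_succ_apply', entireMap_fixingParam hR hc hκ]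
    exact ((IsAnalyticOnDisc.const 1).sub
      ((isAnalyticOnDisc_fixingInv hR hc hκ hw hr).mul ih)).mul
        (isAnalyticOnDisc_cofactor hR hc κ ih)

end

/-! ### Connecting orbits -/

/-- The point `f_{c(y)}^j(x)`, as a function of `y`, for the parameter `c(y)` that differs from `c`
only in the entry `κ` and has the fixed point `y`. -/
noncomputable def fixingOrbit (p : ℕ) [Fact p.Prime] (c : ℕ → ℂ_[p]) (κ : ℕ) (x : ℂ_[p]) (j : ℕ)
    (y : ℂ_[p]) : ℂ_[p] :=
  (entireMap p (fixingParam p c κ y))^[j] x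

section

variable {p : ℕ} [hp : Fact p.Prime] {R : ℕ → ℝ} {c : ℕ → ℂ_[p]} {m l n : ℕ → ℕ} {k : ℕ}
  {x w : ℂ_[p]}

theorem fixingOrbit_succ (c : ℕ → ℂ_[p]) (κ : ℕ) (x : ℂ_[p]) (j : ℕ) (y : ℂ_[p]) :
    fixingOrbit p c κ x (j + 1) y = entireMap p (fixingParam p c κ y) (fixingOrbit p c κ x j y) :=
  Function.iterate_succ_apply' _ _ _

theorem fixingOrbit_add (c : ℕ → ℂ_[p]) (κ : ℕ) (x : ℂ_[p]) (i j : ℕ) (y : ℂ_[p]) :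
    fixingOrbit p c κ x (i + j) y =
      (entireMap p (fixingParam p c κ y))^[i] (fixingOrbit p c κ x j y) :=
  Function.iterate_add_apply _ _ _ _

theorem fixingOrbit_eq_zero_of_le {κ i j : ℕ} {y : ℂ_[p]} (hij : i ≤ j)
    (h : fixingOrbit p c κ x i y = 0) : fixingOrbit p c κ x j y = 0 := by
  rw [← Nat.sub_add_cancel hij, fixingOrbit_add, h, entireMap_iterate_zero]

theorem mem_diskB_of_norm_sub_lt {κ : ℕ} (hκ : 1 ≤ κ) (hw : w ∈ diskB p R c κ) {y : ℂ_[p]}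
    (hy : ‖y - w‖ < R κ) : y ∈ diskB p R c κ := by
  rw [mem_diskB_iff c hκ] at hw ⊢
  exact ultra_sub_trans_lt hy hw

/-- If `ε` is large enough, then the orbit of `x` leaves `B_k` at time `blockStart (k + 1)`, for
suitable parameters in the `ε`-neighbourhood: otherwise the Schwarz lemma would bound the
expansion rate of the parameter dependence, which is known from `deviation_block`. -/
theorem HasBlocks.exists_norm_gt (hR : IsGenericRadii p R) (hc : c ∈ paramSpace p R) (hk : 1 ≤ k)
    (hb : HasBlocks p R c m l n k x) (hl : ∀ i, 1 ≤ i → 1 ≤ l (i + 1))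
    (hm : ∀ i, 1 ≤ i → 1 ≤ m i) (hn : ∀ i, 1 ≤ i → 1 ≤ n i)
    (htrans : ∀ i, 1 ≤ i → i < k → R i * growthInv p R (R i) *
      (radialGrowth p R (R i) / R i) ^ l (i + 1) < rho p ^ 2 * (p : ℝ) ^ m (i + 1))
    {ε : ℝ} (hε : ε ≤ R (k + 1))
    (hconn : R (k + 1) ^ 2 /
      (growthInv p R (R k) * (radialGrowth p R (R k) / R k) ^ l (k + 1)) < ε)
    (hw : w ∈ diskB p R c (k + 1)) (hfix : entireMap p c w = w) :
    ∃ r < ε, ∃ y, ‖y - w‖ ≤ r ∧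
      R k < ‖fixingOrbit p c (k + 1) x (blockStart m l n (k + 1)) y‖ := by
  have hκ : 1 ≤ k + 1 := by omega
  have hRk := hR.pos hk
  have hRκ := hR.pos hκ
  have hS := hR.growthInv_pos hRk
  have hΦ := hR.growth_pos hRk
  set A := growthInv p R (R k) * (radialGrowth p R (R k) / R k) ^ l (k + 1) with hA
  have hA0 : 0 < A := by positivity
  obtain ⟨r, hr1, hr2⟩ := exists_between hconn
  have hr0 : 0 < r := lt_trans (by positivity) hr1
  refine ⟨r, hr2, ?_⟩
  by_contra! hno
  have hana := isAnalyticOnDisc_fixingParam_iterate hR hc hκ hw (hr2.trans_le hε) x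
  have hwk : ∀ j, fixingOrbit p c (k + 1) x j w = (entireMap p c)^[j] x := fun j => by
    rw [fixingOrbit, fixingParam_of_fixed hR hc hκ hw hfix]
  -- For `y` close to `w` all deviations are small enough to compute the last one exactly.
  have hev : ∀ᶠ y in 𝓝[≠] w, (∀ j ∈ Finset.range (blockStart m l n (k + 1) + 1),
      ‖fixingOrbit p c (k + 1) x j y - fixingOrbit p c (k + 1) x j w‖ ≤
        rho p * ‖fixingOrbit p c (k + 1) x j w‖) ∧ ‖y - w‖ ≤ r ∧ y ≠ w := by
    refine Filter.Eventually.and ?_ (Filter.Eventually.and ?_ self_mem_nhdsWithin)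
    · refine eventually_nhdsWithin_of_eventually_nhds ?_
      refine (Filter.eventually_all_finset _).2 fun j hj => ?_
      have hpos : 0 < rho p * ‖fixingOrbit p c (k + 1) x j w‖ := by
        refine mul_pos rho_pos (norm_pos_iff.2 ?_)
        rw [hwk]
        exact hb.ne_zero hR hc hk (Nat.lt_succ_iff.1 (Finset.mem_range.1 hj))
      have hcont := (hana j).continuousAt (z := w) (by simpa using hr0)
      filter_upwards [hcont.eventually (Metric.closedBall_mem_nhds _ hpos)] with y hy
      rw [← dist_eq_norm]
      exact hy
    · refine eventually_nhdsWithin_of_eventually_nhds ?_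
      filter_upwards [Metric.closedBall_mem_nhds w hr0] with y hy
      rwa [← dist_eq_norm]
  obtain ⟨y, hclose, hyr, hyw⟩ := hev.exists
  have hd0 : 0 < ‖y - w‖ := norm_pos_iff.2 (sub_ne_zero.2 hyw)
  have hymem : y ∈ diskB p R c (k + 1) :=
    mem_diskB_of_norm_sub_lt hκ hw (hyr.trans_lt (hr2.trans_le hε))
  have hδ := norm_fixingInv_sub hR hc hκ hw hymem
  rw [fixingInv_of_fixed hR hc hκ hw hfix, ← inv_inv (fixingInv p c (k + 1) y)] at hδ
  have hξ := norm_inv_fixingInv hR hc hκ hymem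
  have hδ0 : 0 < ‖y - w‖ / R (k + 1) ^ 2 := by positivity
  have hclose' : ∀ j ≤ blockStart m l n (k + 1),
      ‖(entireMap p (Function.update c (k + 1) (fixingInv p c (k + 1) y)⁻¹))^[j] x -
        (entireMap p c)^[j] x‖ ≤ rho p * ‖(entireMap p c)^[j] x‖ := by
    intro j hj
    rw [← hwk j]
    exact hclose j (Finset.mem_range.2 (Nat.lt_succ_of_le hj))
  have hdev := hb.deviation_block hR hc hl hm hn hξ hδ hδ0 hclose' hk le_rfl
    (hb.deviation_start hR hc hk hl hm hn htrans hξ hδ hδ0 hclose' hk le_rfl)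
  have hschwarz := (hana (blockStart m l n (k + 1))).norm_sub_le_mul hr0 hRk (fun s hs => by
    refine (ultra_sub_le _ _).trans (max_le (hno s hs) (hno w (by simpa using hr0.le)))) hyr
  have e : (entireMap p (fixingParam p c (k + 1) w))^[blockStart m l n (k + 1)] x =
    (entireMap p c)^[blockStart m l n (k + 1)] x := hwk _
  rw [e] at hschwarz
  change ‖(entireMap p (fixingParam p c (k + 1) y))^[blockStart m l n (k + 1)] x -
    (entireMap p c)^[blockStart m l n (k + 1)] x‖ = _ at hdev
  rw [hdev, show (radialGrowth p R (R k) / R k) ^ l (k + 1) *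
    (R k * growthInv p R (R k) * (‖y - w‖ / R (k + 1) ^ 2)) =
      R k * ‖y - w‖ * (A / R (k + 1) ^ 2) by rw [hA]; ring] at hschwarz
  have h1 : A / R (k + 1) ^ 2 ≤ 1 / r := by
    have : 0 < R k * ‖y - w‖ := by positivity
    refine le_of_mul_le_mul_left (hschwarz.trans_eq ?_) this
    ring
  rw [div_le_div_iff₀ (by positivity) hr0] at h1
  rw [div_lt_iff₀ hA0] at hr1
  linarith

/-- There is a parameter for which the orbit of `x` follows the blocks up to `B_k` and is then
mapped to `0`.  On the whole disc of parameters up to this one, the norms of the orbit points are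
those of the original orbit. -/
theorem HasBlocks.exists_orbit_eq_zero (hR : IsGenericRadii p R) (hc : c ∈ paramSpace p R)
    (hk : 1 ≤ k) (hb : HasBlocks p R c m l n k x) (hl : 1 ≤ l (k + 1))
    {ε r : ℝ} (hε : ε ≤ R (k + 1)) (hw : w ∈ diskB p R c (k + 1)) (hfix : entireMap p c w = w)
    (hr : r < ε) {y' : ℂ_[p]} (hy' : ‖y' - w‖ ≤ r)
    (hbig : R k < ‖fixingOrbit p c (k + 1) x (blockStart m l n (k + 1)) y'‖) :
    ∃ s, ‖s - w‖ < ε ∧ fixingOrbit p c (k + 1) x (blockStart m l n (k + 1)) s = 0 ∧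
      ∀ y, ‖y - w‖ ≤ ‖s - w‖ →
        (∀ j < blockStart m l n (k + 1),
          ‖fixingOrbit p c (k + 1) x j y‖ = ‖(entireMap p c)^[j] x‖) ∧
        fixingOrbit p c (k + 1) x (blockStart m l n (k + 1) - 1) y ∈ diskB p R c k := by
  have hκ : 1 ≤ k + 1 := by omega
  have hRk := hR.pos hk
  have hΦ := hR.growth_pos hRk
  have hΦR := hR.lt_growth (hR.one_lt hk).le
  obtain ⟨r₁, hrr, hr₁⟩ := exists_between hr
  have hana : ∀ j, IsAnalyticOnDisc w r₁ (fixingOrbit p c (k + 1) x j) :=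
    isAnalyticOnDisc_fixingParam_iterate hR hc hκ hw (hr₁.trans_le hε) x
  have hwk : ∀ j, fixingOrbit p c (k + 1) x j w = (entireMap p c)^[j] x := fun j => by
    rw [fixingOrbit, fixingParam_of_fixed hR hc hκ hw hfix]
  set L := blockStart m l n (k + 1) with hL
  have hLk : L = blockStart m l n k + (m k + n k + l (k + 1)) := blockStart_succ m l n hk
  have hzL : ‖fixingOrbit p c (k + 1) x L w‖ = R k := by
    rw [hwk]
    exact norm_of_mem_diskB hc hk hb.final
  have hzL1 : ‖fixingOrbit p c (k + 1) x (L - 1) w‖ = R k := by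
    rw [hwk, show L - 1 = blockStart m l n k + m k + n k + (l (k + 1) - 1) by omega]
    exact norm_of_mem_diskB hc hk (hb.tame k _ hk le_rfl (by omega))
  have hmem : ∀ {y}, ‖y - w‖ < ε → y ∈ diskB p R c (k + 1) := fun hy =>
    mem_diskB_of_norm_sub_lt hκ hw (hy.trans_le hε)
  have hnz : fixingOrbit p c (k + 1) x L w ≠ 0 := by
    rw [← norm_pos_iff, hzL]
    exact hRk
  obtain ⟨s, hs, hs0, hconst⟩ := (hana L).exists_closest_zero hrr hnz hy'
    (by rw [hzL]; exact hbig.ne')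
  have hτ0 : 0 < ‖s - w‖ := by
    refine norm_pos_iff.2 (sub_ne_zero.2 ?_)
    rintro rfl
    exact hnz hs0
  have hτ : ‖s - w‖ < r₁ := hs.trans_lt hrr
  -- Zeros of earlier orbit points are zeros of the last one.
  have hopen : ∀ y, ‖y - w‖ < ‖s - w‖ → ∀ j ≤ L,
      ‖fixingOrbit p c (k + 1) x j y‖ = ‖fixingOrbit p c (k + 1) x j w‖ := by
    intro y hy j hj
    refine (hana j).norm_eq_of_ne_zero (hy.trans hτ) (fun t ht h0 => ?_) le_rfl
    have := hconst t (ht.trans_lt hy)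
    rw [fixingOrbit_eq_zero_of_le hj h0, norm_zero, hzL] at this
    exact hRk.ne this
  have hkκ : ∀ y, fixingParam p c (k + 1) y k = c k := fun y => by
    rw [fixingParam, Function.update_of_ne (by omega)]
  have hC0 : 0 < R k * R k / radialGrowth p R (R k) := by positivity
  have hC : R k * R k / radialGrowth p R (R k) < R k := by
    rw [div_lt_iff₀ hΦ]
    gcongr
  have hdist : ∀ y, ‖y - w‖ < ‖s - w‖ → ‖fixingOrbit p c (k + 1) x (L - 1) y - c k‖ ≤
      R k * R k / radialGrowth p R (R k) := by
    intro y hy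
    have hc' := fixingParam_mem hR hc hκ (hmem (hy.trans (hτ.trans hr₁)))
    have h1 := hopen y hy (L - 1) (by omega)
    have h2 := hopen y hy L le_rfl
    rw [hzL1] at h1
    rw [hzL, show L = L - 1 + 1 by omega, fixingOrbit_succ] at h2
    have h3 := mem_diskB_of_norm_lt hR hc' hk h1 (by rw [h2]; exact hΦR)
    rw [norm_entireMap_of_mem hR hc' hk h3, hkκ] at h2
    rw [le_div_iff₀ hΦ]
    rw [div_mul_eq_mul_div, div_eq_iff hRk.ne'] at h2
    linarith
  have hclosed : ∀ y, ‖y - w‖ ≤ ‖s - w‖ →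
      fixingOrbit p c (k + 1) x (L - 1) y ∈ diskB p R c k := by
    intro y hy
    rw [mem_diskB_iff c hk]
    exact ((((hana (L - 1)).mono hτ.le).sub (.const (c k))).norm_le_of_open hτ0 hC0 hdist
      hy).trans_lt hC
  refine ⟨s, hτ.trans hr₁, hs0, fun y hy => ⟨fun j hj => ?_, hclosed y hy⟩⟩
  rw [← hwk]
  refine (hana j).norm_eq_of_ne_zero hτ (fun t ht h0 => ?_) hy
  have := norm_of_mem_diskB hc hk (hclosed t ht)
  rw [fixingOrbit_eq_zero_of_le (by omega) h0, norm_zero] at this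
  exact hRk.ne this

/-- If the orbit of `x` is at `0` at time `L` for the parameter with fixed point `s`, and outside
the unit disc for another fixed point `w`, then some parameter with fixed point in the disc
`|y - s| ≤ |w - s|` sends `x` in `L + M` steps to its fixed point. -/
theorem exists_orbit_eq_fixed (hR : IsGenericRadii p R) (hc : c ∈ paramSpace p R) {κ : ℕ}
    (hκ : 1 ≤ κ) {s : ℂ_[p]} (hs : s ∈ diskB p R c κ) (hws : ‖w - s‖ < R κ) {L M : ℕ}
    (hs0 : fixingOrbit p c κ x L s = 0) (hwL : 1 ≤ ‖fixingOrbit p c κ x L w‖)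
    (hM : (growthInv p R)^[M] (R κ) < 1) :
    ∃ y, ‖y - s‖ ≤ ‖w - s‖ ∧ fixingOrbit p c κ x (L + M) y = y ∧
      ∀ i ≤ M, ‖fixingOrbit p c κ x (L + (M - i)) y‖ = (growthInv p R)^[i] (R κ) := by
  have hRκ := hR.pos hκ
  obtain ⟨r₁, hr, hr₁⟩ := exists_between hws
  have hana : ∀ i, IsAnalyticOnDisc s r₁ (fixingOrbit p c κ x (L + i)) := fun i =>
    isAnalyticOnDisc_fixingParam_iterate hR hc hκ hs hr₁ x (L + i)
  have hzero : ∀ i, fixingOrbit p c κ x (L + i) s = 0 := fun i =>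
    fixingOrbit_eq_zero_of_le (Nat.le_add_right L i) hs0
  have hmem : ∀ {y}, ‖y - s‖ ≤ ‖w - s‖ → y ∈ diskB p R c κ := fun hy =>
    mem_diskB_of_norm_sub_lt hκ hs (hy.trans_lt hws)
  have hback : ∀ {t : ℝ}, t ≤ ‖w - s‖ →
      (∀ y, ‖y - s‖ ≤ t → ‖fixingOrbit p c κ x (L + M) y‖ ≤ R κ) → ∀ i ≤ M, ∀ y, ‖y - s‖ ≤ t →
        ‖fixingOrbit p c κ x (L + (M - i)) y‖ ≤ (growthInv p R)^[i] (R κ) := by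
    intro t ht hle i hi y hy
    refine norm_le_growthInv_iterate hR (ht.trans_lt hr)
      (x := fun i y => fixingOrbit p c κ x (L + i) y) hana hzero ?_ hRκ hle hi hy
    intro i y hy hne
    rw [← Nat.add_assoc, fixingOrbit_succ]
    exact norm_entireMap_eq_of_norm_ne hR (fixingParam_mem hR hc hκ (hmem (hy.trans ht))) hne
  have hH := (hana M).sub IsAnalyticOnDisc.id
  have hHs : ‖fixingOrbit p c κ x (L + M) s - s‖ = R κ := by
    rw [hzero, zero_sub, norm_neg, norm_of_mem_diskB hc hκ hs]
  have hbound : ∀ {y}, ‖y - s‖ ≤ ‖w - s‖ → ‖fixingOrbit p c κ x (L + M) y - y‖ = R κ →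
      ‖fixingOrbit p c κ x (L + M) y‖ ≤ R κ := by
    intro y hy h
    have := ultra_add_le h.le (norm_of_mem_diskB hc hκ (hmem hy)).le
    rwa [sub_add_cancel] at this
  obtain ⟨y', hy', hne⟩ : ∃ y, ‖y - s‖ ≤ ‖w - s‖ ∧
      ‖fixingOrbit p c κ x (L + M) y - y‖ ≠ R κ := by
    by_contra! hno
    have := hback le_rfl (fun y hy => hbound hy (hno y hy)) M le_rfl w le_rfl
    rw [Nat.sub_self, Nat.add_zero] at this
    linarith
  obtain ⟨y, hy, hy0, hconst⟩ := hH.exists_closest_zero hr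
    (by rw [← norm_pos_iff, hHs]; exact hRκ) hy' (by rw [hHs]; exact hne)
  have hfix : fixingOrbit p c κ x (L + M) y = y := sub_eq_zero.1 hy0
  have ht0 : 0 < ‖y - s‖ := by
    refine norm_pos_iff.2 (sub_ne_zero.2 ?_)
    rintro rfl
    rw [hfix, sub_self, norm_zero] at hHs
    exact hRκ.ne hHs
  have hle : ∀ t, ‖t - s‖ ≤ ‖y - s‖ → ‖fixingOrbit p c κ x (L + M) t‖ ≤ R κ := fun t ht =>
    ((hana M).mono (hy.trans hr.le)).norm_le_of_open ht0 hRκ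
      (fun t ht => hbound (ht.le.trans hy) ((hconst t ht).trans hHs)) ht
  refine ⟨y, hy, hfix, fun i hi => le_antisymm (hback hy hle i hi y le_rfl) ?_⟩
  by_contra! hlt
  have := norm_iterate_lt hR (fixingParam_mem hR hc hκ (hmem hy)) hRκ hlt
  rw [← fixingOrbit_add, show i + (L + (M - i)) = L + M by omega, hfix,
    norm_of_mem_diskB hc hκ (hmem hy)] at this
  exact lt_irrefl _ this

end

/-! ### The new itinerary -/

section

variable {p : ℕ} [hp : Fact p.Prime] {R : ℕ → ℝ} {c c' : ℕ → ℂ_[p]} {m l n : ℕ → ℕ} {k : ℕ}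
  {x : ℂ_[p]}

/-- The norms of the orbit points determine the itinerary, apart from the last step in `B_k` and
the fixed point in `B_{k+1}` at which the orbit ends. -/
theorem hasItinerary_succ (hR : IsGenericRadii p R) (hc : c ∈ paramSpace p R)
    (hc' : c' ∈ paramSpace p R) (hk : 1 ≤ k) (hl : 1 ≤ l (k + 1))
    (hx : HasItinerary p R c x (padWord (truncWord m l n k) (Letter.B k)))
    (hpre : ∀ j < blockStart m l n (k + 1),
      ‖(entireMap p c')^[j] x‖ = ‖(entireMap p c)^[j] x‖)
    (hlast : (entireMap p c')^[blockStart m l n (k + 1) - 1] x ∈ diskB p R c' k)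
    (hnorm : ∀ i ≤ m (k + 1) + n (k + 1),
      ‖(entireMap p c')^[blockStart m l n (k + 1) + (m (k + 1) + n (k + 1) - i)] x‖ =
        (growthInv p R)^[i] (R (k + 1)))
    (hn : 1 ≤ (growthInv p R)^[n (k + 1)] (R (k + 1)))
    (hn' : (growthInv p R)^[n (k + 1) + 1] (R (k + 1)) < 1)
    {y : ℂ_[p]} (hy : y ∈ diskB p R c' (k + 1)) (hyfix : entireMap p c' y = y)
    (hend : (entireMap p c')^[blockStart m l n (k + 1) + (m (k + 1) + n (k + 1))] x = y) :
    HasItinerary p R c' x (padWord (truncWord m l n (k + 1)) (Letter.B (k + 1))) := by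
  have hRκ := hR.pos (j := k + 1) (by omega)
  intro j
  rw [padWord_truncWord]
  set L := blockStart m l n (k + 1) with hL
  have hLlen : (prefixWord m l n (k + 1)).length = L := rfl
  have hLk : L = blockStart m l n k + (m k + n k + l (k + 1)) := blockStart_succ m l n hk
  rcases lt_or_ge j L with hj | hj
  · rw [List.getD_append _ _ _ _ (hLlen ▸ hj)]
    rcases Nat.lt_or_ge (j + 1) L with hj1 | hj1
    · have hxj := hx j
      rw [padWord_truncWord_eq_prefixWord_succ m l n hk] at hxj
      rw [List.getD_eq_getElem _ _ (hLlen ▸ hj)] at hxj ⊢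
      refine mem_piece_of_norm_eq hR hc hc' hxj (hpre j hj) ?_
      have := hpre (j + 1) hj1
      rwa [Function.iterate_succ_apply', Function.iterate_succ_apply'] at this
    · have e : j = blockStart m l n k + (m k + n k + (l (k + 1) - 1)) := by omega
      have e' : j = L - 1 := by omega
      rw [← e'] at hlast
      have hB : (prefixWord m l n (k + 1)).getD j (Letter.B (k + 1)) = Letter.B k := by
        rw [e, getD_prefixWord_block m l n hk k.lt_succ_self (by omega),
          getD_block_B m l n (by omega)]
      rw [hB]
      exact hlast
  · rw [List.getD_append_right _ _ _ _ (hLlen ▸ hj), hLlen]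
    obtain ⟨t, rfl⟩ := Nat.exists_eq_add_of_le hj
    rw [Nat.add_sub_cancel_left]
    rcases Nat.lt_or_ge t (m (k + 1)) with ht | ht
    · rw [getD_wildWord_zero m n ht]
      have h := hnorm (m (k + 1) + n (k + 1) - t) (by omega)
      rw [Nat.sub_sub_self (by omega)] at h
      change _ ∈ diskB p R c' 0
      rw [mem_diskB_zero_iff, h]
      exact hR.growthInv_iterate_lt_one hRκ hn' (by omega)
    obtain ⟨t, rfl⟩ := Nat.exists_eq_add_of_le ht
    rcases Nat.lt_or_ge t (n (k + 1)) with ht' | ht'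
    · rw [getD_wildWord_A m n ht']
      have h := hnorm (n (k + 1) - t) (by omega)
      rw [show m (k + 1) + n (k + 1) - (n (k + 1) - t) = m (k + 1) + t by omega] at h
      intro hmem
      obtain ⟨i, hi⟩ := Set.mem_iUnion.1 hmem
      rcases Nat.eq_zero_or_pos i with rfl | hi0
      · rw [mem_diskB_zero_iff, h] at hi
        exact hi.not_ge (hR.one_le_growthInv_iterate hRκ hn (Nat.sub_le _ _))
      · exact hR.growthInv_iterate_ne hc hi0 (Nat.le_add_left 1 k)
          (by omega : 1 ≤ n (k + 1) - t) (h.symm.trans (norm_of_mem_diskB hc' hi0 hi))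
    · obtain ⟨t, rfl⟩ := Nat.exists_eq_add_of_le ht'
      rw [← Nat.add_assoc, getD_wildWord_default, ← Nat.add_assoc, Nat.add_comm _ t,
        Function.iterate_add_apply, hend, Function.iterate_fixed hyfix]
      exact hy

theorem radiusS_eq_growthInv (hR : IsGenericRadii p R) (hc : c ∈ paramSpace p R) {j : ℕ}
    (hj : 1 ≤ j) : radiusS p R c j = growthInv p R (R j) := by
  have h := radiusS_spec hR hc hj
  refine hR.growth_inj h.1.le (hR.growthInv_pos (hR.pos hj)).le ?_
  rw [h.2, hR.growth_growthInv (hR.pos hj)]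

theorem TransversalityAt.lt (hR : IsGenericRadii p R) (hc : c ∈ paramSpace p R)
    (h : TransversalityAt p R c m l k) {i : ℕ} (hi : 1 ≤ i) (hik : i < k) :
    R i * growthInv p R (R i) * (radialGrowth p R (R i) / R i) ^ l (i + 1) <
      rho p ^ 2 * (p : ℝ) ^ m (i + 1) := by
  have h1 := h (i + 1) (by omega) hik
  have hρ := rho_pos (p := p)
  have hpp := prime_pos (p := p)
  rw [Nat.add_sub_cancel, radiusS_eq_growthInv hR hc hi, norm_multiplier hR hc hi, zpow_neg,
    zpow_neg, zpow_natCast, ← div_eq_mul_inv, div_lt_one (by positivity), mul_assoc, mul_assoc,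
    inv_mul_lt_iff₀ (by positivity), ← mul_assoc] at h1
  exact_mod_cast h1

theorem ConnectingAt.lt (hR : IsGenericRadii p R) (hc : c ∈ paramSpace p R) (hk : 1 ≤ k)
    {ε : ℕ → ℝ} (h : ConnectingAt p R c ε l k) :
    R (k + 1) ^ 2 / (growthInv p R (R k) * (radialGrowth p R (R k) / R k) ^ l (k + 1)) <
      ε (k + 1) := by
  have hρ := rho_pos (p := p)
  have hS := hR.growthInv_pos (hR.pos hk)
  have hΦ := hR.growth_pos (hR.pos hk)
  have hRk := hR.pos hk
  have hpρ : 1 ≤ (p : ℝ) * (rho p)⁻¹ :=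
    one_le_mul_of_one_le_of_one_le one_lt_prime.le ((one_le_inv₀ hρ).2 rho_lt_one.le)
  rw [ConnectingAt, radiusS_eq_growthInv hR hc hk, norm_multiplier hR hc hk, zpow_neg,
    zpow_natCast, mul_assoc, ← div_eq_mul_inv (R (k + 1) ^ 2 / _), div_div] at h
  exact (le_mul_of_one_le_left (by positivity) hpρ).trans_lt h

end

theorem lemmal (p : ℕ) [Fact p.Prime] (R : ℕ → ℝ) (hR : IsGenericRadii p R)
    (ε : ℕ → ℝ) (l m : ℕ → ℕ)
    (hε : ∀ j, 1 ≤ j → 0 < ε j ∧ ε j < R j)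
    (hl : ∀ j, 2 ≤ j → 1 ≤ l j) (hm : ∀ j, 1 ≤ j → 1 ≤ m j)
    (k : ℕ) (hk : 1 ≤ k)
    (c : ℕ → ℂ_[p]) (hc : c ∈ paramSpace p R)
    (hstab : StabilityAt p R c ε l k)
    (htrans : TransversalityAt p R c m l k)
    (hconn : ConnectingAt p R c ε l k)
    (x : ℂ_[p])
    (hx : HasItinerary p R c x
      (padWord (truncWord m l (transitTime p R c) k) (Letter.B k))) :
    ∃ c' ∈ oneEntryNhd p R c (k + 1) (ε (k + 1)),
      HasItinerary p R c' x
        (padWord (truncWord m l (transitTime p R c) (k + 1)) (Letter.B (k + 1))) := by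
  have hκ : 1 ≤ k + 1 := by omega
  set n := transitTime p R c with hndef
  have hn : ∀ i, 1 ≤ i → 1 ≤ n i := fun i hi => (transitTime_spec hR hc hi).1
  have hl' : ∀ i, 1 ≤ i → 1 ≤ l (i + 1) := fun i hi => hl (i + 1) (by omega)
  obtain ⟨-, hnκ, hnκ'⟩ : _ ∧ 1 ≤ (growthInv p R)^[n (k + 1)] (R (k + 1)) ∧
      (growthInv p R)^[n (k + 1) + 1] (R (k + 1)) < 1 := transitTime_spec hR hc hκ
  obtain ⟨hw, hfix⟩ := fixedPt_spec hR hc hκ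
  set w := fixedPt p R c (k + 1)
  have hεR := (hε (k + 1) hκ).2
  have hb := hasBlocks_of_hasItinerary hk hx
  obtain ⟨r, hr, y', hy', hbig⟩ := hb.exists_norm_gt hR hc hk hl' hm hn
    (fun i hi hik => htrans.lt hR hc hi hik) hεR.le (hconn.lt hR hc hk) hw hfix
  obtain ⟨s, hs, hs0, hsall⟩ := hb.exists_orbit_eq_zero hR hc hk (hl' k hk) hεR.le hw hfix hr hy'
    hbig
  have hwL : 1 ≤ ‖fixingOrbit p c (k + 1) x (blockStart m l n (k + 1)) w‖ := by
    rw [fixingOrbit, fixingParam_of_fixed hR hc hκ hw hfix, norm_of_mem_diskB hc hk hb.final]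
    exact (hR.one_lt hk).le
  have hsmem := mem_diskB_of_norm_sub_lt hκ hw (hs.trans hεR)
  obtain ⟨y, hys, hyfix, hynorm⟩ := exists_orbit_eq_fixed hR hc hκ hsmem
    (by rw [norm_sub_rev]; exact hs.trans hεR) (M := m (k + 1) + n (k + 1)) hs0 hwL
    (hR.growthInv_iterate_lt_one (hR.pos hκ) hnκ' (by have := hm (k + 1) hκ; omega))
  have hyw : ‖y - w‖ ≤ ‖s - w‖ := by
    rw [norm_sub_rev w s] at hys
    exact ultra_sub_trans_le hys le_rfl
  have hymem := mem_diskB_of_norm_sub_lt hκ hw (hyw.trans_lt (hs.trans hεR))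
  have hc' := fixingParam_mem hR hc hκ hymem
  obtain ⟨hpre, hlast⟩ := hsall y hyw
  refine ⟨fixingParam p c (k + 1) y, ⟨hc', ?_, fun j _ hj => Function.update_of_ne hj _ _⟩, ?_⟩
  · rw [norm_fixingParam_sub hR hc hκ hw hfix hymem]
    exact hyw.trans_lt hs
  · exact hasItinerary_succ hR hc hc' hk (hl' k hk) hx hpre
      ((mem_diskB_update_iff c (by omega) _ _).2 hlast) hynorm hnκ hnκ'
      (mem_diskB_fixingParam hR hc hκ hymem) (entireMap_fixingParam_self hR hc hκ hymem) hyfix
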